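/- **Setting.** Let $H,\hat H$ be finite-dimensional complex Hilbert spaces, $H_0=H\oplus\hat H$, $\mathbf H=H\oplus\hat H\oplus H$ (elements $y=\{y_0,\hat y,y_1\}$), $J\{y_0,\hat y,y_1\}=\{-y_1,\,i\hat y,\,y_0\}$; inner products are linear in the first variable. Let $\mathcal I=[a,b\rangle$, $-\infty<a<b\le\infty$ (a finite $b$ may or may not belong to $\mathcal I$), and let $B=B^*$ and $\Delta\ge 0$ (a.e.) be operator functions on $\mathcal I$ with values in $[\mathbf H]$, integrable on each $[a,\beta]\subset\mathcal I$. Let $\mathcal L^2_\Delta$ be the space of Borel functions $f:\mathcal I\to\mathbf H$ with $\int_{\mathcal I}(\Delta f,f)\,dt<\infty$, and let $\mathrm{dom}\,\mathcal T_{\max}$ be the set of $y\in\mathcal L^2_\Delta$, absolutely continuous on each $[a,\beta]\subset\mathcal I$, with $Jy'-By=\Delta f$ a.e. for some $f\in\mathcal L^2_\Delta$. For $\lambda\in\mathbb C$ let $\mathcal N_\lambda$ be the space of solutions in $\mathcal L^2_\Delta$ of $$Jy'-B(t)y=\lambda\Delta(t)y .\qquad(1)$$ Assume that the system is definite: for every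 $\lambda\in\mathbb C$, a solution $y$ of (1) with $\Delta y=0$ a.e. is $0$. Then $\dim\mathcal N_\lambda$ is constant on each of $\mathbb C_+$ and $\mathbb C_-$ (the open upper and lower half-planes), with values $n_+$ and $n_-$ (the deficiency indices of the minimal relation). An $\mathcal L^2_\Delta$ operator solution of (1) is a function $Y(\cdot,\lambda):\mathcal I\to[K,\mathbf H]$ ($\dim K<\infty$) with $Y(\cdot,\lambda)h\in\mathcal N_\lambda$ for all $h\in K$; $Y(\lambda):K\to\mathcal N_\lambda$ denotes the map $h\mapsto Y(\cdot,\lambda)h$. *At $a$:* let $U=\begin{pmatrix}u_1&u_2&u_3\\u_4&u_5&u_6\end{pmatrix}:H\oplus\hat H\oplus H\to\hat H\oplus H$ be surjective with $iu_2u_2^*-u_1u_3^*+u_3u_1^*=iI_{\hat H}$, $iu_5u_2^*-u_4u_3^*+u_6u_1^*=0$, $iu_5u_5^*+u_6u_4^*-u_4u_6^*=0$; put $\hat\Gamma_a y=u_1y_0(a)+u_2\hat y(a)+u_3y_1(a)$, $\Gamma_{1a}y=u_4y_0(a)+u_5\hat y(a)+u_6y_1(a)$. *At $b$:* let $\tilde{\mathcal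 H}_b$ be a finite-dimensional Hilbert space, $\mathcal H_b\subset\tilde{\mathcal H}_b$ a subspace, $P_{\mathcal H_b}$ and $P^\perp$ the orthoprojectors in $\tilde{\mathcal H}_b$ onto $\mathcal H_b$ and onto its orthogonal complement, and $\Gamma_b=(\Gamma_{0b},\hat\Gamma_b,\Gamma_{1b}):\mathrm{dom}\,\mathcal T_{\max}\to\tilde{\mathcal H}_b\oplus\hat H\oplus\mathcal H_b$ a surjective linear map such that for all $y,z\in\mathrm{dom}\,\mathcal T_{\max}$ $$\lim_{t\uparrow b}(Jy(t),z(t))=(\Gamma_{0b}y,\Gamma_{1b}z)-(\Gamma_{1b}y,\Gamma_{0b}z)+i(P^\perp\Gamma_{0b}y,P^\perp\Gamma_{0b}z)+i(\hat\Gamma_by,\hat\Gamma_bz).$$ *Boundary parameter:* let $\tau=\{\tau_+,\tau_-\}\in\tilde R(\tilde{\mathcal H}_b,\mathcal H_b)$. That is, $\tau$ is given by holomorphic operator functions $C_0(\lambda)\in[\tilde{\mathcal H}_b]$, $C_1(\lambda)\in[\mathcal H_b,\tilde{\mathcal H}_b]$ on $\mathbb C_+$ and $D_0(\lambda)\in[\tilde{\mathcal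 H}_b,\mathcal H_b]$, $D_1(\lambda)\in[\mathcal H_b]$ on $\mathbb C_-$ such that, with $C_{01},D_{01}$ and $C_{02},D_{02}$ the restrictions of $C_0,D_0$ to $\mathcal H_b$ and to $\tilde{\mathcal H}_b\ominus\mathcal H_b$, and $\mathrm{Im}\,X=(X-X^*)/2i$: $2\,\mathrm{Im}(C_1C_{01}^*)+C_{02}C_{02}^*\ge0$ and $C_0-iC_1P_{\mathcal H_b}$ is invertible on $\mathbb C_+$; $2\,\mathrm{Im}(D_1D_{01}^*)+D_{02}D_{02}^*\le0$ and $D_{01}+iD_1$ is invertible on $\mathbb C_-$; and $C_1(\lambda)D_{01}^*(\bar\lambda)-C_{01}(\lambda)D_1^*(\bar\lambda)+iC_{02}(\lambda)D_{02}^*(\bar\lambda)=0$ for $\lambda\in\mathbb C_+$. Put $\tau_+(\lambda)=\{\{h_0,h_1\}\in\tilde{\mathcal H}_b\oplus\mathcal H_b:C_0(\lambda)h_0+C_1(\lambda)h_1=0\}$, $\lambda\in\mathbb C_+$; $\tau_+^*(\lambda)$ is the adjoint linear relation from $\mathcal H_b$ to $\tilde{\mathcal H}_b$. **Theorem 4.2.**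 For each $\lambda\in\mathbb C\setminus\mathbb R$ there is a unique $\mathcal L^2_\Delta$ operator solution $v_\tau(\cdot,\lambda):\mathcal I\to[H_0,\mathbf H]$ of (1) such that, with $P_H,P_{\hat H}$ the orthoprojectors in $H_0$ onto $H$ and $\hat H$, $$\Gamma_{1a}v_\tau(\lambda)=-P_H,\qquad i(\hat\Gamma_a-\hat\Gamma_b)v_\tau(\lambda)=P_{\hat H},\qquad(2)$$ $$C_0(\lambda)\Gamma_{0b}v_\tau(\lambda)+C_1(\lambda)\Gamma_{1b}v_\tau(\lambda)=0\ (\lambda\in\mathbb C_+),\qquad D_0(\lambda)\Gamma_{0b}v_\tau(\lambda)+D_1(\lambda)\Gamma_{1b}v_\tau(\lambda)=0\ (\lambda\in\mathbb C_-).\qquad(3)$$ Moreover, for each $\lambda\in\mathbb C\setminus\mathbb R$ there is a unique $\mathcal L^2_\Delta$ operator solution $v_0(\cdot,\lambda):\mathcal I\to[H_0,\mathbf H]$ of (1) that satisfies (2) and $\Gamma_{0b}v_0(\lambda)=0$ if $\lambda\in\mathbb C_+$, $P_{\mathcal H_b}\Gamma_{0b}v_0(\lambda)=0$ if $\lambda\in\mathbb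 C_-$; and there is a unique $\mathcal L^2_\Delta$ operator solution $u_+(\cdot,\lambda):\mathcal I\to[\tilde{\mathcal H}_b,\mathbf H]$ ($\lambda\in\mathbb C_+$), respectively $u_-(\cdot,\lambda):\mathcal I\to[\mathcal H_b,\mathbf H]$ ($\lambda\in\mathbb C_-$), of (1) with $\Gamma_{1a}u_\pm(\lambda)=0$, $i(\hat\Gamma_a-\hat\Gamma_b)u_\pm(\lambda)=0$ and $\Gamma_{0b}u_+(\lambda)=I_{\tilde{\mathcal H}_b}$, respectively $P_{\mathcal H_b}\Gamma_{0b}u_-(\lambda)=I_{\mathcal H_b}$. With $$M_{3+}=-\Gamma_{1b}v_0,\quad M_{4+}=-\Gamma_{1b}u_+\ \ (\lambda\in\mathbb C_+),\qquad M_{3-}=(-\Gamma_{1b}+iP^\perp\Gamma_{0b})v_0,\quad M_{4-}=(-\Gamma_{1b}+iP^\perp\Gamma_{0b})u_-\ \ (\lambda\in\mathbb C_-),$$ the inverse linear relations below are everywhere defined operators and $$v_\tau(t,\lambda)=v_0(t,\lambda)-u_+(t,\lambda)\,(\tau_+(\lambda)+M_{4+}(\lambda))^{-1}M_{3+}(\lambda),\quad\lambda\in\mathbb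 C_+,$$ $$v_\tau(t,\lambda)=v_0(t,\lambda)-u_-(t,\lambda)\,(\tau_+^*(\bar\lambda)+M_{4-}(\lambda))^{-1}M_{3-}(\lambda),\quad\lambda\in\mathbb C_-.$$ If in addition $n_+=n_-$, then $\tilde{\mathcal H}_b=\mathcal H_b$, and, writing $C_j(\lambda):=D_j(\lambda)$ for $\lambda\in\mathbb C_-$, $\tau$ is a Nevanlinna pair: $C_0,C_1:\mathbb C\setminus\mathbb R\to[\mathcal H_b]$ are holomorphic, $\mathrm{Im}\,\lambda\cdot\mathrm{Im}(C_1(\lambda)C_0^*(\lambda))\ge0$, $C_1(\lambda)C_0^*(\bar\lambda)-C_0(\lambda)C_1^*(\bar\lambda)=0$ for $\lambda\in\mathbb C\setminus\mathbb R$, and $C_0(\lambda)\mp iC_1(\lambda)$ is invertible for $\lambda\in\mathbb C_\pm$; the conditions (3) take the form $C_0(\lambda)\Gamma_{0b}v_\tau(\lambda)+C_1(\lambda)\Gamma_{1b}v_\tau(\lambda)=0$, $\lambda\in\mathbb C\setminus\mathbb R$. -/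

import Mathlib

open MeasureTheory Filter Set Topology

noncomputable section

/-- Finite-dimensional complex normed spaces are complete (made available to instance search, so
that adjoints of operators between finite-dimensional Hilbert spaces can be formed). -/
instance completeSpace_of_finiteDimensional_complex {E : Type*} [NormedAddCommGroup E]
    [NormedSpace ℂ E] [FiniteDimensional ℂ E] : CompleteSpace E :=
  FiniteDimensional.complete ℂ E

/-! ### Operators and linear relations -/

/-- The imaginary part `(X - X*) / (2i)` of an operator. -/
def opIm {E : Type*} [NormedAddCommGroup E] [InnerProductSpace ℂ E] [FiniteDimensional ℂ E]
    (X : E →L[ℂ] E) : E →L[ℂ] E :=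
  (2 * Complex.I)⁻¹ • (X - ContinuousLinearMap.adjoint X)

/-- The sum `T + M = {{x, y + M x} : {x, y} ∈ T}` of a linear relation and an operator. -/
def relAddOp {E F : Type*} [AddCommGroup E] [Module ℂ E] [AddCommGroup F] [Module ℂ F]
    (T : Submodule ℂ (E × F)) (M : E →ₗ[ℂ] F) : Submodule ℂ (E × F) :=
  T.map ((LinearMap.fst ℂ E F).prod (LinearMap.snd ℂ E F + M ∘ₗ LinearMap.fst ℂ E F))

/-- The inverse `{{y, x} : {x, y} ∈ T}` of a linear relation. -/
def relInv {E F : Type*} [AddCommGroup E] [Module ℂ E] [AddCommGroup F] [Module ℂ F]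
    (T : Submodule ℂ (E × F)) : Submodule ℂ (F × E) :=
  T.map (LinearEquiv.prodComm ℂ E F : (E × F) →ₗ[ℂ] (F × E))

/-! ### Holomorphic operator pairs -/

/-- A collection `τ = {τ₊, τ₋}` of the class `R̃(𝓗₀, 𝓗₁)`, where `𝓗₁` is a subspace of the
finite-dimensional Hilbert space `𝓗₀` and `𝓗₂ = 𝓗₀ ⊖ 𝓗₁`, given by representing holomorphic pairs
`(C₀(λ), C₁(λ)) : 𝓗₀ ⊕ 𝓗₁ → 𝓗₀`, `λ ∈ ℂ₊`, and `(D₀(λ), D₁(λ)) : 𝓗₀ ⊕ 𝓗₁ → 𝓗₁`, `λ ∈ ℂ₋`.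
The values of the functions outside the indicated half-planes play no role.  The blocks of
`C₀ = (C₀₁, C₀₂)` and `D₀ = (D₀₁, D₀₂)` are the restrictions to `𝓗₁` and `𝓗₂`. -/
structure BoundaryParameter {E : Type*} [NormedAddCommGroup E] [InnerProductSpace ℂ E]
    [FiniteDimensional ℂ E] (E₁ : Submodule ℂ E) where
  C₀ : ℂ → (E →L[ℂ] E)
  C₁ : ℂ → (E₁ →L[ℂ] E)
  D₀ : ℂ → (E →L[ℂ] E₁)
  D₁ : ℂ → (E₁ →L[ℂ] E₁)
  holo_C₀ : DifferentiableOn ℂ C₀ {z | 0 < z.im}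
  holo_C₁ : DifferentiableOn ℂ C₁ {z | 0 < z.im}
  holo_D₀ : DifferentiableOn ℂ D₀ {z | z.im < 0}
  holo_D₁ : DifferentiableOn ℂ D₁ {z | z.im < 0}
  /-- `2 Im (C₁ C₀₁*) + C₀₂ C₀₂* ≥ 0` on `ℂ₊`. -/
  nonneg_C : ∀ z : ℂ, 0 < z.im →
    ((2 : ℂ) • opIm (C₁ z ∘L ContinuousLinearMap.adjoint (C₀ z ∘L E₁.subtypeL)) +
      (C₀ z ∘L E₁ᗮ.subtypeL) ∘L
        ContinuousLinearMap.adjoint (C₀ z ∘L E₁ᗮ.subtypeL)).IsPositive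
  /-- `2 Im (D₁ D₀₁*) + D₀₂ D₀₂* ≤ 0` on `ℂ₋`. -/
  nonpos_D : ∀ z : ℂ, z.im < 0 →
    (-((2 : ℂ) • opIm (D₁ z ∘L ContinuousLinearMap.adjoint (D₀ z ∘L E₁.subtypeL)) +
      (D₀ z ∘L E₁ᗮ.subtypeL) ∘L
        ContinuousLinearMap.adjoint (D₀ z ∘L E₁ᗮ.subtypeL))).IsPositive
  /-- `C₁(λ) D₀₁*(λ̄) - C₀₁(λ) D₁*(λ̄) + i C₀₂(λ) D₀₂*(λ̄) = 0` on `ℂ₊`. -/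
  symm_CD : ∀ z : ℂ, 0 < z.im →
    C₁ z ∘L ContinuousLinearMap.adjoint (D₀ (starRingEnd ℂ z) ∘L E₁.subtypeL) -
      (C₀ z ∘L E₁.subtypeL) ∘L ContinuousLinearMap.adjoint (D₁ (starRingEnd ℂ z)) +
      Complex.I • ((C₀ z ∘L E₁ᗮ.subtypeL) ∘L
        ContinuousLinearMap.adjoint (D₀ (starRingEnd ℂ z) ∘L E₁ᗮ.subtypeL)) = 0
  /-- `0 ∈ ρ(C₀ - i C₁ P₁)` on `ℂ₊`. -/
  isUnit_C : ∀ z : ℂ, 0 < z.im →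
    IsUnit (C₀ z - Complex.I • (C₁ z ∘L E₁.orthogonalProjectionOnto))
  /-- `0 ∈ ρ(D₀₁ + i D₁)` on `ℂ₋`. -/
  isUnit_D : ∀ z : ℂ, z.im < 0 →
    IsUnit (D₀ z ∘L E₁.subtypeL + Complex.I • D₁ z)

namespace BoundaryParameter

variable {E : Type*} [NormedAddCommGroup E] [InnerProductSpace ℂ E] [FiniteDimensional ℂ E]
  {E₁ : Submodule ℂ E}

/-- The linear relation `τ₊(λ) = {{h₀, h₁} ∈ 𝓗₀ ⊕ 𝓗₁ : C₀(λ) h₀ + C₁(λ) h₁ = 0}`, `λ ∈ ℂ₊`. -/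
def relPlus (τ : BoundaryParameter E₁) (z : ℂ) : Submodule ℂ (E × E₁) :=
  LinearMap.ker ((τ.C₀ z).toLinearMap.coprod (τ.C₁ z).toLinearMap)

/-- The first component of the single pair on `𝓗₁`, defined for all non-real `λ`, into which the
collection turns when `𝓗₁ = 𝓗₀`. -/
def pair₀ (τ : BoundaryParameter E₁) (z : ℂ) : E₁ →L[ℂ] E₁ :=
  if 0 < z.im then E₁.orthogonalProjectionOnto ∘L τ.C₀ z ∘L E₁.subtypeL
  else τ.D₀ z ∘L E₁.subtypeL

/-- The second component of the single pair on `𝓗₁`, defined for all non-real `λ`, into which the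
collection turns when `𝓗₁ = 𝓗₀`. -/
def pair₁ (τ : BoundaryParameter E₁) (z : ℂ) : E₁ →L[ℂ] E₁ :=
  if 0 < z.im then E₁.orthogonalProjectionOnto ∘L τ.C₁ z
  else τ.D₁ z

end BoundaryParameter

/-- Nevanlinna operator pairs `τ(λ) = {(C₀(λ), C₁(λ)); 𝓗}`, `λ ∈ ℂ \ ℝ`: the class `R̃(𝓗)`. -/
structure IsNevanlinnaPair {E : Type*} [NormedAddCommGroup E] [InnerProductSpace ℂ E]
    [FiniteDimensional ℂ E] (C₀ C₁ : ℂ → (E →L[ℂ] E)) : Prop where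
  holo₀ : DifferentiableOn ℂ C₀ {z | z.im ≠ 0}
  holo₁ : DifferentiableOn ℂ C₁ {z | z.im ≠ 0}
  nonneg : ∀ z : ℂ, z.im ≠ 0 →
    ((z.im : ℂ) • opIm (C₁ z ∘L ContinuousLinearMap.adjoint (C₀ z))).IsPositive
  symm : ∀ z : ℂ, z.im ≠ 0 →
    C₁ z ∘L ContinuousLinearMap.adjoint (C₀ (starRingEnd ℂ z)) -
      C₀ z ∘L ContinuousLinearMap.adjoint (C₁ (starRingEnd ℂ z)) = 0
  isUnit_plus : ∀ z : ℂ, 0 < z.im → IsUnit (C₀ z - Complex.I • C₁ z)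
  isUnit_minus : ∀ z : ℂ, z.im < 0 → IsUnit (C₀ z + Complex.I • C₁ z)

/-! ### The spaces `H₀ = H ⊕ Ĥ` and `H₀ ⊕ H = H ⊕ Ĥ ⊕ H` -/

/-- The Hilbert space `H₀ = H ⊕ Ĥ`. -/
abbrev HZero (H Hh : Type*) : Type _ := WithLp 2 (H × Hh)

/-- The Hilbert space `𝐇 = (H ⊕ Ĥ) ⊕ H` in which the system acts.  The components of
`x = {x₀, x̂, x₁}` are `x.fst.fst`, `x.fst.snd` and `x.snd`. -/
abbrev PhaseSpace (H Hh : Type*) : Type _ := WithLp 2 (HZero H Hh × H)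

section Spaces

variable {H Hh : Type*} [NormedAddCommGroup H] [InnerProductSpace ℂ H] [FiniteDimensional ℂ H]
  [NormedAddCommGroup Hh] [InnerProductSpace ℂ Hh] [FiniteDimensional ℂ Hh]

/-- The signature operator `J {x₀, x̂, x₁} = {-x₁, i x̂, x₀}`. -/
def sigJ : PhaseSpace H Hh →ₗ[ℂ] PhaseSpace H Hh where
  toFun x := WithLp.toLp 2 (WithLp.toLp 2 (-x.snd, Complex.I • x.fst.snd), x.fst.fst)
  map_add' x y := by
    apply WithLp.ofLp_injective
    refine Prod.ext ?_ rfl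
    apply WithLp.ofLp_injective
    refine Prod.ext ?_ ?_
    · change -(x.snd + y.snd) = -x.snd + -y.snd
      abel
    · change Complex.I • (x.fst.snd + y.fst.snd) = Complex.I • x.fst.snd + Complex.I • y.fst.snd
      rw [smul_add]
  map_smul' c x := by
    apply WithLp.ofLp_injective
    refine Prod.ext ?_ rfl
    apply WithLp.ofLp_injective
    refine Prod.ext ?_ ?_
    · change -(c • x.snd) = c • (-x.snd)
      rw [smul_neg]
    · change Complex.I • (c • x.fst.snd) = c • (Complex.I • x.fst.snd)
      rw [smul_comm]

variable (H Hh) in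
/-- The data of a boundary condition at the regular endpoint: an operator
`U = (u₁ u₂ u₃; u₄ u₅ u₆) : H ⊕ Ĥ ⊕ H → Ĥ ⊕ H` with `ran U = Ĥ ⊕ H` and
`i u₂ u₂* - u₁ u₃* + u₃ u₁* = i I`, `i u₅ u₂* - u₄ u₃* + u₆ u₁* = 0`,
`i u₅ u₅* + u₆ u₄* - u₄ u₆* = 0`. -/
structure LeftOperator where
  u₁ : H →L[ℂ] Hh
  u₂ : Hh →L[ℂ] Hh
  u₃ : H →L[ℂ] Hh
  u₄ : H →L[ℂ] H
  u₅ : Hh →L[ℂ] H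
  u₆ : H →L[ℂ] H
  surj : ∀ (p : Hh) (q : H), ∃ (x₀ : H) (xh : Hh) (x₁ : H),
    u₁ x₀ + u₂ xh + u₃ x₁ = p ∧ u₄ x₀ + u₅ xh + u₆ x₁ = q
  rel₁ : Complex.I • (u₂ ∘L ContinuousLinearMap.adjoint u₂) -
    u₁ ∘L ContinuousLinearMap.adjoint u₃ + u₃ ∘L ContinuousLinearMap.adjoint u₁ =
      Complex.I • ContinuousLinearMap.id ℂ Hh
  rel₂ : Complex.I • (u₅ ∘L ContinuousLinearMap.adjoint u₂) -
    u₄ ∘L ContinuousLinearMap.adjoint u₃ + u₆ ∘L ContinuousLinearMap.adjoint u₁ = 0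
  rel₃ : Complex.I • (u₅ ∘L ContinuousLinearMap.adjoint u₅) +
    u₆ ∘L ContinuousLinearMap.adjoint u₄ - u₄ ∘L ContinuousLinearMap.adjoint u₆ = 0

namespace LeftOperator

/-- The first row `u₁ x₀ + u₂ x̂ + u₃ x₁` of `U`. -/
def rowHat (U : LeftOperator H Hh) (x : PhaseSpace H Hh) : Hh :=
  U.u₁ x.fst.fst + U.u₂ x.fst.snd + U.u₃ x.snd

/-- The second row `u₄ x₀ + u₅ x̂ + u₆ x₁` of `U`. -/
def rowOne (U : LeftOperator H Hh) (x : PhaseSpace H Hh) : H :=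
  U.u₄ x.fst.fst + U.u₅ x.fst.snd + U.u₆ x.snd

end LeftOperator

end Spaces

/-! ### Symmetric systems -/

/-- Local integrability on `I ∋ a`: integrability over every segment `[a, β] ⊆ I`. -/
def LocIntegrableFrom {F : Type*} [NormedAddCommGroup F] (a : ℝ) (I : Set ℝ) (f : ℝ → F) : Prop :=
  AEStronglyMeasurable f (volume.restrict I) ∧ ∀ β ∈ I, IntegrableOn f (Icc a β) volume

/-- Absolute continuity on every segment `[a, β] ⊆ I`. -/
def LocAbsCont {F : Type*} [NormedAddCommGroup F] (a : ℝ) (I : Set ℝ) (y : ℝ → F) : Prop :=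
  ∀ β ∈ I, AbsolutelyContinuousOnInterval y a β

/-- A symmetric system `J y' - B(t) y = Δ(t) f` on an interval `I = [a, b⟩`, `-∞ < a < b ≤ ∞`.
If `b < ∞`, the endpoint `b` may belong to `I` or not. -/
structure SymmetricSystem (H Hh : Type*)
    [NormedAddCommGroup H] [InnerProductSpace ℂ H] [FiniteDimensional ℂ H]
    [NormedAddCommGroup Hh] [InnerProductSpace ℂ Hh] [FiniteDimensional ℂ Hh] where
  a : ℝ
  b : EReal
  hab : (a : EReal) < b
  I : Set ℝ
  hI : I = {t : ℝ | a ≤ t ∧ (t : EReal) < b} ∨ I = {t : ℝ | a ≤ t ∧ (t : EReal) ≤ b}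
  B : ℝ → (PhaseSpace H Hh →L[ℂ] PhaseSpace H Hh)
  Δ : ℝ → (PhaseSpace H Hh →L[ℂ] PhaseSpace H Hh)
  locInt_B : LocIntegrableFrom a I B
  locInt_Δ : LocIntegrableFrom a I Δ
  selfAdjoint_B : ∀ᵐ t ∂volume.restrict I, IsSelfAdjoint (B t)
  nonneg_Δ : ∀ᵐ t ∂volume.restrict I, (Δ t).IsPositive

namespace SymmetricSystem

variable {H Hh : Type*} [NormedAddCommGroup H] [InnerProductSpace ℂ H] [FiniteDimensional ℂ H]
  [NormedAddCommGroup Hh] [InnerProductSpace ℂ Hh] [FiniteDimensional ℂ Hh]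

/-- The filter `t ↑ b`. -/
def leftNhdsB (S : SymmetricSystem H Hh) : Filter ℝ :=
  comap (fun t : ℝ => (t : EReal)) (𝓝[<] S.b)

/-- `J y' - B y = Δ f` almost everywhere on `I`. -/
def SatisfiesEq (S : SymmetricSystem H Hh) (y f : ℝ → PhaseSpace H Hh) : Prop :=
  ∀ᵐ t ∂volume.restrict S.I,
    ∃ y' : PhaseSpace H Hh, HasDerivAt y y' t ∧ sigJ y' - S.B t (y t) = S.Δ t (f t)

/-- The system is definite: for each `λ ∈ ℂ`, a solution `y` of `J y' - B y = λ Δ y` with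
`Δ y = 0` a.e. on `I` vanishes on `I`. -/
def IsDefinite (S : SymmetricSystem H Hh) : Prop :=
  ∀ (z : ℂ) (y : ℝ → PhaseSpace H Hh), LocAbsCont S.a S.I y → S.SatisfiesEq y (z • y) →
    (∀ᵐ t ∂volume.restrict S.I, S.Δ t (y t) = 0) → ∀ t ∈ S.I, y t = 0

theorem form_add_le {E : Type*} [NormedAddCommGroup E] [InnerProductSpace ℂ E]
    {A : E →L[ℂ] E} (hA : A.IsPositive) (x y : E) :
    (inner ℂ (A (x + y)) (x + y)).re ≤
      2 * (inner ℂ (A x) x).re + 2 * (inner ℂ (A y) y).re := by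
  have h : 0 ≤ (inner ℂ (A (x - y)) (x - y)).re := hA.2 (x - y)
  simp only [map_add, map_sub, inner_add_left, inner_add_right, inner_sub_left, inner_sub_right,
    Complex.add_re, Complex.sub_re] at h ⊢
  linarith

/-- The space `𝓛²_Δ(I)` of Borel functions `f` on `I` with `∫_I (Δ(t) f(t), f(t)) dt < ∞`.
Functions on `I` are identified with their extensions by zero to `ℝ`. -/
def L2 (S : SymmetricSystem H Hh) : Submodule ℂ (ℝ → PhaseSpace H Hh) where
  carrier := {f | (∀ t, t ∉ S.I → f t = 0) ∧ StronglyMeasurable f ∧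
    IntegrableOn (fun t => (inner ℂ (S.Δ t (f t)) (f t)).re) S.I volume}
  zero_mem' := by
    refine ⟨fun _ _ => rfl, stronglyMeasurable_zero, ?_⟩
    simp
  add_mem' := by
    rintro f g ⟨hf0, hfm, hfi⟩ ⟨hg0, hgm, hgi⟩
    refine ⟨fun t ht => by simp [hf0 t ht, hg0 t ht], hfm.add hgm, ?_⟩
    have hm : AEStronglyMeasurable
        (fun t => (inner ℂ (S.Δ t ((f + g) t)) ((f + g) t)).re) (volume.restrict S.I) := by
      have h1 : AEStronglyMeasurable (fun t => (f + g) t) (volume.restrict S.I) :=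
        (hfm.add hgm).aestronglyMeasurable
      have h2 : AEStronglyMeasurable (fun t => S.Δ t ((f + g) t)) (volume.restrict S.I) :=
        (isBoundedBilinearMap_apply (𝕜 := ℂ)).continuous.comp_aestronglyMeasurable
          (S.locInt_Δ.1.prodMk h1)
      exact Complex.continuous_re.comp_aestronglyMeasurable (h2.inner h1)
    refine Integrable.mono' ((hfi.const_mul 2).add (hgi.const_mul 2)) hm ?_
    filter_upwards [S.nonneg_Δ] with t ht
    have h0 : 0 ≤ (inner ℂ (S.Δ t ((f + g) t)) ((f + g) t)).re := ht.2 _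
    rw [Real.norm_of_nonneg h0]
    exact form_add_le ht (f t) (g t)
  smul_mem' := by
    rintro c f ⟨hf0, hfm, hfi⟩
    refine ⟨fun t ht => by simp [hf0 t ht], hfm.const_smul c, ?_⟩
    refine (hfi.const_mul (‖c‖ ^ 2)).congr (Eventually.of_forall fun t => ?_)
    simp only [Pi.smul_apply, map_smul, inner_smul_left, inner_smul_right]
    rw [← mul_assoc, Complex.mul_conj', ← Complex.ofReal_pow, Complex.re_ofReal_mul]

/-- The maximal relation `t_max = {{y, f} ∈ (𝓛²_Δ)² : y ∈ AC, J y' - B y = Δ f a.e. on I}`. -/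
def tMax (S : SymmetricSystem H Hh) :
    Submodule ℂ ((ℝ → PhaseSpace H Hh) × (ℝ → PhaseSpace H Hh)) where
  carrier := {p | p.1 ∈ S.L2 ∧ p.2 ∈ S.L2 ∧ LocAbsCont S.a S.I p.1 ∧ S.SatisfiesEq p.1 p.2}
  zero_mem' := by
    refine ⟨S.L2.zero_mem, S.L2.zero_mem, fun β _ => ?_, ?_⟩
    · simpa [AbsolutelyContinuousOnInterval] using tendsto_const_nhds
    · refine Eventually.of_forall fun t => ⟨0, hasDerivAt_const t 0, ?_⟩
      simp
  add_mem' := by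
    rintro p q ⟨hp1, hp2, hp3, hp4⟩ ⟨hq1, hq2, hq3, hq4⟩
    refine ⟨S.L2.add_mem hp1 hq1, S.L2.add_mem hp2 hq2,
      fun β hβ => (hp3 β hβ).add (hq3 β hβ), ?_⟩
    filter_upwards [hp4, hq4] with t ⟨y', hy, ey⟩ ⟨z', hz, ez⟩
    refine ⟨y' + z', hy.add hz, ?_⟩
    simp only [Prod.fst_add, Prod.snd_add, Pi.add_apply, map_add]
    rw [← ey, ← ez]
    abel
  smul_mem' := by
    rintro c p ⟨hp1, hp2, hp3, hp4⟩
    refine ⟨S.L2.smul_mem c hp1, S.L2.smul_mem c hp2, fun β hβ => (hp3 β hβ).const_smul c, ?_⟩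
    filter_upwards [hp4] with t ⟨y', hy, ey⟩
    refine ⟨c • y', hy.const_smul c, ?_⟩
    simp only [Prod.smul_fst, Prod.smul_snd, Pi.smul_apply, map_smul]
    rw [← ey, smul_sub]

/-- The domain `dom t_max`. -/
def domMax (S : SymmetricSystem H Hh) : Submodule ℂ (ℝ → PhaseSpace H Hh) :=
  S.tMax.map (LinearMap.fst ℂ _ _)

/-- The space `𝓝_λ = {y : {y, λ y} ∈ t_max}` of solutions of `J y' - B y = λ Δ y` that belong to
`𝓛²_Δ(I)`. -/
def solSpace (S : SymmetricSystem H Hh) (z : ℂ) : Submodule ℂ (ℝ → PhaseSpace H Hh) :=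
  S.tMax.comap (LinearMap.id.prod (z • LinearMap.id))

theorem solSpace_le_domMax (S : SymmetricSystem H Hh) (z : ℂ) : S.solSpace z ≤ S.domMax :=
  fun y hy => ⟨(y, z • y), hy, rfl⟩

/-- The number of linearly independent `𝓛²_Δ`-solutions of `J y' - B y = λ Δ y`.  For a definite
system and `λ ∈ ℂ₊` (`λ ∈ ℂ₋`) it is the deficiency index `n₊` (`n₋`) of the minimal relation. -/
def deficiency (S : SymmetricSystem H Hh) (z : ℂ) : ℕ := Module.finrank ℂ (S.solSpace z)

/-- Operator solutions `Y(·, λ) : I → [K, 𝐇]` of `J y' - B y = λ Δ y` that belong to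
`𝓛²_Δ[K, 𝐇]`: for each `h ∈ K` the function `Y(·, λ) h` is a solution from `𝓛²_Δ(I)`. -/
@[ext]
structure OpSolution (S : SymmetricSystem H Hh) (z : ℂ) (K : Type*)
    [NormedAddCommGroup K] [InnerProductSpace ℂ K] where
  fn : ℝ → (K →L[ℂ] PhaseSpace H Hh)
  mem : ∀ h : K, (fun t => fn t h) ∈ S.solSpace z

/-- The linear map `Y(λ) : K → 𝓝_λ ⊆ dom t_max`, `h ↦ Y(·, λ) h`. -/
def OpSolution.lin {S : SymmetricSystem H Hh} {z : ℂ} {K : Type*} [NormedAddCommGroup K]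
    [InnerProductSpace ℂ K] (Y : S.OpSolution z K) : K →ₗ[ℂ] S.domMax where
  toFun h := ⟨fun t => Y.fn t h, S.solSpace_le_domMax z (Y.mem h)⟩
  map_add' h k := Subtype.ext (funext fun t => map_add (Y.fn t) h k)
  map_smul' c h := Subtype.ext (funext fun t => map_smul (Y.fn t) c h)

/-! ### Boundary mappings and boundary conditions -/

/-- The mapping `Γ̂_a y = u₁ y₀(a) + u₂ ŷ(a) + u₃ y₁(a)`. -/
def gammaHatA (S : SymmetricSystem H Hh) (U : LeftOperator H Hh) (y : S.domMax) : Hh :=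
  U.rowHat ((y : ℝ → PhaseSpace H Hh) S.a)

/-- The mapping `Γ_{1a} y = u₄ y₀(a) + u₅ ŷ(a) + u₆ y₁(a)`. -/
def gammaOneA (S : SymmetricSystem H Hh) (U : LeftOperator H Hh) (y : S.domMax) : H :=
  U.rowOne ((y : ℝ → PhaseSpace H Hh) S.a)

/-- A surjective linear mapping `Γ_b = (Γ_{0b}, Γ̂_b, Γ_{1b}) : dom t_max → E ⊕ Ĥ ⊕ E₁`, where
`E₁` is a subspace of the finite-dimensional Hilbert space `E`, which represents the boundary form
`[y, z]_b = lim_{t ↑ b} (J y(t), z(t))` as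
`(Γ_{0b} y, Γ_{1b} z) - (Γ_{1b} y, Γ_{0b} z) + i (P Γ_{0b} y, P Γ_{0b} z) + i (Γ̂_b y, Γ̂_b z)`,
`P` being the orthoprojector in `E` onto `E ⊖ E₁`.  (The inner products of the mathematical text
are linear in the first variable, hence the interchange of arguments in `inner`.) -/
structure RightMap (S : SymmetricSystem H Hh) {E : Type*} [NormedAddCommGroup E]
    [InnerProductSpace ℂ E] [FiniteDimensional ℂ E] (E₁ : Submodule ℂ E) where
  Γ₀ : S.domMax →ₗ[ℂ] E
  Γh : S.domMax →ₗ[ℂ] Hh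
  Γ₁ : S.domMax →ₗ[ℂ] E₁
  surj : Function.Surjective fun y => (Γ₀ y, Γh y, Γ₁ y)
  form : ∀ y z : S.domMax,
    Tendsto (fun t => inner ℂ ((z : ℝ → PhaseSpace H Hh) t)
        (sigJ ((y : ℝ → PhaseSpace H Hh) t))) S.leftNhdsB
      (𝓝 (inner ℂ (Γ₁ z : E) (Γ₀ y) - inner ℂ (Γ₀ z) (Γ₁ y : E) +
        Complex.I * inner ℂ (E₁ᗮ.starProjection (Γ₀ z)) (E₁ᗮ.starProjection (Γ₀ y)) +
        Complex.I * inner ℂ (Γh z) (Γh y)))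

section Conditions

variable {S : SymmetricSystem H Hh} {E : Type*} [NormedAddCommGroup E] [InnerProductSpace ℂ E]
  [FiniteDimensional ℂ E] {E₁ : Submodule ℂ E} {z : ℂ}

/-- `Γ_{1a} v(λ) = -P_H` and `i (Γ̂_a - Γ̂_b) v(λ) = P_Ĥ`, where `P_H` and `P_Ĥ` are the
orthoprojectors in `H₀ = H ⊕ Ĥ` onto `H` and `Ĥ`. -/
def HasUnitLeftData (U : LeftOperator H Hh) (Γ : S.RightMap E₁)
    (v : S.OpSolution z (HZero H Hh)) : Prop :=
  ∀ h : HZero H Hh, S.gammaOneA U (v.lin h) = -h.fst ∧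
    Complex.I • (S.gammaHatA U (v.lin h) - Γ.Γh (v.lin h)) = h.snd

/-- `Γ_{1a} u(λ) = 0` and `i (Γ̂_a - Γ̂_b) u(λ) = 0`. -/
def HasZeroLeftData (U : LeftOperator H Hh) (Γ : S.RightMap E₁) {K : Type*}
    [NormedAddCommGroup K] [InnerProductSpace ℂ K] (u : S.OpSolution z K) : Prop :=
  ∀ h : K, S.gammaOneA U (u.lin h) = 0 ∧
    Complex.I • (S.gammaHatA U (u.lin h) - Γ.Γh (u.lin h)) = 0

/-- The boundary condition at `b`: `C₀(λ) Γ_{0b} v(λ) + C₁(λ) Γ_{1b} v(λ) = 0` if `λ ∈ ℂ₊`, and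
`D₀(λ) Γ_{0b} v(λ) + D₁(λ) Γ_{1b} v(λ) = 0` if `λ ∈ ℂ₋`. -/
def SatisfiesRight (τ : BoundaryParameter E₁) (Γ : S.RightMap E₁) {K : Type*}
    [NormedAddCommGroup K] [InnerProductSpace ℂ K] (v : S.OpSolution z K) : Prop :=
  (0 < z.im → ∀ h : K, τ.C₀ z (Γ.Γ₀ (v.lin h)) + τ.C₁ z (Γ.Γ₁ (v.lin h)) = 0) ∧
  (z.im < 0 → ∀ h : K, τ.D₀ z (Γ.Γ₀ (v.lin h)) + τ.D₁ z (Γ.Γ₁ (v.lin h)) = 0)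

/-- The defining conditions of `v_τ(·, λ)`. -/
def IsVTau (U : LeftOperator H Hh) (Γ : S.RightMap E₁) (τ : BoundaryParameter E₁)
    (v : S.OpSolution z (HZero H Hh)) : Prop :=
  HasUnitLeftData U Γ v ∧ SatisfiesRight τ Γ v

/-- The defining conditions of `v₀(·, λ)`: those at `a` above, and `Γ_{0b} v₀(λ) = 0` if `λ ∈ ℂ₊`,
`P_{E₁} Γ_{0b} v₀(λ) = 0` if `λ ∈ ℂ₋`. -/
def IsVZero (U : LeftOperator H Hh) (Γ : S.RightMap E₁)
    (v : S.OpSolution z (HZero H Hh)) : Prop :=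
  HasUnitLeftData U Γ v ∧
  (0 < z.im → ∀ h, Γ.Γ₀ (v.lin h) = 0) ∧
  (z.im < 0 → ∀ h, E₁.orthogonalProjectionOnto (Γ.Γ₀ (v.lin h)) = 0)

/-- The defining conditions of `u₊(·, λ)`, `λ ∈ ℂ₊`, with `Γ_{0b} u₊(λ) = I`. -/
def IsUPlus (U : LeftOperator H Hh) (Γ : S.RightMap E₁) (u : S.OpSolution z E) : Prop :=
  HasZeroLeftData U Γ u ∧ ∀ h : E, Γ.Γ₀ (u.lin h) = h

/-- The defining conditions of `u₋(·, λ)`, `λ ∈ ℂ₋`, with `P_{E₁} Γ_{0b} u₋(λ) = I`. -/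
def IsUMinus (U : LeftOperator H Hh) (Γ : S.RightMap E₁) (u : S.OpSolution z E₁) : Prop :=
  HasZeroLeftData U Γ u ∧ ∀ h : E₁, E₁.orthogonalProjectionOnto (Γ.Γ₀ (u.lin h)) = h

/-- `-Γ_{1b} Y(λ)`: this is `M_{3+}(λ)` for `Y = v₀` and `M_{4+}(λ)` for `Y = u₊`. -/
def weylPlus (Γ : S.RightMap E₁) {K : Type*} [NormedAddCommGroup K] [InnerProductSpace ℂ K]
    (Y : S.OpSolution z K) : K →ₗ[ℂ] E₁ :=
  -(Γ.Γ₁ ∘ₗ Y.lin)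

/-- `(-Γ_{1b} + i P_{E ⊖ E₁} Γ_{0b}) Y(λ)`: this is `M_{3-}(λ)` for `Y = v₀` and `M_{4-}(λ)` for
`Y = u₋`. -/
def weylMinus (Γ : S.RightMap E₁) {K : Type*} [NormedAddCommGroup K] [InnerProductSpace ℂ K]
    (Y : S.OpSolution z K) : K →ₗ[ℂ] E :=
  (-(E₁.subtype ∘ₗ Γ.Γ₁) +
    Complex.I • (E₁ᗮ.starProjection.toLinearMap ∘ₗ Γ.Γ₀)) ∘ₗ Y.lin

end Conditions

end SymmetricSystem

end

noncomputable section

set_option linter.unusedSectionVars false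

/-! ### Linear differential equations with integrable coefficients on a compact segment -/

section

/-! ### Absolutely continuous functions with values in a normed space -/

section AbsolutelyContinuous

variable {X Y Z : Type*} [PseudoMetricSpace X] [PseudoMetricSpace Y] [PseudoMetricSpace Z]

/-! The theorem rests on an energy identity and a dimension count.

Let `y ∈ 𝓝_λ` satisfy `Γ_{1a} y = 0` and `Γ̂_a y = Γ̂_b y`. Green's formula on `[a, t]` with `t ↑ b`
gives `2 Im λ ∫ (Δ y, y) = 2 Im (Γ_{0b} y, Γ_{1b} y) + ‖P^⊥ Γ_{0b} y‖²`
(`two_im_mul_integral_quad`), since the hat terms at the two ends cancel. If a condition at `b`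
makes `Im λ` times the right side nonpositive, then `Δ y = 0` a.e., and definiteness forces `y = 0`.
This applies to `Γ_{0b} y = 0` in `ℂ₊`, to `P Γ_{0b} y = 0` in `ℂ₋`, and to the conditions of `τ` by
`relPlus_dissipative` and `relMinus_accumulative`. Each such condition, taken with the data at `a`,
is thus an injective map on `𝓝_λ`, so `dim 𝓝_λ` is at most `dim H + dim Ĥ + dim E` in `ℂ₊` and `dim
H + dim Ĥ + dim E₁` in `ℂ₋`.

For the reverse inequality, `y ↦ (y(a), Γ_b y)` is onto on `dom t_max` (`exists_mem_domMax_apply_a`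
and surjectivity of `Γ_b`), and every element of the domain is a sum of solutions at `λ` and `λ̄` up
to a function with zero boundary values (`exists_eq_add_add`). Hence the two dimensions together are
at least the sum of the two upper bounds, and both bounds are attained. The injective maps are
therefore bijective, which yields every existence and uniqueness claim at once
(`IsRegularAt.existsUnique`). Equality of the deficiency indices then means `dim E = dim E₁`.

The decomposition is obtained from compact segments, without the theory of unbounded relations. The
function `(t_max - λ̄) y` is projected onto the solutions at `λ` on growing segments, a convergent
subsequence is chosen, and the remainders are solved for by functions vanishing at both ends, whose
energies are uniformly bounded.

In the formulas for `v_τ`, regularity of the condition of `τ` makes `τ + M` injective, a dimension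
count makes its inverse everywhere defined, and `v₀ - u x` with `x = (τ + M)⁻¹ M₃ h` satisfies the
conditions that determine `v_τ h`. -/

theorem AbsolutelyContinuousOnInterval.of_dist_le_add {f : ℝ → X} {g : ℝ → Y} {h : ℝ → Z}
    {a b : ℝ} (hg : AbsolutelyContinuousOnInterval g a b)
    (hh : AbsolutelyContinuousOnInterval h a b) {C D : ℝ}
    (hf : ∀ s ∈ uIcc a b, ∀ t ∈ uIcc a b,
      dist (f s) (f t) ≤ C * dist (g s) (g t) + D * dist (h s) (h t)) :
    AbsolutelyContinuousOnInterval f a b := by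
  unfold AbsolutelyContinuousOnInterval at hg hh
  refine squeeze_zero' ?_ ?_ (by simpa using (hg.const_mul C).add (hh.const_mul D))
  · exact Eventually.of_forall fun _ => Finset.sum_nonneg fun i hi => dist_nonneg
  rw [eventually_inf_principal]
  filter_upwards with ⟨n, I⟩ hnI
  simp only [Finset.mul_sum, ← Finset.sum_add_distrib]
  refine Finset.sum_le_sum fun i hi => ?_
  exact hf _ (hnI.1 i hi).1 _ (hnI.1 i hi).2

variable {F : Type*} [NormedAddCommGroup F] [NormedSpace ℝ F]

/-- Increments of the primitive of `f` are bounded by those of the primitive of `‖f‖`, which reduces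
the claim to real functions. The second comparison function enters with coefficient 0. -/
theorem IntervalIntegrable.absolutelyContinuousOnInterval_integral {f : ℝ → F} {a b : ℝ}
    (hf : IntervalIntegrable f volume a b) :
    AbsolutelyContinuousOnInterval (fun x => ∫ v in a..x, f v) a b := by
  have hn := hf.norm.absolutelyContinuousOnInterval_intervalIntegral (c := a) (by simp)
  refine hn.of_dist_le_add hn (C := 1) (D := 0) fun s hs t ht => ?_
  have hs' : IntervalIntegrable f volume a s :=
    hf.mono_set (uIcc_subset_uIcc left_mem_uIcc hs)
  have ht' : IntervalIntegrable f volume a t :=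
    hf.mono_set (uIcc_subset_uIcc left_mem_uIcc ht)
  rw [dist_comm, dist_comm (∫ v in a..s, ‖f v‖), dist_eq_norm, dist_eq_norm,
    intervalIntegral.integral_interval_sub_left ht' hs',
    intervalIntegral.integral_interval_sub_left ht'.norm hs'.norm, zero_mul, add_zero, one_mul]
  exact intervalIntegral.norm_integral_le_abs_integral_norm

variable [CompleteSpace F]

/-- The fundamental theorem of calculus for absolutely continuous vector functions. -/
theorem AbsolutelyContinuousOnInterval.integral_eq_sub_of_ae_hasDerivAt {f f' : ℝ → F} {a b : ℝ}
    (hf : AbsolutelyContinuousOnInterval f a b) (hi : IntervalIntegrable f' volume a b)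
    (hd : ∀ᵐ x, x ∈ uIcc a b → HasDerivAt f (f' x) x) :
    ∫ x in a..b, f' x = f b - f a := by
  -- After the primitive of `f'` is subtracted the derivative is 0 almost everywhere, so the
  -- difference is constant.
  have hg : AbsolutelyContinuousOnInterval (fun x => f x - ∫ t in a..x, f' t) a b :=
    hf.fun_sub hi.absolutelyContinuousOnInterval_integral
  obtain ⟨C, hC⟩ := hg.const_of_ae_hasDerivAt_zero (by
    filter_upwards [hd, hi.ae_hasDerivAt_integral] with x h₁ h₂ hx
    simpa using (h₁ hx).fun_sub (h₂ hx a left_mem_uIcc))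
  have h1 := hC a left_mem_uIcc
  have h2 := hC b right_mem_uIcc
  simp only [intervalIntegral.integral_same, sub_zero] at h1
  rw [← h1] at h2
  rw [← h2]; abel

theorem AbsolutelyContinuousOnInterval.fun_pow {f : ℝ → ℝ} {a b : ℝ}
    (hf : AbsolutelyContinuousOnInterval f a b) (n : ℕ) :
    AbsolutelyContinuousOnInterval (fun x => f x ^ (n + 1)) a b := by
  induction n with
  | zero => simpa using hf
  | succ n ih => simpa only [pow_succ _ (n + 1)] using ih.fun_mul hf

/-- The quotient `(∫ k) ^ (n + 1) / (n + 1)` is absolutely continuous and has the integrand as its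
derivative a.e. This is the source of the factorials in the Picard estimate when `k` is only
integrable. -/
theorem integral_mul_primitive_pow {k : ℝ → ℝ} {a b : ℝ} (hk : IntervalIntegrable k volume a b)
    (n : ℕ) :
    ∫ s in a..b, k s * (∫ r in a..s, k r) ^ n = (∫ r in a..b, k r) ^ (n + 1) / (n + 1) := by
  have hm := hk.absolutelyContinuousOnInterval_integral
  have h := ((hm.fun_pow n).const_mul ((n + 1 : ℝ)⁻¹)).integral_eq_sub_of_ae_hasDerivAt
    (f' := fun s => k s * (∫ r in a..s, k r) ^ n) ?_ ?_
  · rw [h]; simp; ring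
  · cases n with
    | zero => simpa using hk
    | succ n => exact hk.mul_continuousOn (hm.fun_pow n).continuousOn
  · filter_upwards [hk.ae_hasDerivAt_integral] with x hx hx'
    convert! ((hx hx' a left_mem_uIcc).pow (n + 1)).const_mul ((n + 1 : ℝ)⁻¹) using 1
    push_cast
    field_simp

end AbsolutelyContinuous

/-! ### Linear Carathéodory differential equations -/

section LinearODE

variable {F : Type*} [NormedAddCommGroup F] [NormedSpace ℂ F]

theorem IntervalIntegrable.clm_apply_continuousOn {A : ℝ → F →L[ℂ] F} {y : ℝ → F} {a b : ℝ}
    (hA : IntervalIntegrable A volume a b) (hy : ContinuousOn y (uIcc a b)) :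
    IntervalIntegrable (fun s => A s (y s)) volume a b := by
  obtain ⟨C, hC⟩ := isCompact_uIcc.exists_bound_of_continuousOn hy
  have hm : AEStronglyMeasurable y (volume.restrict (uIoc a b)) :=
    (hy.aestronglyMeasurable_of_isCompact isCompact_uIcc measurableSet_uIcc).mono_measure
      (Measure.restrict_mono uIoc_subset_uIcc le_rfl)
  refine (hA.norm.const_mul C).mono_fun ?_ ?_
  · exact (isBoundedBilinearMap_apply (𝕜 := ℂ)).continuous.comp_aestronglyMeasurable
      (hA.aestronglyMeasurable_restrict_uIoc.prodMk hm)
  · filter_upwards [ae_restrict_mem measurableSet_uIoc] with s hs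
    have h1 := hC s (uIoc_subset_uIcc hs)
    have h0 : 0 ≤ C := (norm_nonneg _).trans h1
    rw [Real.norm_of_nonneg (by positivity), mul_comm]
    exact (A s).le_of_opNorm_le_of_le le_rfl h1

variable {a b : ℝ} (hab : a ≤ b) (A : ℝ → F →L[ℂ] F) (f : ℝ → F)

/-- The Picard operator of `y' = A y + f`, `y a = x`. -/
def picardMap (hA : IntervalIntegrable A volume a b) (hf : IntervalIntegrable f volume a b)
    (x : F) (y : C(Icc a b, F)) : C(Icc a b, F) where
  toFun t := x + ∫ s in a..t, (A s (IccExtend hab y s) + f s)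
  continuous_toFun := by
    have h : ContinuousOn (fun t => ∫ s in a..t, (A s (IccExtend hab y s) + f s)) (uIcc a b) :=
      ((hA.clm_apply_continuousOn y.continuous.Icc_extend'.continuousOn).add
        hf).absolutelyContinuousOnInterval_integral.continuousOn
    rw [uIcc_of_le hab] at h
    exact continuous_const.add h.domRestrict

variable {A f}

/-- Each Picard step integrates the previous bound against `‖A‖`; the forcing term cancels in the
difference. -/
theorem norm_picardMap_iterate_sub_le (hA : IntervalIntegrable A volume a b)
    (hf : IntervalIntegrable f volume a b) (x : F) (y w : C(Icc a b, F)) (n : ℕ) (t : Icc a b) :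
    ‖(picardMap hab A f hA hf x)^[n] y t - (picardMap hab A f hA hf x)^[n] w t‖ ≤
      (∫ s in a..t, ‖A s‖) ^ n / n.factorial * dist y w := by
  induction n generalizing t with
  | zero => simpa [dist_eq_norm] using (y - w).norm_coe_le_norm t
  | succ n ih =>
    set u := (picardMap hab A f hA hf x)^[n] y
    set v := (picardMap hab A f hA hf x)^[n] w
    have hsub : uIcc a (t : ℝ) ⊆ uIcc a b :=
      uIcc_subset_uIcc left_mem_uIcc (by rw [uIcc_of_le hab]; exact t.2)
    have hA' := hA.mono_set hsub
    have hi : ∀ q : C(Icc a b, F),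
        IntervalIntegrable (fun s => A s (IccExtend hab q s) + f s) volume a t := fun q =>
      (hA'.clm_apply_continuousOn q.continuous.Icc_extend'.continuousOn).add (hf.mono_set hsub)
    rw [Function.iterate_succ_apply', Function.iterate_succ_apply']
    change ‖(x + ∫ s in a..t, (A s (IccExtend hab u s) + f s)) -
      (x + ∫ s in a..t, (A s (IccExtend hab v s) + f s))‖ ≤ _
    rw [add_sub_add_left_eq_sub, ← intervalIntegral.integral_sub (hi u) (hi v)]
    have hpow : IntervalIntegrable (fun s => ‖A s‖ * (∫ r in a..s, ‖A r‖) ^ n) volume a t := by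
      refine hA'.norm.mul_continuousOn ?_
      exact hA'.norm.absolutelyContinuousOnInterval_integral.continuousOn.pow n
    calc _ ≤ ∫ s in a..t, ‖A s‖ * (∫ r in a..s, ‖A r‖) ^ n * (dist y w / n.factorial) := by
          refine intervalIntegral.norm_integral_le_of_norm_le t.2.1 ?_ (hpow.mul_const _)
          refine Eventually.of_forall fun s hs => ?_
          have hs' : s ∈ Icc a b := ⟨hs.1.le, hs.2.trans t.2.2⟩
          rw [add_sub_add_right_eq_sub, ← map_sub, IccExtend_of_mem _ _ hs',
            IccExtend_of_mem _ _ hs', mul_assoc]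
          refine (A s).le_of_opNorm_le_of_le le_rfl ((ih ⟨s, hs'⟩).trans (le_of_eq ?_))
          ring
      _ = _ := by
          rw [intervalIntegral.integral_mul_const, integral_mul_primitive_pow hA'.norm,
            Nat.factorial_succ]
          push_cast
          field_simp

/-- A single Picard step need not contract on a long segment, but `m ^ n / n!` tends to 0, so some
iterate contracts on all of `[a, b]` and no subdivision is needed. -/
theorem exists_contracting_picardMap_iterate (hA : IntervalIntegrable A volume a b)
    (hf : IntervalIntegrable f volume a b) (x : F) :
    ∃ n, ContractingWith (1 / 2) (picardMap hab A f hA hf x)^[n] := by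
  have h := FloorSemiring.tendsto_pow_div_factorial_atTop (∫ s in a..b, ‖A s‖)
  obtain ⟨n, hn⟩ := (h.eventually (gt_mem_nhds (show (0 : ℝ) < 1 / 2 by norm_num))).exists
  refine ⟨n, NNReal.coe_lt_coe.1 (by norm_num), LipschitzWith.of_dist_le_mul fun y w => ?_⟩
  refine (ContinuousMap.dist_le (by positivity)).2 fun t => ?_
  rw [dist_eq_norm]
  refine (norm_picardMap_iterate_sub_le hab hA hf x y w n t).trans ?_
  gcongr
  push_cast
  refine le_trans ?_ hn.le
  have h0 : 0 ≤ ∫ s in a..t, ‖A s‖ :=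
    intervalIntegral.integral_nonneg t.2.1 fun s _ => norm_nonneg _
  gcongr
  exact intervalIntegral.integral_mono_interval le_rfl t.2.1 t.2.2
    (Eventually.of_forall fun s => norm_nonneg _) hA.norm

variable [CompleteSpace F]

theorem exists_linear_integral_equation (hab : a ≤ b) (hA : IntervalIntegrable A volume a b)
    (hf : IntervalIntegrable f volume a b) (x : F) :
    ∃ y : ℝ → F, ContinuousOn y (Icc a b) ∧
      ∀ t ∈ Icc a b, y t = x + ∫ s in a..t, (A s (y s) + f s) := by
  obtain ⟨n, hn⟩ := exists_contracting_picardMap_iterate hab hA hf x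
  have hfix := hn.isFixedPt_fixedPoint_iterate
  set y := hn.fixedPoint (picardMap hab A f hA hf x)^[n]
  refine ⟨IccExtend hab y, y.continuous.Icc_extend'.continuousOn, fun t ht => ?_⟩
  rw [IccExtend_of_mem _ _ ht]
  exact (DFunLike.congr_fun hfix ⟨t, ht⟩).symm

theorem linear_integral_equation_unique (hab : a ≤ b) (hA : IntervalIntegrable A volume a b)
    (hf : IntervalIntegrable f volume a b) {x : F} {y w : ℝ → F} (hyc : ContinuousOn y (Icc a b))
    (hy : ∀ t ∈ Icc a b, y t = x + ∫ s in a..t, (A s (y s) + f s))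
    (hwc : ContinuousOn w (Icc a b))
    (hw : ∀ t ∈ Icc a b, w t = x + ∫ s in a..t, (A s (w s) + f s)) :
    EqOn y w (Icc a b) := by
  obtain ⟨n, hn⟩ := exists_contracting_picardMap_iterate hab hA hf x
  have key : ∀ (q : ℝ → F) (hq : ContinuousOn q (Icc a b)),
      (∀ t ∈ Icc a b, q t = x + ∫ s in a..t, (A s (q s) + f s)) →
      Function.IsFixedPt (picardMap hab A f hA hf x)^[n]
        ⟨(Icc a b).domRestrict q, hq.domRestrict⟩ := by
    intro q hqc hq
    refine Function.IsFixedPt.iterate ?_ n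
    ext t
    change x + ∫ s in a..t, (A s (IccExtend hab ((Icc a b).domRestrict q) s) + f s) = q t
    rw [hq t t.2]
    congr 1
    refine intervalIntegral.integral_congr fun s hs => ?_
    rw [uIcc_of_le t.2.1] at hs
    simp only [IccExtend_of_mem hab _ (show s ∈ Icc a b from ⟨hs.1, hs.2.trans t.2.2⟩),
      domRestrict_apply]
  intro t ht
  exact DFunLike.congr_fun (hn.fixedPoint_unique' (key y hyc hy) (key w hwc hw)) ⟨t, ht⟩

end LinearODE

end

/-! ### Positive forms, the signature operator, and energies on segments of the interval -/

section

/-! ### Positive operators -/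

section Positive

variable {V : Type*} [NormedAddCommGroup V] [InnerProductSpace ℂ V]

/-- This is Cauchy–Schwarz in additive form, obtained by expanding `(A v, v) ≥ 0` at `v = ε x - c y`
with `|c| = 1`. Being free of square roots, it can be integrated directly, and the weight `ε` stays
available for absorption and limits. -/
theorem norm_inner_apply_le_of_isPositive {A : V →L[ℂ] V} (hA : A.IsPositive) (x y : V) {ε : ℝ}
    (hε : 0 < ε) :
    ‖inner ℂ x (A y)‖ ≤ (ε * (inner ℂ (A x) x).re + ε⁻¹ * (inner ℂ (A y) y).re) / 2 := by
  -- The phase `c` turns the inner product into its modulus.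
  obtain ⟨c, hc, hcx⟩ : ∃ c : ℂ, ‖c‖ = 1 ∧ c * inner ℂ x (A y) = ‖inner ℂ x (A y)‖ := by
    by_cases h : inner ℂ x (A y) = 0
    · exact ⟨1, by simp, by simp [h]⟩
    · have h' : ((‖inner ℂ x (A y)‖ : ℝ) : ℂ) ≠ 0 := by simpa using h
      refine ⟨‖inner ℂ x (A y)‖ / inner ℂ x (A y), ?_, by field_simp⟩
      rw [norm_div, Complex.norm_real, norm_norm, div_self (by simpa using h)]
  have hsym : inner ℂ (A y) x = starRingEnd ℂ (inner ℂ x (A y)) := (inner_conj_symm _ _).symm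
  have hsym' : inner ℂ (A x) y = inner ℂ x (A y) := hA.isSymmetric x y
  have h : 0 ≤ (inner ℂ (A ((ε : ℂ) • x - c • y)) ((ε : ℂ) • x - c • y)).re := hA.2 _
  simp only [map_sub, map_smul, inner_sub_left, inner_sub_right, inner_smul_left,
    inner_smul_right, Complex.conj_ofReal, hsym', hsym] at h
  have h2 : c * (starRingEnd ℂ c) = 1 := by rw [Complex.mul_conj, Complex.normSq_eq_norm_sq, hc]; simp
  have e1 : (ε : ℂ) * (ε * inner ℂ (A x) x) - c * (ε * inner ℂ x (A y)) -
      ((starRingEnd ℂ c) * ((ε : ℂ) * starRingEnd ℂ (inner ℂ x (A y))) -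
        (starRingEnd ℂ c) * (c * inner ℂ (A y) y)) =
      ((ε ^ 2 : ℝ) : ℂ) * inner ℂ (A x) x - ((2 * ε * ‖inner ℂ x (A y)‖ : ℝ) : ℂ) +
        inner ℂ (A y) y := by
    have h3 : (starRingEnd ℂ c) * starRingEnd ℂ (inner ℂ x (A y)) = ‖inner ℂ x (A y)‖ := by
      rw [← map_mul, hcx, Complex.conj_ofReal]
    push_cast
    linear_combination (-(ε : ℂ)) * hcx + (-(ε : ℂ)) * h3 + inner ℂ (A y) y * h2
  have h' : 0 ≤ ε ^ 2 * (inner ℂ (A x) x).re - 2 * ε * ‖inner ℂ x (A y)‖ +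
      (inner ℂ (A y) y).re := by
    have e2 := congrArg Complex.re e1
    rw [Complex.add_re _ (inner ℂ (A y) y), Complex.sub_re (_ * _) (((_ : ℝ) : ℂ)),
      Complex.re_ofReal_mul, Complex.ofReal_re] at e2
    rw [← e2]
    convert h using 2
    ring
  have : ε⁻¹ * (2 * ε * ‖inner ℂ x (A y)‖) ≤
      ε⁻¹ * (ε ^ 2 * (inner ℂ (A x) x).re + (inner ℂ (A y) y).re) :=
    mul_le_mul_of_nonneg_left (by linarith) (by positivity)
  have e3 : ε⁻¹ * (2 * ε * ‖inner ℂ x (A y)‖) = 2 * ‖inner ℂ x (A y)‖ := by field_simp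
  have e4 : ε⁻¹ * (ε ^ 2 * (inner ℂ (A x) x).re + (inner ℂ (A y) y).re) =
      ε * (inner ℂ (A x) x).re + ε⁻¹ * (inner ℂ (A y) y).re := by field_simp
  rw [e3, e4] at this
  linarith

theorem norm_sq_apply_le_of_isPositive {A : V →L[ℂ] V} (hA : A.IsPositive) (y : V) :
    ‖A y‖ ^ 2 ≤ ‖A‖ * (inner ℂ (A y) y).re := by
  rcases (norm_nonneg A).eq_or_lt with h0 | h0
  · have : A = 0 := norm_eq_zero.1 h0.symm
    simp [this]
  -- With weight `‖A‖⁻¹` the first term on the right is at most half of `‖A y‖ ^ 2` and is absorbed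
  -- by the left side.
  have h := norm_inner_apply_le_of_isPositive hA (A y) y (inv_pos.2 h0)
  have h1 : (inner ℂ (A (A y)) (A y)).re ≤ ‖A‖ * ‖A y‖ ^ 2 := by
    refine (Complex.re_le_norm _).trans ((norm_inner_le_norm _ _).trans ?_)
    rw [pow_two, ← mul_assoc]
    gcongr
    exact A.le_opNorm _
  have h2 : ‖inner ℂ (A y) (A y)‖ = ‖A y‖ ^ 2 := by
    rw [inner_self_eq_norm_sq_to_K]; simp
  rw [h2, inv_inv] at h
  have h3 : ‖A‖⁻¹ * (inner ℂ (A (A y)) (A y)).re ≤ ‖A y‖ ^ 2 := by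
    rw [inv_mul_le_iff₀ h0]; exact h1
  linarith

theorem apply_eq_zero_of_isPositive {A : V →L[ℂ] V} (hA : A.IsPositive) {y : V}
    (h : (inner ℂ (A y) y).re = 0) : A y = 0 := by
  have := norm_sq_apply_le_of_isPositive hA y
  rw [h, mul_zero] at this
  exact norm_eq_zero.1 (pow_eq_zero_iff two_ne_zero |>.1 (le_antisymm this (by positivity)))

end Positive

variable {H Hh : Type*} [NormedAddCommGroup H] [InnerProductSpace ℂ H] [FiniteDimensional ℂ H]
  [NormedAddCommGroup Hh] [InnerProductSpace ℂ Hh] [FiniteDimensional ℂ Hh]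

/-! ### The signature operator -/

theorem sigJ_sigJ (x : PhaseSpace H Hh) : sigJ (sigJ x) = -x := by
  apply WithLp.ofLp_injective
  refine Prod.ext ?_ rfl
  apply WithLp.ofLp_injective
  refine Prod.ext rfl ?_
  change Complex.I • Complex.I • x.fst.snd = -x.fst.snd
  rw [smul_smul, Complex.I_mul_I, neg_one_smul]

theorem inner_phaseSpace (x y : PhaseSpace H Hh) :
    inner ℂ x y = inner ℂ x.fst.fst y.fst.fst + inner ℂ x.fst.snd y.fst.snd +
      inner ℂ x.snd y.snd := by
  rw [WithLp.prod_inner_apply, WithLp.prod_inner_apply]; rfl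

theorem inner_sigJ_right (x y : PhaseSpace H Hh) :
    inner ℂ x (sigJ y) = -inner ℂ x.fst.fst y.snd + Complex.I * inner ℂ x.fst.snd y.fst.snd +
      inner ℂ x.snd y.fst.fst := by
  rw [inner_phaseSpace]
  change inner ℂ x.fst.fst (-y.snd) + inner ℂ x.fst.snd (Complex.I • y.fst.snd) + _ = _
  rw [inner_neg_right, inner_smul_right]; rfl

theorem inner_sigJ_left (x y : PhaseSpace H Hh) :
    inner ℂ (sigJ x) y = -inner ℂ x (sigJ y) := by
  rw [← inner_conj_symm, inner_sigJ_right, inner_sigJ_right]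
  simp only [map_add, map_neg, map_mul, inner_conj_symm, Complex.conj_I]
  ring

variable (H Hh) in
/-- The signature operator as a continuous linear map. -/
def sigJL : PhaseSpace H Hh →L[ℂ] PhaseSpace H Hh := LinearMap.toContinuousLinearMap sigJ

@[simp]
theorem sigJL_apply (x : PhaseSpace H Hh) : sigJL H Hh x = sigJ x := rfl

namespace SymmetricSystem

/-! ### The interval of a symmetric system -/

theorem mem_I_iff_or (S : SymmetricSystem H Hh) :
    (∀ t, t ∈ S.I ↔ S.a ≤ t ∧ (t : EReal) < S.b) ∨ ∀ t, t ∈ S.I ↔ S.a ≤ t ∧ (t : EReal) ≤ S.b := by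
  rcases S.hI with h | h
  · exact Or.inl fun t => by rw [h]; rfl
  · exact Or.inr fun t => by rw [h]; rfl

theorem le_of_mem_I (S : SymmetricSystem H Hh) {t : ℝ} (ht : t ∈ S.I) : S.a ≤ t := by
  rcases S.mem_I_iff_or with h | h
  · exact ((h t).1 ht).1
  · exact ((h t).1 ht).1

theorem mem_I_of_lt (S : SymmetricSystem H Hh) {t : ℝ} (h1 : S.a ≤ t) (h2 : (t : EReal) < S.b) :
    t ∈ S.I := by
  rcases S.mem_I_iff_or with h | h
  · exact (h t).2 ⟨h1, h2⟩
  · exact (h t).2 ⟨h1, h2.le⟩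

theorem le_b_of_mem_I (S : SymmetricSystem H Hh) {t : ℝ} (ht : t ∈ S.I) : (t : EReal) ≤ S.b := by
  rcases S.mem_I_iff_or with h | h
  · exact ((h t).1 ht).2.le
  · exact ((h t).1 ht).2

theorem a_mem_I (S : SymmetricSystem H Hh) : S.a ∈ S.I := S.mem_I_of_lt le_rfl S.hab

theorem mem_I_of_le (S : SymmetricSystem H Hh) {s t : ℝ} (ht : t ∈ S.I) (h1 : S.a ≤ s)
    (h2 : s ≤ t) : s ∈ S.I := by
  have h3 : (s : EReal) ≤ t := EReal.coe_le_coe_iff.2 h2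
  rcases S.mem_I_iff_or with h | h
  · exact (h s).2 ⟨h1, h3.trans_lt ((h t).1 ht).2⟩
  · exact (h s).2 ⟨h1, h3.trans ((h t).1 ht).2⟩

theorem Icc_subset_I (S : SymmetricSystem H Hh) {β : ℝ} (h : β ∈ S.I) : Icc S.a β ⊆ S.I :=
  fun _ ht => S.mem_I_of_le h ht.1 ht.2

theorem uIcc_subset_I (S : SymmetricSystem H Hh) {s t : ℝ} (hs : s ∈ S.I) (ht : t ∈ S.I) :
    uIcc s t ⊆ S.I := by
  have hm : max s t ∈ S.I := by rcases max_cases s t with h | h <;> rw [h.1] <;> assumption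
  exact fun r hr => S.mem_I_of_le hm ((le_min (S.le_of_mem_I hs) (S.le_of_mem_I ht)).trans hr.1) hr.2

theorem uIcc_subset_I' (S : SymmetricSystem H Hh) {t : ℝ} (ht : t ∈ S.I) : uIcc S.a t ⊆ S.I :=
  S.uIcc_subset_I S.a_mem_I ht

theorem measurableSet_I (S : SymmetricSystem H Hh) : MeasurableSet S.I := by
  have : S.I.OrdConnected := ⟨fun s hs t ht r hr =>
    S.mem_I_of_le ht ((S.le_of_mem_I hs).trans hr.1) hr.2⟩
  exact this.measurableSet

theorem ae_ne_b (S : SymmetricSystem H Hh) : ∀ᵐ t : ℝ, (t : EReal) ≠ S.b := by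
  have h : ∀ᵐ t : ℝ, t ≠ S.b.toReal := by simp [ae_iff, measure_singleton]
  filter_upwards [h] with t ht h'
  exact ht (by rw [← h', EReal.toReal_coe])

/-- Only the endpoints can fail to be interior. Hence a formula valid on `I` may be differentiated
at almost every point of `I`. -/
theorem ae_I_mem_nhds (S : SymmetricSystem H Hh) : ∀ᵐ t ∂volume.restrict S.I, S.I ∈ 𝓝 t := by
  have h : ∀ᵐ t : ℝ, t ≠ S.a := by simp [ae_iff, measure_singleton]
  filter_upwards [ae_restrict_of_ae h, ae_restrict_of_ae S.ae_ne_b,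
    ae_restrict_mem S.measurableSet_I] with t h1 h2 ht
  have h3 : S.a < t := lt_of_le_of_ne (S.le_of_mem_I ht) h1.symm
  have h4 : (t : EReal) < S.b := lt_of_le_of_ne (S.le_b_of_mem_I ht) h2
  have ho : IsOpen {r : ℝ | S.a < r ∧ (r : EReal) < S.b} :=
    (isOpen_lt continuous_const continuous_id).inter
      (isOpen_lt continuous_coe_real_ereal continuous_const)
  exact mem_of_superset (ho.mem_nhds ⟨h3, h4⟩) fun r hr => S.mem_I_of_lt hr.1.le hr.2

/-- The last clause holds only almost everywhere, because `b` itself may belong to `I` while every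
`β n` lies below it. -/
theorem exists_seq_tendsto_b (S : SymmetricSystem H Hh) :
    ∃ β : ℕ → ℝ, StrictMono β ∧ (∀ n, β n ∈ S.I) ∧ Tendsto β atTop S.leftNhdsB ∧
      ∀ᵐ t ∂volume.restrict S.I, ∃ n, t ≤ β n := by
  obtain ⟨u, hu, hmem, hlim⟩ := exists_seq_strictMono_tendsto' S.hab
  have hcoe : ∀ n, ((u n).toReal : EReal) = u n := fun n =>
    EReal.coe_toReal (ne_top_of_lt (hmem n).2) (ne_bot_of_gt (hmem n).1)
  have hlt : ∀ n, (((u n).toReal : ℝ) : EReal) < S.b := fun n => by rw [hcoe]; exact (hmem n).2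
  refine ⟨fun n => (u n).toReal, fun m n hmn => ?_, fun n => S.mem_I_of_lt ?_ (hlt n), ?_, ?_⟩
  · rw [← EReal.coe_lt_coe_iff, hcoe, hcoe]; exact hu hmn
  · rw [← EReal.coe_le_coe_iff, hcoe]; exact (hmem n).1.le
  · refine tendsto_comap_iff.2 (tendsto_nhdsWithin_iff.2 ⟨?_, Eventually.of_forall hlt⟩)
    simpa only [Function.comp_def, hcoe] using hlim
  · filter_upwards [ae_restrict_of_ae S.ae_ne_b, ae_restrict_mem S.measurableSet_I] with t h2 ht
    have h4 : (t : EReal) < S.b := lt_of_le_of_ne (S.le_b_of_mem_I ht) h2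
    obtain ⟨n, hn⟩ := (hlim.eventually (lt_mem_nhds h4)).exists
    exact ⟨n, by rw [← EReal.coe_le_coe_iff, hcoe]; exact hn.le⟩

/-! ### Locally square integrable functions -/

/-- The density `(Δ(t) f(t), f(t))`. -/
def quad (S : SymmetricSystem H Hh) (f : ℝ → PhaseSpace H Hh) (t : ℝ) : ℝ :=
  (inner ℂ (S.Δ t (f t)) (f t)).re

theorem aestronglyMeasurable_Δ_apply (S : SymmetricSystem H Hh) {f : ℝ → PhaseSpace H Hh}
    (hf : AEStronglyMeasurable f (volume.restrict S.I)) :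
    AEStronglyMeasurable (fun t => S.Δ t (f t)) (volume.restrict S.I) :=
  (isBoundedBilinearMap_apply (𝕜 := ℂ)).continuous.comp_aestronglyMeasurable
    (S.locInt_Δ.1.prodMk hf)

theorem aestronglyMeasurable_quad (S : SymmetricSystem H Hh) {f : ℝ → PhaseSpace H Hh}
    (hf : AEStronglyMeasurable f (volume.restrict S.I)) :
    AEStronglyMeasurable (S.quad f) (volume.restrict S.I) :=
  Complex.continuous_re.comp_aestronglyMeasurable ((S.aestronglyMeasurable_Δ_apply hf).inner hf)

theorem ae_restrict_of_subset_I (S : SymmetricSystem H Hh) {s : Set ℝ} (hs : s ⊆ S.I)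
    {p : ℝ → Prop} (h : ∀ᵐ t ∂volume.restrict S.I, p t) : ∀ᵐ t ∂volume.restrict s, p t :=
  ae_restrict_of_ae_restrict_of_subset hs h

theorem quad_nonneg (S : SymmetricSystem H Hh) (f : ℝ → PhaseSpace H Hh) :
    ∀ᵐ t ∂volume.restrict S.I, 0 ≤ S.quad f t := by
  filter_upwards [S.nonneg_Δ] with t ht using ht.2 _

/-- The functions `f` on `I` with `∫_a^β (Δ f, f) dt < ∞` for all `β ∈ I`. -/
def L2Loc (S : SymmetricSystem H Hh) : Submodule ℂ (ℝ → PhaseSpace H Hh) where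
  carrier := {f | AEStronglyMeasurable f (volume.restrict S.I) ∧
    ∀ β ∈ S.I, IntegrableOn (S.quad f) (Icc S.a β) volume}
  zero_mem' := ⟨aestronglyMeasurable_zero, fun β _ => by
    have : S.quad 0 = fun _ => 0 := by ext t; simp [quad]
    rw [this]; exact integrableOn_zero⟩
  add_mem' := by
    rintro f g ⟨hfm, hfi⟩ ⟨hgm, hgi⟩
    refine ⟨hfm.add hgm, fun β hβ => ?_⟩
    refine Integrable.mono' (((hfi β hβ).const_mul 2).add ((hgi β hβ).const_mul 2))
      ((S.aestronglyMeasurable_quad (hfm.add hgm)).mono_set (S.Icc_subset_I hβ)) ?_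
    filter_upwards [S.ae_restrict_of_subset_I (S.Icc_subset_I hβ) S.nonneg_Δ] with t ht
    have h0 : 0 ≤ S.quad (f + g) t := ht.2 _
    rw [Real.norm_of_nonneg h0]
    exact form_add_le ht (f t) (g t)
  smul_mem' := by
    rintro c f ⟨hfm, hfi⟩
    refine ⟨hfm.const_smul c, fun β hβ => ?_⟩
    refine ((hfi β hβ).const_mul (‖c‖ ^ 2)).congr (Eventually.of_forall fun t => ?_)
    simp only [quad, Pi.smul_apply, map_smul, inner_smul_left, inner_smul_right]
    rw [← mul_assoc, Complex.mul_conj', ← Complex.ofReal_pow, Complex.re_ofReal_mul]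

theorem L2_le_L2Loc (S : SymmetricSystem H Hh) : S.L2 ≤ S.L2Loc := fun _ hf =>
  ⟨hf.2.1.aestronglyMeasurable, fun _ hβ => hf.2.2.mono_set (S.Icc_subset_I hβ)⟩

theorem mem_L2Loc_of_continuousOn (S : SymmetricSystem H Hh) {f : ℝ → PhaseSpace H Hh}
    (hf : ContinuousOn f S.I) : f ∈ S.L2Loc := by
  have hm : AEStronglyMeasurable f (volume.restrict S.I) :=
    hf.aestronglyMeasurable S.measurableSet_I
  refine ⟨hm, fun β hβ => ?_⟩
  obtain ⟨C, hC⟩ := isCompact_Icc.exists_bound_of_continuousOn (hf.mono (S.Icc_subset_I hβ))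
  refine ((S.locInt_Δ.2 β hβ).norm.const_mul (C ^ 2)).mono'
    ((S.aestronglyMeasurable_quad hm).mono_set (S.Icc_subset_I hβ)) ?_
  filter_upwards [ae_restrict_mem measurableSet_Icc] with t ht
  refine (Complex.abs_re_le_norm _).trans ((norm_inner_le_norm _ _).trans ?_)
  calc ‖S.Δ t (f t)‖ * ‖f t‖ ≤ (‖S.Δ t‖ * ‖f t‖) * ‖f t‖ := by
        gcongr; exact (S.Δ t).le_opNorm _
    _ = ‖f t‖ ^ 2 * ‖S.Δ t‖ := by ring
    _ ≤ C ^ 2 * ‖S.Δ t‖ := by gcongr; exact hC t ht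

theorem intervalIntegrable_of_integrableOn_Icc (S : SymmetricSystem H Hh) {X : Type*}
    [NormedAddCommGroup X] {f : ℝ → X}
    (h : ∀ β ∈ S.I, IntegrableOn f (Icc S.a β) volume) {s t : ℝ} (hs : s ∈ S.I) (ht : t ∈ S.I) :
    IntervalIntegrable f volume s t := by
  have key : ∀ r ∈ S.I, IntervalIntegrable f volume S.a r := fun r hr =>
    (intervalIntegrable_iff_integrableOn_Icc_of_le (S.le_of_mem_I hr)).2 (h r hr)
  exact (key s hs).symm.trans (key t ht)

variable (S : SymmetricSystem H Hh) {f g : ℝ → PhaseSpace H Hh}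

theorem ae_uIoc_of_ae_I {s t : ℝ} (hs : s ∈ S.I) (ht : t ∈ S.I) {p : ℝ → Prop}
    (h : ∀ᵐ t ∂volume.restrict S.I, p t) : ∀ᵐ r ∂volume.restrict (uIoc s t), p r :=
  S.ae_restrict_of_subset_I (uIoc_subset_uIcc.trans (S.uIcc_subset_I hs ht)) h

theorem intervalIntegrable_quad (hf : f ∈ S.L2Loc) {s t : ℝ} (hs : s ∈ S.I) (ht : t ∈ S.I) :
    IntervalIntegrable (S.quad f) volume s t :=
  S.intervalIntegrable_of_integrableOn_Icc hf.2 hs ht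

theorem intervalIntegrable_inner (hf : f ∈ S.L2Loc) (hg : g ∈ S.L2Loc) {s t : ℝ} (hs : s ∈ S.I)
    (ht : t ∈ S.I) :
    IntervalIntegrable (fun r => inner ℂ (f r) (S.Δ r (g r))) volume s t := by
  refine ((S.intervalIntegrable_quad hf hs ht).add (S.intervalIntegrable_quad hg hs ht)).mono_fun
    ((hf.1.inner (S.aestronglyMeasurable_Δ_apply hg.1)).mono_set
      (uIoc_subset_uIcc.trans (S.uIcc_subset_I hs ht))) ?_
  filter_upwards [S.ae_uIoc_of_ae_I hs ht S.nonneg_Δ] with r hr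
  have h := norm_inner_apply_le_of_isPositive hr (f r) (g r) one_pos
  have h1 : 0 ≤ (inner ℂ (S.Δ r (f r)) (f r)).re := hr.2 _
  have h2 : 0 ≤ (inner ℂ (S.Δ r (g r)) (g r)).re := hr.2 _
  refine h.trans (le_trans ?_ (Real.le_norm_self _))
  change _ ≤ (inner ℂ (S.Δ r (f r)) (f r)).re + (inner ℂ (S.Δ r (g r)) (g r)).re
  rw [one_mul, inv_one, one_mul]
  linarith

/-- From `‖Δ f‖² ≤ ‖Δ‖ (Δ f, f)` it follows that `‖Δ f‖ ≤ ‖Δ‖ + (Δ f, f)`, a sum of integrable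
functions. So `Δ f` is an admissible forcing term. -/
theorem integrableOn_Δ_apply (hf : f ∈ S.L2Loc) {β : ℝ} (hβ : β ∈ S.I) :
    IntegrableOn (fun r => S.Δ r (f r)) (Icc S.a β) volume := by
  refine ((S.locInt_Δ.2 β hβ).norm.add (hf.2 β hβ)).mono'
    ((S.aestronglyMeasurable_Δ_apply hf.1).mono_set (S.Icc_subset_I hβ)) ?_
  filter_upwards [S.ae_restrict_of_subset_I (S.Icc_subset_I hβ) S.nonneg_Δ] with r hr
  have h := norm_sq_apply_le_of_isPositive hr (f r)
  have h1 : 0 ≤ (inner ℂ (S.Δ r (f r)) (f r)).re := hr.2 _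
  change _ ≤ ‖S.Δ r‖ + (inner ℂ (S.Δ r (f r)) (f r)).re
  nlinarith [norm_nonneg (S.Δ r), norm_nonneg (S.Δ r (f r))]

/-- The semi-inner product `∫_s^t (Δ g, f) dr`. -/
def ip (s t : ℝ) (f g : ℝ → PhaseSpace H Hh) : ℂ := ∫ r in s..t, inner ℂ (f r) (S.Δ r (g r))

/-- The square `∫_s^t (Δ f, f) dr` of the seminorm. -/
def energy (s t : ℝ) (f : ℝ → PhaseSpace H Hh) : ℝ := ∫ r in s..t, S.quad f r

theorem norm_ip_le (hf : f ∈ S.L2Loc) (hg : g ∈ S.L2Loc) {s t : ℝ} (hs : s ∈ S.I)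
    (ht : t ∈ S.I) (hst : s ≤ t) {ε : ℝ} (hε : 0 < ε) :
    ‖S.ip s t f g‖ ≤ (ε * S.energy s t f + ε⁻¹ * S.energy s t g) / 2 := by
  have h1 := S.intervalIntegrable_quad hf hs ht
  have h2 := S.intervalIntegrable_quad hg hs ht
  refine (intervalIntegral.norm_integral_le_of_norm_le hst ?_
    (((h1.const_mul ε).add (h2.const_mul ε⁻¹)).div_const 2)).trans (le_of_eq ?_)
  · have h := S.ae_uIoc_of_ae_I hs ht S.nonneg_Δ
    rw [uIoc_of_le hst] at h
    filter_upwards [(ae_restrict_iff' measurableSet_Ioc).1 h] with r hr hr'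
    exact norm_inner_apply_le_of_isPositive (hr hr') (f r) (g r) hε
  · simp only [energy]
    rw [← intervalIntegral.integral_const_mul, ← intervalIntegral.integral_const_mul,
      ← intervalIntegral.integral_add (h1.const_mul ε) (h2.const_mul ε⁻¹),
      ← intervalIntegral.integral_div]

theorem ip_self {s t : ℝ} (hs : s ∈ S.I) (ht : t ∈ S.I) (f : ℝ → PhaseSpace H Hh) :
    S.ip s t f f = S.energy s t f := by
  rw [ip, energy, ← intervalIntegral.integral_ofReal]
  refine intervalIntegral.integral_congr_ae ?_
  filter_upwards [(ae_restrict_iff' measurableSet_uIoc).1 (S.ae_uIoc_of_ae_I hs ht S.nonneg_Δ)]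
    with r hr hr'
  have h : inner ℂ (S.Δ r (f r)) (f r) = inner ℂ (f r) (S.Δ r (f r)) :=
    (hr hr').isSymmetric (f r) (f r)
  rw [← h]
  exact ((hr hr').isSymmetric.coe_re_inner_apply_self (f r)).symm

theorem conj_ip {s t : ℝ} (hs : s ∈ S.I) (ht : t ∈ S.I) (f g : ℝ → PhaseSpace H Hh) :
    starRingEnd ℂ (S.ip s t f g) = S.ip s t g f := by
  have h : starRingEnd ℂ (S.ip s t f g) =
      ∫ r in s..t, starRingEnd ℂ (inner ℂ (f r) (S.Δ r (g r))) := by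
    simp only [ip, intervalIntegral, map_sub, ← integral_conj]
  rw [h, ip]
  refine intervalIntegral.integral_congr_ae ?_
  filter_upwards [(ae_restrict_iff' measurableSet_uIoc).1 (S.ae_uIoc_of_ae_I hs ht S.nonneg_Δ)]
    with r hr hr'
  rw [inner_conj_symm]
  exact (hr hr').isSymmetric _ _

theorem energy_nonneg {s t : ℝ} (hs : s ∈ S.I) (ht : t ∈ S.I) (hst : s ≤ t)
    (f : ℝ → PhaseSpace H Hh) : 0 ≤ S.energy s t f := by
  refine intervalIntegral.integral_nonneg_of_ae_restrict hst ?_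
  exact S.ae_restrict_of_subset_I (by rw [← uIcc_of_le hst]; exact S.uIcc_subset_I hs ht)
    (S.quad_nonneg f)

theorem energy_add_energy (hf : f ∈ S.L2Loc) {r s t : ℝ} (hr : r ∈ S.I) (hs : s ∈ S.I)
    (ht : t ∈ S.I) : S.energy r s f + S.energy s t f = S.energy r t f :=
  intervalIntegral.integral_add_adjacent_intervals (S.intervalIntegrable_quad hf hr hs)
    (S.intervalIntegrable_quad hf hs ht)

theorem energy_mono (hf : f ∈ S.L2Loc) {s t : ℝ} (hs : s ∈ S.I) (ht : t ∈ S.I) (hst : s ≤ t) :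
    S.energy S.a s f ≤ S.energy S.a t f := by
  rw [← S.energy_add_energy hf S.a_mem_I hs ht]
  linarith [S.energy_nonneg hs ht hst f]

theorem energy_add_le (hf : f ∈ S.L2Loc) (hg : g ∈ S.L2Loc) {s t : ℝ} (hs : s ∈ S.I)
    (ht : t ∈ S.I) (hst : s ≤ t) :
    S.energy s t (f + g) ≤ 2 * S.energy s t f + 2 * S.energy s t g := by
  have h1 := S.intervalIntegrable_quad hf hs ht
  have h2 := S.intervalIntegrable_quad hg hs ht
  simp only [energy]
  rw [← intervalIntegral.integral_const_mul, ← intervalIntegral.integral_const_mul,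
    ← intervalIntegral.integral_add (h1.const_mul 2) (h2.const_mul 2)]
  refine intervalIntegral.integral_mono_ae_restrict hst
    (S.intervalIntegrable_quad (add_mem hf hg) hs ht) ((h1.const_mul 2).add (h2.const_mul 2)) ?_
  filter_upwards [S.ae_restrict_of_subset_I (by
    rw [← uIcc_of_le hst]; exact S.uIcc_subset_I hs ht) S.nonneg_Δ] with r hr
  exact form_add_le hr (f r) (g r)

theorem ip_add_right {g' : ℝ → PhaseSpace H Hh} (hf : f ∈ S.L2Loc) (hg : g ∈ S.L2Loc)
    (hg' : g' ∈ S.L2Loc) {s t : ℝ} (hs : s ∈ S.I) (ht : t ∈ S.I) :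
    S.ip s t f (g + g') = S.ip s t f g + S.ip s t f g' := by
  simp only [ip]
  rw [← intervalIntegral.integral_add (S.intervalIntegrable_inner hf hg hs ht)
    (S.intervalIntegrable_inner hf hg' hs ht)]
  simp only [Pi.add_apply, map_add, inner_add_right]

theorem ip_smul_right (c : ℂ) (s t : ℝ) (f g : ℝ → PhaseSpace H Hh) :
    S.ip s t f (c • g) = c * S.ip s t f g := by
  simp only [ip]
  rw [← intervalIntegral.integral_const_mul]
  simp only [Pi.smul_apply, map_smul, inner_smul_right]

theorem ip_add_left {f' : ℝ → PhaseSpace H Hh} (hf : f ∈ S.L2Loc) (hf' : f' ∈ S.L2Loc)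
    (hg : g ∈ S.L2Loc) {s t : ℝ} (hs : s ∈ S.I) (ht : t ∈ S.I) :
    S.ip s t (f + f') g = S.ip s t f g + S.ip s t f' g := by
  simp only [ip]
  rw [← intervalIntegral.integral_add (S.intervalIntegrable_inner hf hg hs ht)
    (S.intervalIntegrable_inner hf' hg hs ht)]
  simp only [Pi.add_apply, inner_add_left]

theorem ip_smul_left (c : ℂ) (s t : ℝ) (f g : ℝ → PhaseSpace H Hh) :
    S.ip s t (c • f) g = starRingEnd ℂ c * S.ip s t f g := by
  simp only [ip]
  rw [← intervalIntegral.integral_const_mul]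
  simp only [Pi.smul_apply, inner_smul_left]

theorem energy_smul (c : ℂ) (s t : ℝ) (f : ℝ → PhaseSpace H Hh) :
    S.energy s t (c • f) = ‖c‖ ^ 2 * S.energy s t f := by
  simp only [energy]
  rw [← intervalIntegral.integral_const_mul]
  congr 1 with r
  simp only [quad, Pi.smul_apply, map_smul, inner_smul_left, inner_smul_right]
  rw [← mul_assoc, Complex.mul_conj', ← Complex.ofReal_pow, Complex.re_ofReal_mul]

end SymmetricSystem

end

/-! ### Green's formula, the initial value problem, and definiteness on segments -/

section

variable {H Hh : Type*} [NormedAddCommGroup H] [InnerProductSpace ℂ H] [FiniteDimensional ℂ H]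
  [NormedAddCommGroup Hh] [InnerProductSpace ℂ Hh] [FiniteDimensional ℂ Hh]

namespace SymmetricSystem

variable (S : SymmetricSystem H Hh)

/-! ### Solutions without integrability conditions -/

/-- The pairs `{y, f}` with `y` locally absolutely continuous and `J y' - B y = Δ f` a.e. -/
def tLoc : Submodule ℂ ((ℝ → PhaseSpace H Hh) × (ℝ → PhaseSpace H Hh)) where
  carrier := {p | LocAbsCont S.a S.I p.1 ∧ S.SatisfiesEq p.1 p.2}
  zero_mem' := ⟨S.tMax.zero_mem.2.2.1, S.tMax.zero_mem.2.2.2⟩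
  add_mem' := by
    rintro p q ⟨hp3, hp4⟩ ⟨hq3, hq4⟩
    refine ⟨fun β hβ => (hp3 β hβ).add (hq3 β hβ), ?_⟩
    filter_upwards [hp4, hq4] with t ⟨y', hy, ey⟩ ⟨z', hz, ez⟩
    refine ⟨y' + z', hy.add hz, ?_⟩
    simp only [Prod.fst_add, Prod.snd_add, Pi.add_apply, map_add]
    rw [← ey, ← ez]
    abel
  smul_mem' := by
    rintro c p ⟨hp3, hp4⟩
    refine ⟨fun β hβ => (hp3 β hβ).const_smul c, ?_⟩
    filter_upwards [hp4] with t ⟨y', hy, ey⟩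
    refine ⟨c • y', hy.const_smul c, ?_⟩
    simp only [Prod.smul_fst, Prod.smul_snd, Pi.smul_apply, map_smul]
    rw [← ey, smul_sub]

variable {S} {y w f g : ℝ → PhaseSpace H Hh}

theorem tMax_le_tLoc : S.tMax ≤ S.tLoc := fun _ hp => hp.2.2

theorem mem_tMax_of_mem_tLoc (h : (y, f) ∈ S.tLoc) (hy : y ∈ S.L2) (hf : f ∈ S.L2) :
    (y, f) ∈ S.tMax := ⟨hy, hf, h⟩

theorem continuousOn_of_mem_tLoc (h : (y, f) ∈ S.tLoc) : ContinuousOn y S.I := by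
  intro t ht
  have key : ∀ β ∈ S.I, t ≤ β → Icc S.a β ∈ 𝓝[S.I] t → ContinuousWithinAt y S.I t := by
    intro β hβ htβ hn
    have hc := (h.1 β hβ).continuousOn
    rw [uIcc_of_le (S.le_of_mem_I hβ)] at hc
    exact (hc t ⟨S.le_of_mem_I ht, htβ⟩).mono_of_mem_nhdsWithin hn
  by_cases hex : ∃ β ∈ S.I, t < β
  · obtain ⟨β, hβ, htβ⟩ := hex
    refine key β hβ htβ.le ?_
    filter_upwards [self_mem_nhdsWithin, mem_nhdsWithin_of_mem_nhds (Iio_mem_nhds htβ)] with r hr hr'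
    exact ⟨S.le_of_mem_I hr, hr'.le⟩
  · push Not at hex
    refine key t ht le_rfl ?_
    filter_upwards [self_mem_nhdsWithin] with r hr using ⟨S.le_of_mem_I hr, hex r hr⟩

theorem mem_L2Loc_of_mem_tLoc (h : (y, f) ∈ S.tLoc) : y ∈ S.L2Loc :=
  S.mem_L2Loc_of_continuousOn (continuousOn_of_mem_tLoc h)

theorem stronglyMeasurable_of_continuousOn (hy : ContinuousOn y S.I) (h0 : ∀ t, t ∉ S.I → y t = 0) :
    StronglyMeasurable y := by
  classical
  borelize (PhaseSpace H Hh)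
  have h1 : Measurable (S.I.piecewise y 0) :=
    hy.measurable_piecewise continuousOn_const S.measurableSet_I
  have h2 : S.I.piecewise y 0 = y := by
    ext1 t
    by_cases ht : t ∈ S.I
    · simp [ht]
    · simp [ht, h0 t ht]
  rw [h2] at h1
  exact h1.stronglyMeasurable

/-- The form `(J y(t), w(t))`. -/
def bracket (y w : ℝ → PhaseSpace H Hh) (t : ℝ) : ℂ := inner ℂ (w t) (sigJ (y t))

theorem absolutelyContinuousOnInterval_bracket {a b : ℝ}
    (hy : AbsolutelyContinuousOnInterval y a b) (hw : AbsolutelyContinuousOnInterval w a b) :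
    AbsolutelyContinuousOnInterval (bracket y w) a b := by
  obtain ⟨C, hC⟩ := hy.exists_bound
  obtain ⟨D, hD⟩ := hw.exists_bound
  refine hy.of_dist_le_add hw (C := D * ‖sigJL H Hh‖) (D := ‖sigJL H Hh‖ * C) fun s hs t ht => ?_
  have h : bracket y w s - bracket y w t =
      inner ℂ (w s) (sigJL H Hh (y s - y t)) + inner ℂ (w s - w t) (sigJL H Hh (y t)) := by
    simp only [bracket, map_sub, inner_sub_left, inner_sub_right, sigJL_apply]; ring
  rw [dist_eq_norm, h, dist_eq_norm, dist_eq_norm]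
  refine (norm_add_le _ _).trans (add_le_add ?_ ?_)
  · refine (norm_inner_le_norm _ _).trans ?_
    rw [mul_assoc]
    exact mul_le_mul (hD s hs) ((sigJL H Hh).le_opNorm _) (norm_nonneg _)
      ((norm_nonneg _).trans (hD s hs))
  · refine (norm_inner_le_norm _ _).trans ?_
    rw [mul_comm]
    gcongr
    exact (sigJL H Hh).le_of_opNorm_le_of_le le_rfl (hC t ht)

/-- Green's formula. -/
theorem bracket_sub_bracket (hy : (y, f) ∈ S.tLoc) (hw : (w, g) ∈ S.tLoc) (hf : f ∈ S.L2Loc)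
    (hg : g ∈ S.L2Loc) {s t : ℝ} (hs : s ∈ S.I) (ht : t ∈ S.I) :
    bracket y w t - bracket y w s = S.ip s t w f - S.ip s t g y := by
  have hm : max s t ∈ S.I := by rcases max_cases s t with h | h <;> rw [h.1] <;> assumption
  have hsub : uIcc s t ⊆ uIcc S.a (max s t) := by
    rw [uIcc_of_le (S.le_of_mem_I hm)]
    exact fun r hr => ⟨S.le_of_mem_I (S.uIcc_subset_I hs ht hr), hr.2⟩
  have hac := absolutelyContinuousOnInterval_bracket ((hy.1 _ hm).mono hsub) ((hw.1 _ hm).mono hsub)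
  have i1 := S.intervalIntegrable_inner (mem_L2Loc_of_mem_tLoc hw) hf hs ht
  have i2 := S.intervalIntegrable_inner hg (mem_L2Loc_of_mem_tLoc hy) hs ht
  rw [ip, ip, ← intervalIntegral.integral_sub i1 i2]
  refine (hac.integral_eq_sub_of_ae_hasDerivAt (i1.sub i2) ?_).symm
  have hae : ∀ᵐ r ∂volume.restrict (uIcc s t), HasDerivAt (bracket y w)
      (inner ℂ (w r) (S.Δ r (f r)) - inner ℂ (g r) (S.Δ r (y r))) r := by
    refine S.ae_restrict_of_subset_I (S.uIcc_subset_I hs ht) ?_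
    filter_upwards [hy.2, hw.2, S.selfAdjoint_B, S.nonneg_Δ] with r ⟨y', dy, ey⟩ ⟨w', dw, ew⟩ hB hΔ
    have dJ : HasDerivAt (fun r => sigJ (y r)) (sigJ y') r :=
      ((sigJL H Hh).restrictScalars ℝ).hasFDerivAt.comp_hasDerivAt r dy
    convert! dw.inner ℂ dJ using 1
    -- In the product rule for `(J y, w)` the terms with `B` cancel, since `J` is skew and `B` is
    -- self-adjoint; only those with `Δ` remain.
    have e1 : sigJ y' = S.B r (y r) + S.Δ r (f r) := by rw [← ey]; abel
    have e2 : inner ℂ w' (sigJ (y r)) = -inner ℂ (S.B r (w r) + S.Δ r (g r)) (y r) := by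
      rw [← ew, add_sub_cancel, inner_sigJ_left, neg_neg]
    have e3 : inner ℂ (S.B r (w r)) (y r) = inner ℂ (w r) (S.B r (y r)) :=
      hB.isSymmetric _ _
    have e4 : inner ℂ (S.Δ r (g r)) (y r) = inner ℂ (g r) (S.Δ r (y r)) :=
      hΔ.isSymmetric _ _
    rw [e1, e2, inner_add_left, inner_add_right, e3, e4]
    ring
  exact (ae_restrict_iff' measurableSet_uIcc).1 hae

/-! ### Existence and uniqueness of solutions -/

variable (S) in
/-- The coefficient `-J (B + λ Δ)` of the system solved for `y'`. -/
def coeff (z : ℂ) (t : ℝ) : PhaseSpace H Hh →L[ℂ] PhaseSpace H Hh :=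
  (-sigJL H Hh) ∘L (S.B t + z • S.Δ t)

theorem intervalIntegrable_coeff (z : ℂ) {β : ℝ} (hβ : β ∈ S.I) :
    IntervalIntegrable (S.coeff z) volume S.a β := by
  refine (intervalIntegrable_iff_integrableOn_Icc_of_le (S.le_of_mem_I hβ)).2 ?_
  exact (ContinuousLinearMap.compL ℂ _ _ _ (-sigJL H Hh)).integrable_comp
    ((S.locInt_B.2 β hβ).add ((S.locInt_Δ.2 β hβ).smul z))

theorem intervalIntegrable_force (hf : f ∈ S.L2Loc) {β : ℝ} (hβ : β ∈ S.I) :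
    IntervalIntegrable (fun t => -sigJL H Hh (S.Δ t (f t))) volume S.a β := by
  refine (intervalIntegrable_iff_integrableOn_Icc_of_le (S.le_of_mem_I hβ)).2 ?_
  exact (-sigJL H Hh).integrable_comp (S.integrableOn_Δ_apply hf hβ)

/-- Solutions on the segments `[a, β]` agree where they overlap, by uniqueness, and are glued
together. Extension by zero outside `I` matches the convention in `L2`. -/
theorem exists_mem_tLoc (S : SymmetricSystem H Hh) (z : ℂ) (hf : f ∈ S.L2Loc)
    (x : PhaseSpace H Hh) :
    ∃ y, (y, z • y + f) ∈ S.tLoc ∧ y S.a = x ∧ ∀ t, t ∉ S.I → y t = 0 := by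
  classical
  have hex : ∀ β : S.I, ∃ y : ℝ → PhaseSpace H Hh, ContinuousOn y (Icc S.a β) ∧
      ∀ t ∈ Icc S.a (β : ℝ), y t = x + ∫ s in S.a..t, (S.coeff z s (y s) + -sigJL H Hh (S.Δ s (f s))) :=
    fun β => exists_linear_integral_equation (S.le_of_mem_I β.2) (intervalIntegrable_coeff z β.2)
      (intervalIntegrable_force hf β.2) x
  choose Y hYc hY using hex
  -- The value at `t` is taken from the solution on `[a, t]` itself.
  set y : ℝ → PhaseSpace H Hh := fun t => if ht : t ∈ S.I then Y ⟨t, ht⟩ t else 0 with hydef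
  have hyY : ∀ (β : S.I), ∀ t ∈ Icc S.a (β : ℝ), y t = Y β t := by
    intro β t ht
    have htI := S.Icc_subset_I β.2 ht
    have hsub : Icc S.a t ⊆ Icc S.a β := Icc_subset_Icc_right ht.2
    simp only [hydef, htI, dif_pos]
    exact linear_integral_equation_unique ht.1 (intervalIntegrable_coeff z htI)
      (intervalIntegrable_force hf htI) (hYc ⟨t, htI⟩) (hY ⟨t, htI⟩) ((hYc β).mono hsub)
      (fun r hr => hY β r (hsub hr)) ⟨ht.1, le_rfl⟩
  have hyc : ∀ β ∈ S.I, ContinuousOn y (uIcc S.a β) := by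
    intro β hβ
    rw [uIcc_of_le (S.le_of_mem_I hβ)]
    exact (hYc ⟨β, hβ⟩).congr (hyY ⟨β, hβ⟩)
  have hint : ∀ β ∈ S.I, IntervalIntegrable
      (fun s => S.coeff z s (y s) + -sigJL H Hh (S.Δ s (f s))) volume S.a β := fun β hβ =>
    ((intervalIntegrable_coeff z hβ).clm_apply_continuousOn (hyc β hβ)).add
      (intervalIntegrable_force hf hβ)
  have hy : ∀ t ∈ S.I, y t = x + ∫ s in S.a..t, (S.coeff z s (y s) + -sigJL H Hh (S.Δ s (f s))) := by
    intro t ht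
    have hat := S.le_of_mem_I ht
    rw [hyY ⟨t, ht⟩ t ⟨hat, le_rfl⟩, hY ⟨t, ht⟩ t ⟨hat, le_rfl⟩]
    congr 1
    refine intervalIntegral.integral_congr fun s hs => ?_
    rw [uIcc_of_le hat] at hs
    simp only [hyY ⟨t, ht⟩ s hs]
  refine ⟨y, ⟨fun β hβ => ?_, ?_⟩, ?_, fun t ht => by simp [hydef, ht]⟩
  · have h := (hint β hβ).absolutelyContinuousOnInterval_integral
    refine h.of_dist_le_add h (C := 1) (D := 0) fun s hs t ht => ?_
    have hsub := S.uIcc_subset_I' hβ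
    dsimp only
    rw [hy s (hsub hs), hy t (hsub ht), dist_add_left]
    simp
  -- Countably many segments cover almost all of `I`, so the exceptional null sets for
  -- differentiating the primitives have a null union.
  · obtain ⟨β, -, hβI, -, hβ⟩ := S.exists_seq_tendsto_b
    have hd := ae_all_iff.2 fun n => (hint (β n) (hβI n)).ae_hasDerivAt_integral
    filter_upwards [hβ, ae_restrict_of_ae hd, S.ae_I_mem_nhds, ae_restrict_mem S.measurableSet_I]
      with t ⟨n, hn⟩ hdt hnhds htI
    have hmem : t ∈ uIcc S.a (β n) := by
      rw [uIcc_of_le (S.le_of_mem_I (hβI n))]; exact ⟨S.le_of_mem_I htI, hn⟩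
    refine ⟨_, ((hdt n hmem S.a left_mem_uIcc).const_add x).congr_of_eventuallyEq ?_, ?_⟩
    · filter_upwards [hnhds] with r hr using hy r hr
    · have e : S.coeff z t (y t) + -sigJL H Hh (S.Δ t (f t)) =
          -sigJ (S.B t (y t) + z • S.Δ t (y t) + S.Δ t (f t)) := by
        simp [coeff]
        abel
      rw [e, map_neg, sigJ_sigJ]
      simp only [Pi.add_apply, Pi.smul_apply, map_add, map_smul]
      abel
  · rw [hy S.a S.a_mem_I]; simp

theorem eq_zero_of_mem_tLoc {z : ℂ} (h : (y, z • y) ∈ S.tLoc) (h0 : y S.a = 0) :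
    ∀ t ∈ S.I, y t = 0 := by
  have hc : ∀ β ∈ S.I, ContinuousOn y (uIcc S.a β) := fun β hβ => (h.1 β hβ).continuousOn
  intro t ht
  have hat := S.le_of_mem_I ht
  refine linear_integral_equation_unique (f := fun _ => 0) (x := 0) (w := fun _ => 0) hat
    (intervalIntegrable_coeff z ht) (by simp) ?_ ?_ continuousOn_const (by simp) ⟨hat, le_rfl⟩
  · rw [← uIcc_of_le hat]; exact hc t ht
  · intro r hr
    have hrI := S.Icc_subset_I ht hr
    have hi := (intervalIntegrable_coeff z hrI).clm_apply_continuousOn (hc r hrI)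
    have := (h.1 r hrI).integral_eq_sub_of_ae_hasDerivAt hi ?_
    · simp only [add_zero, zero_add]; rw [this]; change y r = y r - y S.a; rw [h0, sub_zero]
    · refine (ae_restrict_iff' measurableSet_uIcc).1
        (S.ae_restrict_of_subset_I (S.uIcc_subset_I' hrI) ?_)
      filter_upwards [h.2] with s ⟨y', dy, ey⟩
      have e1 : sigJ y' = S.B s (y s) + z • S.Δ s (y s) := by
        rw [sub_eq_iff_eq_add] at ey
        rw [ey, Pi.smul_apply, map_smul]; abel
      have e2 : y' = -sigJ (sigJ y') := by rw [sigJ_sigJ, neg_neg]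
      have e3 : S.coeff z s (y s) = y' := by
        rw [e2, e1]
        simp [coeff]
        abel
      rw [e3]
      exact dy

/-- Uniqueness for the initial value problem makes the solution linear in its initial value; the
zero extension makes this an identity on all of `ℝ`. -/
theorem exists_fund (S : SymmetricSystem H Hh) (z : ℂ) :
    ∃ Φ : PhaseSpace H Hh →ₗ[ℂ] (ℝ → PhaseSpace H Hh), ∀ x, (Φ x, z • Φ x) ∈ S.tLoc ∧
      Φ x S.a = x ∧ ∀ t, t ∉ S.I → Φ x t = 0 := by
  have hex := fun x => S.exists_mem_tLoc z (Submodule.zero_mem S.L2Loc) x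
  simp only [add_zero] at hex
  choose Φ hmem ha hoff using hex
  have huniq : ∀ y : ℝ → PhaseSpace H Hh, (y, z • y) ∈ S.tLoc → y S.a = 0 →
      (∀ t, t ∉ S.I → y t = 0) → y = 0 := fun y h h0 hoff => by
    ext1 t
    by_cases ht : t ∈ S.I
    · exact eq_zero_of_mem_tLoc h h0 t ht
    · exact hoff t ht
  refine ⟨{ toFun := Φ, map_add' := fun x x' => ?_, map_smul' := fun c x => ?_ },
    fun x => ⟨hmem x, ha x, hoff x⟩⟩
  · refine sub_eq_zero.1 (huniq _ ?_ ?_ fun t ht => ?_)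
    · convert! S.tLoc.sub_mem (hmem (x + x')) (S.tLoc.add_mem (hmem x) (hmem x')) using 1
      simp [smul_sub]
    · rw [Pi.sub_apply, Pi.add_apply, ha, ha, ha, sub_self]
    · rw [Pi.sub_apply, Pi.add_apply, hoff _ t ht, hoff _ t ht, hoff _ t ht, add_zero, sub_zero]
  · refine sub_eq_zero.1 (huniq _ ?_ ?_ fun t ht => ?_)
    · convert! S.tLoc.sub_mem (hmem (c • x)) (S.tLoc.smul_mem c (hmem x)) using 1
      rw [RingHom.id_apply, smul_sub, smul_comm z c]
      rfl
    · rw [RingHom.id_apply, Pi.sub_apply, Pi.smul_apply, ha, ha, sub_self]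
    · rw [RingHom.id_apply, Pi.sub_apply, Pi.smul_apply, hoff _ t ht, hoff _ t ht, smul_zero,
        sub_zero]

variable (S) in
/-- The solution of `J y' - B y = λ Δ y` with `y(a) = x`, extended by zero outside `I`. -/
def fund (z : ℂ) : PhaseSpace H Hh →ₗ[ℂ] (ℝ → PhaseSpace H Hh) := (S.exists_fund z).choose

theorem fund_mem_tLoc (z : ℂ) (x : PhaseSpace H Hh) : (S.fund z x, z • S.fund z x) ∈ S.tLoc :=
  ((S.exists_fund z).choose_spec x).1

@[simp]
theorem fund_a (z : ℂ) (x : PhaseSpace H Hh) : S.fund z x S.a = x :=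
  ((S.exists_fund z).choose_spec x).2.1

theorem fund_of_notMem (z : ℂ) (x : PhaseSpace H Hh) {t : ℝ} (ht : t ∉ S.I) : S.fund z x t = 0 :=
  ((S.exists_fund z).choose_spec x).2.2 t ht

theorem fund_mem_L2Loc (z : ℂ) (x : PhaseSpace H Hh) : S.fund z x ∈ S.L2Loc :=
  mem_L2Loc_of_mem_tLoc (fund_mem_tLoc z x)

/-- If `y` solves the equation at `λ̄` with right hand side `h` and `w` the homogeneous one at `λ`,
then `[y, w]` is a primitive of `(Δ h, w)`. -/
theorem bracket_fund_sub {z : ℂ} (hy : (y, starRingEnd ℂ z • y + f) ∈ S.tLoc) (hf : f ∈ S.L2Loc)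
    (x : PhaseSpace H Hh) {s t : ℝ} (hs : s ∈ S.I) (ht : t ∈ S.I) :
    bracket y (S.fund z x) t - bracket y (S.fund z x) s = S.ip s t (S.fund z x) f := by
  have hyl := mem_L2Loc_of_mem_tLoc hy
  have hw := fund_mem_L2Loc (S := S) z x
  rw [bracket_sub_bracket hy (fund_mem_tLoc z x) (add_mem (S.L2Loc.smul_mem _ hyl) hf)
    (S.L2Loc.smul_mem _ hw) hs ht, S.ip_add_right hw (S.L2Loc.smul_mem _ hyl) hf hs ht,
    S.ip_smul_right, S.ip_smul_left]
  ring

/-- The bracket of a solution at `λ` with one at `λ̄` is constant. If it vanishes at `t` it vanishes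
at `a`, where it equals `(J x, x')` with `x'` arbitrary, and `J` is invertible. -/
theorem fund_apply_injective (z : ℂ) {t : ℝ} (ht : t ∈ S.I) {x : PhaseSpace H Hh}
    (h : S.fund z x t = 0) : x = 0 := by
  have key : ∀ x', inner ℂ x' (sigJ x) = 0 := by
    intro x'
    have hm : (S.fund z x, starRingEnd ℂ (starRingEnd ℂ z) • S.fund z x + 0) ∈ S.tLoc := by
      rw [add_zero, Complex.conj_conj]; exact fund_mem_tLoc z x
    have := bracket_fund_sub hm S.L2Loc.zero_mem x' S.a_mem_I ht
    have h0 : S.ip S.a t (S.fund (starRingEnd ℂ z) x') 0 = 0 := by simp [ip]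
    rw [h0, bracket, bracket, h, map_zero, inner_zero_right, fund_a, fund_a, zero_sub,
      neg_eq_zero] at this
    exact this
  have h1 : sigJ x = 0 := inner_self_eq_zero.1 (key (sigJ x))
  have h2 := sigJ_sigJ x
  rw [h1, map_zero] at h2
  exact neg_eq_zero.1 h2.symm

/-- The solution space is nondegenerate at each point: `y(t)` is determined by the values
`[y, w]_t` on solutions `w`. -/
theorem eq_zero_of_bracket_fund_eq_zero (z : ℂ) {t : ℝ} (ht : t ∈ S.I)
    (h : ∀ x, bracket y (S.fund z x) t = 0) : y t = 0 := by
  have hinj : Function.Injective ((LinearMap.proj t : (ℝ → PhaseSpace H Hh) →ₗ[ℂ] _) ∘ₗ S.fund z) := by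
    rw [← LinearMap.ker_eq_bot, LinearMap.ker_eq_bot']
    exact fun x hx => fund_apply_injective z ht hx
  -- Some solution takes the value `J y(t)` at `t`; the bracket with it is `‖J y(t)‖²`.
  obtain ⟨x, hx⟩ := LinearMap.injective_iff_surjective.1 hinj (sigJ (y t))
  have h1 := h x
  rw [bracket, show S.fund z x t = sigJ (y t) from hx, inner_self_eq_zero] at h1
  have h2 := sigJ_sigJ (y t)
  rw [h1, map_zero] at h2
  exact neg_eq_zero.1 h2.symm

/-! ### Definiteness on compact segments -/

theorem Δ_apply_eq_zero_of_energy_eq_zero (hf : f ∈ S.L2Loc) {β : ℝ} (hβ : β ∈ S.I)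
    (h : S.energy S.a β f = 0) : ∀ᵐ t ∂volume.restrict (Icc S.a β), S.Δ t (f t) = 0 := by
  have hat := S.le_of_mem_I hβ
  rw [energy, intervalIntegral.integral_of_le hat, ← integral_Icc_eq_integral_Ioc,
    setIntegral_eq_zero_iff_of_nonneg_ae (S.ae_restrict_of_subset_I (S.Icc_subset_I hβ)
      (S.quad_nonneg f)) (hf.2 β hβ)] at h
  filter_upwards [h, S.ae_restrict_of_subset_I (S.Icc_subset_I hβ) S.nonneg_Δ] with t h1 h2
  exact apply_eq_zero_of_isPositive h2 h1

/-- Initial values whose solution is annihilated by `Δ` on `[a, β n]` form a decreasing sequence of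
subspaces of a finite-dimensional space. It stabilizes, and its stable term is annihilated on all of
`I`, hence zero by definiteness. Thus definiteness already holds on some compact segment. -/
theorem exists_energy_fund_ne_zero (hS : S.IsDefinite) (z : ℂ) {β : ℕ → ℝ} (hβm : Monotone β)
    (hβI : ∀ n, β n ∈ S.I) (hβ : ∀ᵐ t ∂volume.restrict S.I, ∃ n, t ≤ β n) :
    ∃ N, ∀ n ≥ N, ∀ x, S.energy S.a (β n) (S.fund z x) = 0 → x = 0 := by
  let K : ℕ → Submodule ℂ (PhaseSpace H Hh) := fun n =>
    { carrier := {x | ∀ᵐ t ∂volume.restrict (Icc S.a (β n)), S.Δ t (S.fund z x t) = 0}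
      zero_mem' := by simp
      add_mem' := fun {x x'} hx hx' => by
        change ∀ᵐ t ∂volume.restrict (Icc S.a (β n)), S.Δ t (S.fund z (x + x') t) = 0
        filter_upwards [hx, hx'] with t h1 h2
        rw [map_add, Pi.add_apply, map_add, h1, h2, add_zero]
      smul_mem' := fun c x hx => by
        change ∀ᵐ t ∂volume.restrict (Icc S.a (β n)), S.Δ t (S.fund z (c • x) t) = 0
        filter_upwards [hx] with t h1
        rw [map_smul, Pi.smul_apply, map_smul, h1, smul_zero] }
  have hK : Antitone K := fun m n hmn x hx =>
    ae_restrict_of_ae_restrict_of_subset (Icc_subset_Icc_right (hβm hmn)) hx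
  obtain ⟨N, hN⟩ := IsArtinian.monotone_stabilizes
    (⟨fun n => OrderDual.toDual (K n), fun m n hmn => hK hmn⟩ :
      ℕ →o (Submodule ℂ (PhaseSpace H Hh))ᵒᵈ)
  have hN' : ∀ n ≥ N, K N = K n := fun n hn => hN n hn
  refine ⟨N, fun n hn x hx => ?_⟩
  have hxn : x ∈ K n := Δ_apply_eq_zero_of_energy_eq_zero (fund_mem_L2Loc z x) (hβI n) hx
  have hall : ∀ m, x ∈ K m := fun m => by
    rcases le_total N m with h | h
    · rw [← hN' m h, hN' n hn]; exact hxn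
    · exact hK (h.trans hn) hxn
  have hall' : ∀ m, ∀ᵐ t, t ∈ Icc S.a (β m) → S.Δ t (S.fund z x t) = 0 := fun m =>
    (ae_restrict_iff' measurableSet_Icc).1 (hall m)
  have hm := fund_mem_tLoc (S := S) z x
  have h0 := hS z (S.fund z x) hm.1 hm.2 (by
    filter_upwards [hβ, ae_restrict_of_ae (ae_all_iff.2 hall'), ae_restrict_mem S.measurableSet_I]
      with t ⟨m, hm⟩ h1 h2
    exact h1 m ⟨S.le_of_mem_I h2, hm⟩) S.a S.a_mem_I
  rwa [fund_a] at h0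

theorem energy_le_of_mem_L2 (hf : f ∈ S.L2) {s t : ℝ} (hs : s ∈ S.I) (ht : t ∈ S.I) (hst : s ≤ t) :
    S.energy s t f ≤ ∫ r in S.I, S.quad f r := by
  rw [energy, intervalIntegral.integral_of_le hst]
  exact setIntegral_mono_set hf.2.2 (S.quad_nonneg f)
    (Eventually.of_forall (Ioc_subset_Icc_self.trans
      (by rw [← uIcc_of_le hst]; exact S.uIcc_subset_I hs ht)))

end SymmetricSystem

/-- A definite sesquilinear form on a finite-dimensional space represents all functionals. -/
theorem exists_forall_sesq_eq {V : Type*} [NormedAddCommGroup V] [InnerProductSpace ℂ V]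
    [FiniteDimensional ℂ V] (B : V →ₗ⋆[ℂ] V →ₗ[ℂ] ℂ) (hB : ∀ p, B p p = 0 → p = 0)
    (l : V →ₗ⋆[ℂ] ℂ) : ∃ p, ∀ x, B x p = l x := by
  let e := stdOrthonormalBasis ℂ V
  let T : V →ₗ[ℂ] EuclideanSpace ℂ (Fin (Module.finrank ℂ V)) :=
    (WithLp.linearEquiv 2 ℂ _).symm.toLinearMap ∘ₗ LinearMap.pi fun i => B (e i)
  have hT : Function.Injective T := by
    rw [← LinearMap.ker_eq_bot, LinearMap.ker_eq_bot']
    intro p hp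
    have h1 : ∀ i, B.flip p (e i) = 0 := fun i => congrArg (fun v => v i) hp
    have h2 : B.flip p = 0 := e.toBasis.ext fun i => by simpa using h1 i
    exact hB p (by simpa using LinearMap.congr_fun h2 p)
  have hs : Function.Surjective T :=
    (LinearMap.injective_iff_surjective_of_finrank_eq_finrank (by simp)).1 hT
  obtain ⟨p, hp⟩ := hs (WithLp.toLp 2 fun i => l (e i))
  refine ⟨p, fun x => ?_⟩
  have h1 : B.flip p = l := e.toBasis.ext fun i => by
    simpa using! congrArg (fun v => v i) hp
  exact LinearMap.congr_fun h1 x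

end

/-! ### Gram forms and projections onto solutions on growing segments -/

section

variable {H Hh : Type*} [NormedAddCommGroup H] [InnerProductSpace ℂ H] [FiniteDimensional ℂ H]
  [NormedAddCommGroup Hh] [InnerProductSpace ℂ Hh] [FiniteDimensional ℂ Hh]

namespace SymmetricSystem

variable {S : SymmetricSystem H Hh} {y w f g : ℝ → PhaseSpace H Hh}

/-! ### Exhaustion of the interval by compact segments -/

variable (S) in
/-- A sequence `β n ↑ b` in `I`. -/
structure IsExhaustion (β : ℕ → ℝ) : Prop where
  strictMono : StrictMono β
  mem : ∀ n, β n ∈ S.I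
  tendsto : Tendsto β atTop S.leftNhdsB
  ae_le : ∀ᵐ t ∂volume.restrict S.I, ∃ n, t ≤ β n

variable (S) in
theorem exists_isExhaustion : ∃ β, S.IsExhaustion β := by
  obtain ⟨β, h1, h2, h3, h4⟩ := S.exists_seq_tendsto_b
  exact ⟨β, h1, h2, h3, h4⟩

namespace IsExhaustion

variable {β : ℕ → ℝ}

theorem comp (h : S.IsExhaustion β) {k : ℕ → ℕ} (hk : StrictMono k) :
    S.IsExhaustion (fun n => β (k n)) where
  strictMono := h.strictMono.comp hk
  mem n := h.mem _
  tendsto := h.tendsto.comp hk.tendsto_atTop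
  ae_le := by
    filter_upwards [h.ae_le] with t ⟨n, hn⟩
    exact ⟨n, hn.trans (h.strictMono.monotone hk.le_apply)⟩

theorem aecover (h : S.IsExhaustion β) :
    AECover (volume.restrict S.I) atTop (fun n => Icc S.a (β n)) where
  ae_eventually_mem := by
    filter_upwards [h.ae_le, ae_restrict_mem S.measurableSet_I] with t ⟨n, hn⟩ ht
    filter_upwards [eventually_ge_atTop n] with m hm
    exact ⟨S.le_of_mem_I ht, hn.trans (h.strictMono.monotone hm)⟩
  measurableSet _ := measurableSet_Icc

theorem setIntegral_restrict (h : S.IsExhaustion β) (k : ℝ → ℝ) (n : ℕ) :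
    ∫ t in Icc S.a (β n), k t ∂volume.restrict S.I = ∫ t in S.a..β n, k t := by
  rw [Measure.restrict_restrict measurableSet_Icc, inter_eq_left.2 (S.Icc_subset_I (h.mem n)),
    integral_Icc_eq_integral_Ioc, intervalIntegral.integral_of_le (S.le_of_mem_I (h.mem n))]

theorem mem_L2 (h : S.IsExhaustion β) (hf : f ∈ S.L2Loc) (hm : StronglyMeasurable f)
    (h0 : ∀ t, t ∉ S.I → f t = 0) {C : ℝ} (hC : ∀ n, S.energy S.a (β n) f ≤ C) : f ∈ S.L2 := by
  refine ⟨h0, hm, ?_⟩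
  refine h.aecover.integrable_of_integral_bounded_of_nonneg_ae C (fun n => ?_) (S.quad_nonneg f)
    (Eventually.of_forall fun n => ?_)
  · rw [IntegrableOn, Measure.restrict_restrict measurableSet_Icc,
      inter_eq_left.2 (S.Icc_subset_I (h.mem n))]
    exact hf.2 _ (h.mem n)
  · rw [h.setIntegral_restrict]; exact hC n

theorem tendsto_energy (h : S.IsExhaustion β) (hf : f ∈ S.L2) :
    Tendsto (fun n => S.energy S.a (β n) f) atTop (𝓝 (∫ t in S.I, S.quad f t)) := by
  have := h.aecover.integral_tendsto_of_countably_generated (f := S.quad f) hf.2.2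
  simp only [h.setIntegral_restrict] at this
  exact this

end IsExhaustion

/-! ### The Gram form of the solutions on a segment -/

variable (S) in
/-- The form `∫_a^β (Δ φ_y, φ_x) dt` of initial values. -/
def gram (z : ℂ) {β : ℝ} (hβ : β ∈ S.I) : PhaseSpace H Hh →ₗ⋆[ℂ] PhaseSpace H Hh →ₗ[ℂ] ℂ :=
  LinearMap.mk₂'ₛₗ (starRingEnd ℂ) (RingHom.id ℂ)
    (fun x y => S.ip S.a β (S.fund z x) (S.fund z y))
    (fun x x' y => by
      rw [map_add, S.ip_add_left (fund_mem_L2Loc z x) (fund_mem_L2Loc z x') (fund_mem_L2Loc z y)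
        S.a_mem_I hβ])
    (fun c x y => by rw [map_smul, S.ip_smul_left]; rfl)
    (fun x y y' => by
      rw [map_add, S.ip_add_right (fund_mem_L2Loc z x) (fund_mem_L2Loc z y) (fund_mem_L2Loc z y')
        S.a_mem_I hβ])
    (fun c x y => by rw [map_smul, S.ip_smul_right]; rfl)

theorem gram_apply (z : ℂ) {β : ℝ} (hβ : β ∈ S.I) (x y : PhaseSpace H Hh) :
    S.gram z hβ x y = S.ip S.a β (S.fund z x) (S.fund z y) := rfl

theorem continuous_energy_fund (z : ℂ) {β : ℝ} (hβ : β ∈ S.I) :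
    Continuous fun x => S.energy S.a β (S.fund z x) := by
  let e := stdOrthonormalBasis ℂ (PhaseSpace H Hh)
  have h : ∀ x, S.energy S.a β (S.fund z x) =
      (∑ i, inner ℂ (e i) x * starRingEnd ℂ (S.gram z hβ (e i) x)).re := by
    intro x
    have h1 : S.gram z hβ x x = ∑ i, inner ℂ (e i) x * S.gram z hβ x (e i) := by
      conv_lhs => rw [← e.sum_repr' x, map_sum]
      refine Finset.sum_congr rfl fun i _ => ?_
      rw [map_smul, smul_eq_mul, e.sum_repr' x]
    have h2 : S.energy S.a β (S.fund z x) = (S.gram z hβ x x).re := by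
      rw [gram_apply, S.ip_self S.a_mem_I hβ, Complex.ofReal_re]
    rw [h2, h1]
    congr 1
    refine Finset.sum_congr rfl fun i _ => ?_
    rw [gram_apply, gram_apply, S.conj_ip S.a_mem_I hβ]
  simp_rw [h]
  refine Complex.continuous_re.comp (continuous_finsetSum _ fun i _ => ?_)
  exact (continuous_const.inner continuous_id).mul
    (Complex.continuous_conj.comp (LinearMap.continuous_of_finiteDimensional _))

theorem continuous_fund_apply (z : ℂ) (t : ℝ) : Continuous fun x => S.fund z x t :=
  LinearMap.continuous_of_finiteDimensional
    ((LinearMap.proj t : (ℝ → PhaseSpace H Hh) →ₗ[ℂ] _) ∘ₗ S.fund z)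

theorem gram_definite (z : ℂ) {β : ℝ} (hβ : β ∈ S.I)
    (hd : ∀ x, S.energy S.a β (S.fund z x) = 0 → x = 0) (x : PhaseSpace H Hh)
    (hx : S.gram z hβ x x = 0) : x = 0 := by
  rw [gram_apply, S.ip_self S.a_mem_I hβ] at hx
  exact hd x (by exact_mod_cast hx)

/-- Each coordinate of `x` in an orthonormal basis is the Gram product of `x` with a fixed vector,
since the definite form represents every functional. Cauchy–Schwarz then bounds it by the energy. -/
theorem isBounded_setOf_energy_fund_le (z : ℂ) {β : ℝ} (hβ : β ∈ S.I)
    (hd : ∀ x, S.energy S.a β (S.fund z x) = 0 → x = 0) (C : ℝ) :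
    Bornology.IsBounded {x | S.energy S.a β (S.fund z x) ≤ C} := by
  let e := stdOrthonormalBasis ℂ (PhaseSpace H Hh)
  have hp : ∀ i, ∃ p, ∀ x, S.gram z hβ x p = inner ℂ x (e i) := fun i =>
    exists_forall_sesq_eq (S.gram z hβ) (gram_definite z hβ hd)
      ((innerₛₗ ℂ : PhaseSpace H Hh →ₗ⋆[ℂ] _).flip (e i))
  choose p hp using hp
  refine (Metric.isBounded_closedBall (x := (0 : PhaseSpace H Hh))
    (r := ∑ i, (C + S.energy S.a β (S.fund z (p i))) / 2)).subset fun x hx => ?_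
  rw [mem_closedBall_zero_iff]
  conv_lhs => rw [← e.sum_repr' x]
  refine (norm_sum_le _ _).trans (Finset.sum_le_sum fun i _ => ?_)
  rw [norm_smul, e.norm_eq_one, mul_one, norm_inner_symm, ← hp i x, gram_apply]
  refine (S.norm_ip_le (fund_mem_L2Loc z x) (fund_mem_L2Loc z (p i)) S.a_mem_I hβ
    (S.le_of_mem_I hβ) one_pos).trans ?_
  rw [one_mul, inv_one, one_mul]
  gcongr
  exact hx

theorem energy_sub_le (hf : f ∈ S.L2Loc) (hg : g ∈ S.L2Loc) {s t : ℝ} (hs : s ∈ S.I)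
    (ht : t ∈ S.I) (hst : s ≤ t) :
    S.energy s t (f - g) ≤ 2 * S.energy s t f + 2 * S.energy s t g := by
  have h := S.energy_add_le hf (S.L2Loc.smul_mem (-1) hg) hs ht hst
  rw [S.energy_smul, norm_neg, norm_one, one_pow, one_mul, neg_one_smul, ← sub_eq_add_neg] at h
  exact h

/-- The limit of the projections of `g` onto the solutions on growing segments. -/
theorem exists_projection_limit (hS : S.IsDefinite) (z : ℂ) (hg : g ∈ S.L2) :
    ∃ (β : ℕ → ℝ) (p : ℕ → PhaseSpace H Hh) (q : PhaseSpace H Hh), S.IsExhaustion β ∧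
      Tendsto p atTop (𝓝 q) ∧
      (∀ n x, S.ip S.a (β n) (S.fund z x) (g - S.fund z (p n)) = 0) ∧
      (∀ n, S.energy S.a (β n) (S.fund z (p n)) ≤ ∫ t in S.I, S.quad g t) := by
  obtain ⟨β, hβ⟩ := S.exists_isExhaustion
  obtain ⟨N, hN⟩ := exists_energy_fund_ne_zero hS z hβ.strictMono.monotone hβ.mem hβ.ae_le
  have hgl := S.L2_le_L2Loc hg
  have hp : ∀ n, ∃ p, ∀ x, S.gram z (hβ.mem (N + n)) x p =
      S.ip S.a (β (N + n)) (S.fund z x) g := fun n =>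
    exists_forall_sesq_eq _ (gram_definite z (hβ.mem _) (hN _ (Nat.le_add_right _ _)))
      { toFun := fun x => S.ip S.a (β (N + n)) (S.fund z x) g
        map_add' := fun x x' => by
          rw [map_add, S.ip_add_left (fund_mem_L2Loc z x) (fund_mem_L2Loc z x') hgl S.a_mem_I
            (hβ.mem _)]
        map_smul' := fun c x => by rw [map_smul, S.ip_smul_left]; rfl }
  choose p hp using hp
  have horth : ∀ n x, S.ip S.a (β (N + n)) (S.fund z x) (g - S.fund z (p n)) = 0 := by
    intro n x
    have h1 := hp n x
    rw [gram_apply] at h1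
    have h2 := S.ip_add_right (fund_mem_L2Loc z x)
      (sub_mem hgl (fund_mem_L2Loc z (p n))) (fund_mem_L2Loc z (p n)) S.a_mem_I (hβ.mem (N + n))
    rw [sub_add_cancel, h1] at h2
    exact right_eq_add.1 h2
  have hen : ∀ n, S.energy S.a (β (N + n)) (S.fund z (p n)) ≤ ∫ t in S.I, S.quad g t := by
    intro n
    have hI := hβ.mem (N + n)
    have h1 := hp n (p n)
    rw [gram_apply, S.ip_self S.a_mem_I hI] at h1
    have h2 := S.norm_ip_le (fund_mem_L2Loc z (p n)) hgl S.a_mem_I hI (S.le_of_mem_I hI) one_pos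
    rw [← h1, Complex.norm_real, one_mul, inv_one, one_mul] at h2
    have h3 := energy_le_of_mem_L2 hg S.a_mem_I hI (S.le_of_mem_I hI)
    have h4 := Real.le_norm_self (S.energy S.a (β (N + n)) (S.fund z (p n)))
    linarith
  -- On the fixed segment `[a, β N]` the energies of all projections are bounded by that of `g`, so
  -- the initial values `p n` stay bounded.
  obtain ⟨q, -, k, hk, hlim⟩ := tendsto_subseq_of_bounded (x := p)
    (isBounded_setOf_energy_fund_le z (hβ.mem N) (hN N le_rfl) (∫ t in S.I, S.quad g t))
    (fun n => (S.energy_mono (fund_mem_L2Loc z _) (hβ.mem N) (hβ.mem (N + n))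
      (hβ.strictMono.monotone (Nat.le_add_right _ _))).trans (hen n))
  refine ⟨fun n => β (N + k n), p ∘ k, q, hβ.comp (k := fun n => N + k n) (fun m n hmn => ?_), hlim,
    fun n x => horth (k n) x, fun n => hen (k n)⟩
  exact Nat.add_lt_add_left (hk hmn) N

theorem sub_conj_eq (z : ℂ) : z - starRingEnd ℂ z = 2 * z.im * Complex.I := by
  rw [Complex.sub_conj]; push_cast; ring

/-- The energy estimate for solutions at `λ̄` which vanish at both ends of a segment. -/
theorem energy_le_of_vanish {z : ℂ} (hz : z.im ≠ 0)
    (hy : (y, starRingEnd ℂ z • y + f) ∈ S.tLoc) (hf : f ∈ S.L2Loc) {β : ℝ} (hβ : β ∈ S.I)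
    (ha : y S.a = 0) (hb : y β = 0) :
    S.energy S.a β y ≤ (z.im ^ 2)⁻¹ * S.energy S.a β f := by
  have hyl := mem_L2Loc_of_mem_tLoc hy
  have hzl := S.L2Loc.smul_mem (starRingEnd ℂ z) hyl
  have h := bracket_sub_bracket hy hy (add_mem hzl hf) (add_mem hzl hf) S.a_mem_I hβ
  rw [bracket, bracket, ha, hb, inner_zero_left, sub_zero,
    S.ip_add_right hyl hzl hf S.a_mem_I hβ, S.ip_add_left hzl hf hyl S.a_mem_I hβ,
    S.ip_smul_right, S.ip_smul_left, ← S.conj_ip S.a_mem_I hβ y f, Complex.conj_conj,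
    S.ip_self S.a_mem_I hβ] at h
  -- Green's formula has no boundary terms here, so `Im λ` times the energy is the imaginary part of
  -- the product of `y` with `f`.
  have h1 : (z - starRingEnd ℂ z) * S.energy S.a β y =
      S.ip S.a β y f - starRingEnd ℂ (S.ip S.a β y f) := by linear_combination h
  have h2 := congrArg Complex.im h1
  rw [sub_conj_eq, Complex.sub_conj] at h2
  simp at h2
  have hE := S.energy_nonneg S.a_mem_I hβ (S.le_of_mem_I hβ) y
  have h3 : |z.im| * S.energy S.a β y ≤ ‖S.ip S.a β y f‖ := by
    have : z.im * S.energy S.a β y = (S.ip S.a β y f).im := by linarith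
    rw [← abs_of_nonneg hE, ← abs_mul, this]
    exact Complex.abs_im_le_norm _
  have hpos := abs_pos.2 hz
  -- The weight `|Im λ|` leaves half of the left side on the right, where it is absorbed.
  have h4 := h3.trans (S.norm_ip_le hyl hf S.a_mem_I hβ (S.le_of_mem_I hβ) hpos)
  have h5 : |z.im| * S.energy S.a β y ≤ |z.im|⁻¹ * S.energy S.a β f := by linarith
  rw [← sq_abs, pow_two, mul_inv, mul_assoc]
  exact (le_inv_mul_iff₀ hpos).2 h5

end SymmetricSystem

end

/-! ### The decomposition of the maximal domain and prescribed values at `a` -/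

section

variable {H Hh : Type*} [NormedAddCommGroup H] [InnerProductSpace ℂ H] [FiniteDimensional ℂ H]
  [NormedAddCommGroup Hh] [InnerProductSpace ℂ Hh] [FiniteDimensional ℂ Hh]

namespace SymmetricSystem

variable {S : SymmetricSystem H Hh} {y w f g : ℝ → PhaseSpace H Hh}

/-! ### The decomposition of the maximal relation -/

theorem energy_segment_le (hf : f ∈ S.L2Loc) {s t : ℝ} (hs : s ∈ S.I) (ht : t ∈ S.I) :
    S.energy s t f ≤ S.energy S.a t f := by
  rw [← S.energy_add_energy hf S.a_mem_I hs ht]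
  linarith [S.energy_nonneg S.a_mem_I hs (S.le_of_mem_I hs) f]

theorem energy_segment_le_tail (hf : f ∈ S.L2) {s t : ℝ} (hs : s ∈ S.I) (ht : t ∈ S.I) :
    S.energy s t f ≤ (∫ r in S.I, S.quad f r) - S.energy S.a s f := by
  have h := S.energy_add_energy (S.L2_le_L2Loc hf) S.a_mem_I hs ht
  linarith [energy_le_of_mem_L2 hf S.a_mem_I ht (S.le_of_mem_I ht)]

/-- If `y` solves the equation at `λ̄` with right hand side `f` and vanishes at `t`, then its
bracket with an element of the maximal relation is small near `b`, uniformly in `t`. -/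
theorem norm_bracket_le_of_vanish {z : ℂ} {v k : ℝ → PhaseSpace H Hh}
    (hy : (y, starRingEnd ℂ z • y + f) ∈ S.tLoc) (hf : f ∈ S.L2Loc) (hv : (v, k) ∈ S.tMax)
    {s t : ℝ} (hs : s ∈ S.I) (ht : t ∈ S.I) (hst : s ≤ t) (hyt : y t = 0) {E : ℝ}
    (hyE : S.energy S.a t y ≤ E) (hfE : S.energy S.a t f ≤ E) {ε : ℝ} (hε : 0 < ε) :
    ‖bracket y v s‖ ≤ (‖z‖ + 2) * (ε * E) / 2 + (‖z‖ + 2) * (ε⁻¹ *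
      (((∫ r in S.I, S.quad v r) - S.energy S.a s v) +
        ((∫ r in S.I, S.quad k r) - S.energy S.a s k))) / 2 := by
  have hyl := mem_L2Loc_of_mem_tLoc hy
  have hvl := S.L2_le_L2Loc hv.1
  have hkl := S.L2_le_L2Loc hv.2.1
  have hzl := S.L2Loc.smul_mem (starRingEnd ℂ z) hyl
  have h := bracket_sub_bracket hy (tMax_le_tLoc hv) (add_mem hzl hf) hkl hs ht
  rw [bracket, hyt, map_zero, inner_zero_right, zero_sub, S.ip_add_right hvl hzl hf hs ht,
    S.ip_smul_right] at h
  have h1 : bracket y v s = S.ip s t k y - starRingEnd ℂ z * S.ip s t v y - S.ip s t v f := by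
    linear_combination -h
  have ty := (energy_segment_le hyl hs ht).trans hyE
  have tf := (energy_segment_le hf hs ht).trans hfE
  have tv := energy_segment_le_tail hv.1 hs ht
  have tk := energy_segment_le_tail hv.2.1 hs ht
  have pv := S.energy_nonneg hs ht hst v
  have pk := S.energy_nonneg hs ht hst k
  have py := S.energy_nonneg hs ht hst y
  set τv := (∫ r in S.I, S.quad v r) - S.energy S.a s v
  set τk := (∫ r in S.I, S.quad k r) - S.energy S.a s k
  have hε' := inv_pos.2 hε
  -- The large weight `ε⁻¹` falls on the tails of `v` and `k`, which vanish as `s ↑ b`; the small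
  -- weight `ε` falls on the bounded energies of `y` and `f`.
  have bound : ∀ {f₁ f₂ : ℝ → PhaseSpace H Hh}, f₁ ∈ S.L2Loc → f₂ ∈ S.L2Loc →
      S.energy s t f₁ ≤ τv + τk → S.energy s t f₂ ≤ E →
      ‖S.ip s t f₁ f₂‖ ≤ (ε⁻¹ * (τv + τk) + ε * E) / 2 := by
    intro f₁ f₂ h₁ h₂ e₁ e₂
    refine (S.norm_ip_le h₁ h₂ hs ht hst hε').trans ?_
    rw [inv_inv]
    gcongr
  have b1 := bound hkl hyl (by linarith) ty
  have b2 := bound hvl hyl (by linarith) ty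
  have b3 := bound hvl hf (by linarith) tf
  rw [h1]
  refine (norm_sub_le _ _).trans ((add_le_add_left (norm_sub_le _ _) _).trans ?_)
  rw [norm_mul, RCLike.norm_conj]
  have b2' := mul_le_mul_of_nonneg_left b2 (norm_nonneg z)
  linarith

/-- The von Neumann type decomposition: up to elements of the minimal relation, every element of
`dom t_max` is a sum of solutions at `λ` and `λ̄`. -/
theorem exists_eq_add_add (hS : S.IsDefinite) {z : ℂ} (hz : z.im ≠ 0) (hy : y ∈ S.domMax) :
    ∃ w ∈ S.solSpace z, ∃ w' ∈ S.solSpace (starRingEnd ℂ z), ∃ u ∈ S.domMax,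
      y = w + w' + u ∧ u S.a = 0 ∧ ∀ v ∈ S.domMax, ∀ c,
        Tendsto (bracket u v) S.leftNhdsB (𝓝 c) → c = 0 := by
  obtain ⟨⟨y', f⟩, hyf, rfl⟩ := hy
  change ∃ w ∈ S.solSpace z, ∃ w' ∈ S.solSpace (starRingEnd ℂ z), ∃ u ∈ S.domMax,
      y' = w + w' + u ∧ _
  -- `g` is the image of `y'` under `t_max - λ̄`. It is split into a limit of projections onto
  -- solutions at `λ` and a remainder that is the image of `u`.
  set g : ℝ → PhaseSpace H Hh := f - starRingEnd ℂ z • y' with hgdef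
  have hg : g ∈ S.L2 := sub_mem hyf.2.1 (S.L2.smul_mem _ hyf.1)
  have hgl := S.L2_le_L2Loc hg
  obtain ⟨β, p, q, hβ, hpq, horth, hen⟩ := exists_projection_limit hS z hg
  set C := ∫ t in S.I, S.quad g t
  have hβa : ∀ n, S.a ≤ β n := fun n => S.le_of_mem_I (hβ.mem n)
  have hzz : z - starRingEnd ℂ z ≠ 0 := by
    rw [sub_conj_eq]; simp [hz]
  have hlim0 : Tendsto (fun n => q - p n) atTop (𝓝 0) := by
    simpa only [sub_self] using (tendsto_const_nhds (x := q)).sub hpq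
  -- the limit of the projections is square integrable
  have hq : S.fund z q ∈ S.L2 := by
    refine hβ.mem_L2 (fund_mem_L2Loc z q)
      (stronglyMeasurable_of_continuousOn (continuousOn_of_mem_tLoc (fund_mem_tLoc z q))
        fun t ht => fund_of_notMem z q ht) (fun t ht => fund_of_notMem z q ht) (C := C) fun m => ?_
    refine le_of_tendsto (((continuous_energy_fund z (hβ.mem m)).tendsto q).comp hpq) ?_
    filter_upwards [eventually_ge_atTop m] with n hn
    exact (S.energy_mono (fund_mem_L2Loc z _) (hβ.mem m) (hβ.mem n)
      (hβ.strictMono.monotone hn)).trans (hen n)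
  obtain ⟨u, hu, hua, hu0⟩ := S.exists_mem_tLoc (starRingEnd ℂ z)
    (sub_mem hgl (fund_mem_L2Loc z q)) 0
  have hul := mem_L2Loc_of_mem_tLoc hu
  -- the approximating solutions, which vanish at both ends of a segment
  obtain ⟨c, hc⟩ : ∃ c, c * (z - starRingEnd ℂ z) = 1 := ⟨_, inv_mul_cancel₀ hzz⟩
  set d : ℕ → ℝ → PhaseSpace H Hh := fun n =>
    c • (S.fund z (q - p n) - S.fund (starRingEnd ℂ z) (q - p n)) with hd
  have hdl : ∀ n, d n ∈ S.L2Loc := fun n =>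
    S.L2Loc.smul_mem _ (sub_mem (fund_mem_L2Loc z _) (fund_mem_L2Loc _ _))
  have hhl : ∀ n, g - S.fund z (p n) ∈ S.L2Loc := fun n => sub_mem hgl (fund_mem_L2Loc z _)
  -- Since `c (λ - λ̄) = 1`, applying the expression at `λ̄` to `d n` gives `φ (q - p n)`. Adding `d
  -- n` thus replaces the limit `q` by `p n` in the right-hand side, and `d n` vanishes at `a` and
  -- tends to 0.
  have hun : ∀ n, (u + d n, starRingEnd ℂ z • (u + d n) + (g - S.fund z (p n))) ∈ S.tLoc := by
    intro n
    convert! S.tLoc.add_mem hu (S.tLoc.smul_mem c (S.tLoc.sub_mem (fund_mem_tLoc z (q - p n))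
      (fund_mem_tLoc (starRingEnd ℂ z) (q - p n)))) using 1
    refine Prod.ext rfl ?_
    have e : c • (z - starRingEnd ℂ z) • S.fund z (q - p n) = S.fund z (q - p n) := by
      rw [smul_smul, hc, one_smul]
    change _ = starRingEnd ℂ z • u + (g - S.fund z q) + c • (z • S.fund z (q - p n) -
      starRingEnd ℂ z • S.fund (starRingEnd ℂ z) (q - p n))
    have e' : c • (z • S.fund z (q - p n) -
        starRingEnd ℂ z • S.fund (starRingEnd ℂ z) (q - p n)) =
        S.fund z (q - p n) + starRingEnd ℂ z • d n := by
      have e'' : c • (z • S.fund z (q - p n) -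
          starRingEnd ℂ z • S.fund (starRingEnd ℂ z) (q - p n)) =
          c • (z - starRingEnd ℂ z) • S.fund z (q - p n) + starRingEnd ℂ z • d n := by
        simp only [hd]
        module
      rw [e'', e]
    rw [e', map_sub, smul_add]
    module
  have hda : ∀ n, d n S.a = 0 := fun n => by simp [hd]
  -- The right-hand side is orthogonal to all solutions at `λ` on `[a, β n]`, so every bracket, zero
  -- at `a`, is zero at `β n` as well.
  have hunb : ∀ n, (u + d n) (β n) = 0 := by
    intro n
    refine eq_zero_of_bracket_fund_eq_zero z (hβ.mem n) fun x => ?_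
    have h := bracket_fund_sub (hun n) (hhl n) x S.a_mem_I (hβ.mem n)
    rw [horth n x] at h
    rw [sub_eq_zero.1 h, bracket, Pi.add_apply, hua, hda, add_zero, map_zero, inner_zero_right]
  have hC0 : 0 ≤ C := (S.energy_nonneg S.a_mem_I (hβ.mem 0) (hβa 0) _).trans (hen 0)
  have hhE : ∀ n, S.energy S.a (β n) (g - S.fund z (p n)) ≤ 4 * C := by
    intro n
    have h1 := energy_sub_le hgl (fund_mem_L2Loc z (p n)) S.a_mem_I (hβ.mem n) (hβa n)
    have h2 := energy_le_of_mem_L2 hg S.a_mem_I (hβ.mem n) (hβa n)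
    linarith [hen n]
  have hunE : ∀ n, S.energy S.a (β n) (u + d n) ≤ (z.im ^ 2)⁻¹ * (4 * C) := by
    intro n
    refine (energy_le_of_vanish hz (hun n) (hhl n) (hβ.mem n) ?_ (hunb n)).trans ?_
    · rw [Pi.add_apply, hua, hda, add_zero]
    · gcongr
      exact hhE n
  have hdE : ∀ m, Tendsto (fun n => S.energy S.a (β m) (d n)) atTop (𝓝 0) := by
    intro m
    have h1 := (((continuous_energy_fund (S := S) z (hβ.mem m)).tendsto 0).comp hlim0)
    have h2 := (((continuous_energy_fund (S := S) (starRingEnd ℂ z) (hβ.mem m)).tendsto 0).comp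
      hlim0)
    have h0 : S.energy S.a (β m) 0 = 0 := by simp [energy, quad]
    simp only [map_zero, h0] at h1 h2
    have h3 := ((h1.const_mul 2).add (h2.const_mul 2)).const_mul (‖c‖ ^ 2)
    simp only [mul_zero, add_zero] at h3
    refine squeeze_zero (fun n => S.energy_nonneg S.a_mem_I (hβ.mem m) (hβa m) _) (fun n => ?_) h3
    rw [hd, S.energy_smul]
    exact mul_le_mul_of_nonneg_left (energy_sub_le (fund_mem_L2Loc z _) (fund_mem_L2Loc _ _)
      S.a_mem_I (hβ.mem m) (hβa m)) (by positivity)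
  have hd0 : ∀ t, Tendsto (fun n => d n t) atTop (𝓝 0) := by
    intro t
    have h1 := ((continuous_fund_apply (S := S) z t).tendsto 0).comp hlim0
    have h2 := ((continuous_fund_apply (S := S) (starRingEnd ℂ z) t).tendsto 0).comp hlim0
    have h3 := (h1.sub h2).const_smul c
    simp only [map_zero, Pi.zero_apply, sub_zero, smul_zero] at h3
    exact h3
  -- Write `u = (u + d n) - d n`: the first term has energy bounded uniformly in `n`, and the energy
  -- of the second on a fixed segment tends to 0.
  have huL2 : u ∈ S.L2 := by
    refine hβ.mem_L2 hul (stronglyMeasurable_of_continuousOn (continuousOn_of_mem_tLoc hu) hu0) hu0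
      (C := 2 * ((z.im ^ 2)⁻¹ * (4 * C))) fun m => ?_
    have h1 : Tendsto (fun n => 2 * ((z.im ^ 2)⁻¹ * (4 * C)) + 2 * S.energy S.a (β m) (d n)) atTop
        (𝓝 (2 * ((z.im ^ 2)⁻¹ * (4 * C)))) := by
      simpa using tendsto_const_nhds.add ((hdE m).const_mul 2)
    refine ge_of_tendsto h1 ?_
    filter_upwards [eventually_ge_atTop m] with n hn
    have hml := add_mem hul (hdl n)
    have h2 := energy_sub_le hml (hdl n) S.a_mem_I (hβ.mem m) (hβa m)
    rw [add_sub_cancel_right] at h2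
    have h3 := (S.energy_mono hml (hβ.mem m) (hβ.mem n) (hβ.strictMono.monotone hn)).trans (hunE n)
    linarith
  have huT : (u, starRingEnd ℂ z • u + (g - S.fund z q)) ∈ S.tMax :=
    mem_tMax_of_mem_tLoc hu huL2 (add_mem (S.L2.smul_mem _ huL2) (sub_mem hg hq))
  have hw : c • S.fund z q ∈ S.solSpace z :=
    (S.solSpace z).smul_mem c (mem_tMax_of_mem_tLoc (fund_mem_tLoc z q) hq (S.L2.smul_mem _ hq))
  refine ⟨c • S.fund z q, hw, y' - u - c • S.fund z q, ?_, u, ⟨_, huT, rfl⟩,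
    (by rw [add_sub_cancel, sub_add_cancel]),
    hua, ?_⟩
  -- Applying `t_max - λ̄` to `y' - u - c φ(q)` gives `g - (g - φ(q)) - φ(q) = 0`.
  · have h := S.tMax.sub_mem (S.tMax.sub_mem hyf huT) hw
    have e : c • (z - starRingEnd ℂ z) • S.fund z q = S.fund z q := by
      rw [smul_smul, hc, one_smul]
    have e' : starRingEnd ℂ z • (y' - u - c • S.fund z q) =
        f - (starRingEnd ℂ z • u + (g - S.fund z q)) - z • c • S.fund z q := by
      rw [hgdef]
      nth_rw 2 [← e]
      module
    change (y' - u - c • S.fund z q, starRingEnd ℂ z • (y' - u - c • S.fund z q)) ∈ S.tMax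
    rw [e']
    exact h
  · rintro v ⟨⟨v', k⟩, hv, rfl⟩ l hl
    change Tendsto (bracket u v') S.leftNhdsB (𝓝 l) at hl
    set E := 4 * C + (z.im ^ 2)⁻¹ * (4 * C)
    have hE1 : 4 * C ≤ E := le_add_of_nonneg_right (by positivity)
    have hE2 : (z.im ^ 2)⁻¹ * (4 * C) ≤ E := le_add_of_nonneg_left (by positivity)
    -- The tail estimate holds for `u + d n`, which vanishes at `β n`. It passes to `u` as `n → ∞`
    -- with `m` fixed, because its right side does not depend on `n`.
    have step : ∀ ε > 0, ∀ m, ‖bracket u v' (β m)‖ ≤ (‖z‖ + 2) * (ε * E) / 2 + (‖z‖ + 2) * (ε⁻¹ *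
        (((∫ r in S.I, S.quad v' r) - S.energy S.a (β m) v') +
        ((∫ r in S.I, S.quad k r) - S.energy S.a (β m) k))) / 2 := by
      intro ε hε m
      have hc : Tendsto (fun n => ‖bracket (u + d n) v' (β m)‖) atTop
          (𝓝 ‖bracket u v' (β m)‖) := by
        have h1 : Tendsto (fun n => (u + d n) (β m)) atTop (𝓝 (u (β m))) := by
          simpa using! tendsto_const_nhds.add (hd0 (β m))
        have h2 := ((sigJL H Hh).continuous.tendsto _).comp h1
        exact (tendsto_const_nhds.inner h2).norm
      refine le_of_tendsto hc ?_
      filter_upwards [eventually_ge_atTop m] with n hn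
      exact norm_bracket_le_of_vanish (hun n) (hhl n) hv (hβ.mem m) (hβ.mem n)
        (hβ.strictMono.monotone hn) (hunb n) ((hunE n).trans hE2) ((hhE n).trans hE1) hε
    have hl' : Tendsto (fun m => ‖bracket u v' (β m)‖) atTop (𝓝 ‖l‖) :=
      (hl.comp hβ.tendsto).norm
    have tail : ∀ {k : ℝ → PhaseSpace H Hh}, k ∈ S.L2 →
        Tendsto (fun m => (∫ r in S.I, S.quad k r) - S.energy S.a (β m) k) atTop (𝓝 0) := by
      intro k hk
      simpa only [sub_self] using
        (tendsto_const_nhds (x := ∫ r in S.I, S.quad k r)).sub (hβ.tendsto_energy hk)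
    -- As `m → ∞` the tails disappear and only the term with `ε` is left; `ε → 0` follows.
    have fin : ∀ ε > 0, ‖l‖ ≤ (‖z‖ + 2) * (ε * E) / 2 := by
      intro ε hε
      have h1 := ((((tail hv.1).add (tail hv.2.1)).const_mul ε⁻¹).const_mul (‖z‖ + 2)).div_const 2
      have h2 := (tendsto_const_nhds (x := (‖z‖ + 2) * (ε * E) / 2)).add h1
      simp only [add_zero, mul_zero, zero_div] at h2
      exact le_of_tendsto_of_tendsto' hl' h2 (step ε hε)
    have h0 : Tendsto (fun ε : ℝ => (‖z‖ + 2) * (ε * E) / 2) (𝓝[>] 0) (𝓝 0) := by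
      have : Continuous fun ε : ℝ => (‖z‖ + 2) * (ε * E) / 2 := by fun_prop
      simpa using (this.tendsto 0).mono_left nhdsWithin_le_nhds
    refine norm_le_zero_iff.1 (ge_of_tendsto h0 ?_)
    filter_upwards [self_mem_nhdsWithin] with ε hε using fin ε hε

/-! ### Prescribing the value at the regular endpoint -/

/-- A forcing term supported on one segment steers the solution from `x` to 0. The Gram form is
definite on `[a, β N]`, so the forcing can be chosen among solutions cut off at `β N` in such a way
that its contribution to each bracket cancels the initial one. From `β N` on all brackets with
solutions vanish, and so does `y`. -/
theorem exists_mem_domMax_apply_a (hS : S.IsDefinite) (x : PhaseSpace H Hh) :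
    ∃ y ∈ S.domMax, y S.a = x ∧ ∀ᶠ t in S.leftNhdsB, y t = 0 := by
  obtain ⟨β, hβ⟩ := S.exists_isExhaustion
  obtain ⟨N, hN⟩ := exists_energy_fund_ne_zero hS 0 hβ.strictMono.monotone hβ.mem hβ.ae_le
  have hI := hβ.mem N
  have hab := S.le_of_mem_I hI
  obtain ⟨p, hp⟩ := exists_forall_sesq_eq (S.gram 0 hI) (gram_definite 0 hI (hN N le_rfl))
    (-((innerₛₗ ℂ : PhaseSpace H Hh →ₗ⋆[ℂ] _).flip (sigJ x)))
  have hp' : ∀ x', S.ip S.a (β N) (S.fund 0 x') (S.fund 0 p) = -inner ℂ x' (sigJ x) := hp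
  set h : ℝ → PhaseSpace H Hh := (Icc S.a (β N)).indicator (S.fund 0 p) with hdef
  have hφm : StronglyMeasurable (S.fund 0 p) :=
    stronglyMeasurable_of_continuousOn (continuousOn_of_mem_tLoc (fund_mem_tLoc 0 p))
      fun t ht => fund_of_notMem 0 p ht
  have hcompact : ∀ k : ℝ → PhaseSpace H Hh, k ∈ S.L2Loc → StronglyMeasurable k →
      (∀ t, t ∉ Icc S.a (β N) → k t = 0) → k ∈ S.L2 := by
    intro k hk hkm hk0
    refine ⟨fun t ht => hk0 t fun ht' => ht (S.Icc_subset_I hI ht'), hkm, ?_⟩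
    refine IntegrableOn.of_forall_sdiff_eq_zero (hk.2 _ hI) S.measurableSet_I fun t ht => ?_
    rw [hk0 t ht.2]; simp
  have hhl : h ∈ S.L2Loc := by
    refine ⟨(hφm.indicator measurableSet_Icc).aestronglyMeasurable, fun β' hβ' => ?_⟩
    have e : S.quad h = (Icc S.a (β N)).indicator (S.quad (S.fund 0 p)) := by
      ext t
      by_cases ht : t ∈ Icc S.a (β N)
      · rw [hdef, quad, indicator_of_mem ht, indicator_of_mem ht]; rfl
      · rw [hdef, quad, indicator_of_notMem ht, indicator_of_notMem ht]; simp
    rw [e]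
    exact ((fund_mem_L2Loc 0 p).2 β' hβ').indicator measurableSet_Icc
  have hh : h ∈ S.L2 := hcompact h hhl (hφm.indicator measurableSet_Icc)
    fun t ht => indicator_of_notMem ht _
  obtain ⟨y, hy, hya, hy0⟩ := S.exists_mem_tLoc (starRingEnd ℂ 0) hhl x
  have hvan : ∀ t ∈ S.I, β N ≤ t → y t = 0 := by
    intro t ht hbt
    refine eq_zero_of_bracket_fund_eq_zero 0 ht fun x' => ?_
    have h1 := bracket_fund_sub hy hhl x' S.a_mem_I hI
    have h2 := bracket_fund_sub hy hhl x' hI ht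
    have e1 : S.ip S.a (β N) (S.fund 0 x') h = -inner ℂ x' (sigJ x) := by
      rw [← hp']
      refine intervalIntegral.integral_congr fun r hr => ?_
      rw [uIcc_of_le hab] at hr
      simp only [hdef, indicator_of_mem hr]
    have e2 : S.ip (β N) t (S.fund 0 x') h = 0 := by
      refine intervalIntegral.integral_zero_ae (Eventually.of_forall fun r hr => ?_)
      rw [uIoc_of_le hbt] at hr
      have : r ∉ Icc S.a (β N) := fun h' => absurd h'.2 (not_le.2 hr.1)
      simp only [hdef, indicator_of_notMem this, map_zero, inner_zero_right]
    have e3 : bracket y (S.fund 0 x') S.a = inner ℂ x' (sigJ x) := by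
      rw [bracket, hya, fund_a]
    rw [e1, e3] at h1
    rw [e2] at h2
    linear_combination h1 + h2
  have hyL2 : y ∈ S.L2 := by
    refine hcompact y (mem_L2Loc_of_mem_tLoc hy)
      (stronglyMeasurable_of_continuousOn (continuousOn_of_mem_tLoc hy) hy0) fun t ht => ?_
    by_cases htI : t ∈ S.I
    · exact hvan t htI (not_lt.1 fun hlt => ht ⟨S.le_of_mem_I htI, hlt.le⟩)
    · exact hy0 t htI
  refine ⟨y, ⟨_, mem_tMax_of_mem_tLoc hy hyL2 (add_mem (S.L2.smul_mem _ hyL2) hh), rfl⟩, hya, ?_⟩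
  have hlt : (β N : EReal) < S.b :=
    (EReal.coe_lt_coe_iff.2 (hβ.strictMono (Nat.lt_succ_self N))).trans_le
      (S.le_b_of_mem_I (hβ.mem (N + 1)))
  have hev : ∀ᶠ r : EReal in 𝓝[<] S.b, (β N : EReal) < r ∧ r < S.b :=
    (eventually_nhdsWithin_of_eventually_nhds (lt_mem_nhds hlt)).and self_mem_nhdsWithin
  filter_upwards [tendsto_comap.eventually hev] with t ht
  have h1 : β N < t := EReal.coe_lt_coe_iff.1 ht.1
  exact hvan t (S.mem_I_of_lt (hab.trans h1.le) ht.2) h1.le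

instance leftNhdsB_neBot : S.leftNhdsB.NeBot := by
  obtain ⟨β, hβ⟩ := S.exists_isExhaustion
  exact hβ.tendsto.neBot

end SymmetricSystem

end

/-! ### Linear algebra of the boundary conditions at `a` and of the parameter `τ` -/

section

/-! ### The boundary operator at the regular endpoint -/

section Left

variable {H Hh : Type*} [NormedAddCommGroup H] [InnerProductSpace ℂ H] [FiniteDimensional ℂ H]
  [NormedAddCommGroup Hh] [InnerProductSpace ℂ Hh] [FiniteDimensional ℂ Hh]

open ContinuousLinearMap (adjoint)

namespace LeftOperator

/-- The row `(u₁ u₂ u₃)` as a linear map. -/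
def rowHatL (U : LeftOperator H Hh) : PhaseSpace H Hh →ₗ[ℂ] Hh where
  toFun := U.rowHat
  map_add' x y := by
    simp only [rowHat, WithLp.add_fst, WithLp.add_snd, map_add]; abel
  map_smul' c x := by
    simp only [rowHat, WithLp.smul_fst, WithLp.smul_snd, map_smul, smul_add, RingHom.id_apply]

/-- The row `(u₄ u₅ u₆)` as a linear map. -/
def rowOneL (U : LeftOperator H Hh) : PhaseSpace H Hh →ₗ[ℂ] H where
  toFun := U.rowOne
  map_add' x y := by
    simp only [rowOne, WithLp.add_fst, WithLp.add_snd, map_add]; abel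
  map_smul' c x := by
    simp only [rowOne, WithLp.smul_fst, WithLp.smul_snd, map_smul, smul_add, RingHom.id_apply]

/-- The adjoint `U*` of the boundary operator. -/
def adj (U : LeftOperator H Hh) : Hh × H →ₗ[ℂ] PhaseSpace H Hh where
  toFun k := WithLp.toLp 2 (WithLp.toLp 2 (adjoint U.u₁ k.1 + adjoint U.u₄ k.2,
    adjoint U.u₂ k.1 + adjoint U.u₅ k.2), adjoint U.u₃ k.1 + adjoint U.u₆ k.2)
  map_add' k l := by
    simp only [Prod.fst_add, Prod.snd_add, map_add, ← WithLp.toLp_add, Prod.mk_add_mk]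
    simp only [add_add_add_comm]
  map_smul' c k := by
    simp only [Prod.smul_fst, Prod.smul_snd, map_smul, ← smul_add, ← WithLp.toLp_smul,
      Prod.smul_mk, RingHom.id_apply]

variable (U : LeftOperator H Hh)

theorem inner_adj (x : PhaseSpace H Hh) (k : Hh × H) :
    inner ℂ x (U.adj k) = inner ℂ (U.rowHat x) k.1 + inner ℂ (U.rowOne x) k.2 := by
  rw [inner_phaseSpace]
  change inner ℂ x.fst.fst (adjoint U.u₁ k.1 + adjoint U.u₄ k.2) +
    inner ℂ x.fst.snd (adjoint U.u₂ k.1 + adjoint U.u₅ k.2) +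
    inner ℂ x.snd (adjoint U.u₃ k.1 + adjoint U.u₆ k.2) = _
  simp only [inner_add_right, inner_add_left, rowHat, rowOne,
    ContinuousLinearMap.adjoint_inner_right]
  ring

/-- Together with `rowOne_sigJ_adj` this is the block identity `U J U* = diag(i I, 0)`. The
off-diagonal entry needed here is the adjoint of `rel₂`. -/
theorem rowHat_sigJ_adj (k : Hh × H) : U.rowHat (sigJ (U.adj k)) = Complex.I • k.1 := by
  have h1 := DFunLike.congr_fun U.rel₁ k.1
  have h2 := DFunLike.congr_fun (congrArg adjoint U.rel₂) k.2
  simp only [map_add, map_sub, LinearIsometryEquiv.map_smulₛₗ, ContinuousLinearMap.adjoint_comp,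
    ContinuousLinearMap.adjoint_adjoint, map_zero, Complex.conj_I] at h2
  simp only [add_apply, sub_apply,
    smul_apply, ContinuousLinearMap.comp_apply, ContinuousLinearMap.id_apply,
    zero_apply] at h1 h2
  change U.u₁ (-(adjoint U.u₃ k.1 + adjoint U.u₆ k.2)) +
    U.u₂ (Complex.I • (adjoint U.u₂ k.1 + adjoint U.u₅ k.2)) +
    U.u₃ (adjoint U.u₁ k.1 + adjoint U.u₄ k.2) = _
  simp only [map_neg, map_add, map_smul]
  linear_combination (norm := module) h1 - h2

theorem rowOne_sigJ_adj (k : Hh × H) : U.rowOne (sigJ (U.adj k)) = 0 := by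
  have h1 := DFunLike.congr_fun U.rel₂ k.1
  have h2 := DFunLike.congr_fun U.rel₃ k.2
  simp only [add_apply, sub_apply,
    smul_apply, ContinuousLinearMap.comp_apply,
    zero_apply] at h1 h2
  change U.u₄ (-(adjoint U.u₃ k.1 + adjoint U.u₆ k.2)) +
    U.u₅ (Complex.I • (adjoint U.u₂ k.1 + adjoint U.u₅ k.2)) +
    U.u₆ (adjoint U.u₁ k.1 + adjoint U.u₄ k.2) = _
  simp only [map_neg, map_add, map_smul]
  linear_combination (norm := module) h1 + h2

theorem adj_injective : Function.Injective U.adj := by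
  rw [← LinearMap.ker_eq_bot, LinearMap.ker_eq_bot']
  intro k hk
  obtain ⟨x₀, xh, x₁, h1, h2⟩ := U.surj k.1 k.2
  have h := U.inner_adj (WithLp.toLp 2 (WithLp.toLp 2 (x₀, xh), x₁)) k
  rw [hk, inner_zero_right,
    show U.rowHat (WithLp.toLp 2 (WithLp.toLp 2 (x₀, xh), x₁)) = k.1 from h1,
    show U.rowOne (WithLp.toLp 2 (WithLp.toLp 2 (x₀, xh), x₁)) = k.2 from h2] at h
  have h' := congrArg Complex.re h
  have p1 : 0 ≤ (inner ℂ k.1 k.1).re := inner_self_nonneg (𝕜 := ℂ)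
  have p2 : 0 ≤ (inner ℂ k.2 k.2).re := inner_self_nonneg (𝕜 := ℂ)
  rw [Complex.add_re, Complex.zero_re] at h'
  refine Prod.ext ?_ ?_
  · exact (re_inner_self_nonpos (𝕜 := ℂ)).1 (show (inner ℂ k.1 k.1).re ≤ 0 by linarith)
  · exact (re_inner_self_nonpos (𝕜 := ℂ)).1 (show (inner ℂ k.2 k.2).re ≤ 0 by linarith)

theorem _root_.finrank_phaseSpace : Module.finrank ℂ (PhaseSpace H Hh) =
    Module.finrank ℂ H + Module.finrank ℂ Hh + Module.finrank ℂ H := by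
  rw [(WithLp.linearEquiv 2 ℂ (HZero H Hh × H)).finrank_eq, Module.finrank_prod,
    (WithLp.linearEquiv 2 ℂ (H × Hh)).finrank_eq, Module.finrank_prod]

/-- The second row of `U J U*` is zero, which gives one inclusion. Both spaces have dimension `dim H
+ dim Ĥ`, because `J U*` is injective and the second row of `U` is onto. -/
theorem ker_rowOneL_eq : LinearMap.range (sigJ ∘ₗ U.adj) = LinearMap.ker U.rowOneL := by
  refine Submodule.eq_of_le_of_finrank_eq ?_ ?_
  · rintro _ ⟨k, rfl⟩
    exact U.rowOne_sigJ_adj k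
  · have hinj : Function.Injective (sigJ ∘ₗ U.adj) := by
      refine fun x y hxy => U.adj_injective ?_
      have := congrArg sigJ hxy
      rwa [LinearMap.comp_apply, LinearMap.comp_apply, sigJ_sigJ, sigJ_sigJ, neg_inj] at this
    have hs : Function.Surjective U.rowOneL := fun q => by
      obtain ⟨x₀, xh, x₁, -, h⟩ := U.surj 0 q
      exact ⟨WithLp.toLp 2 (WithLp.toLp 2 (x₀, xh), x₁), h⟩
    have h1 := LinearMap.finrank_range_add_finrank_ker U.rowOneL
    rw [LinearMap.range_eq_top.2 hs, finrank_top, finrank_phaseSpace] at h1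
    rw [LinearMap.finrank_range_of_inj hinj, Module.finrank_prod]
    omega

/-- With `x = J U* k` the block identity evaluates both sides in terms of `k`. Thus `U` need not be
completed by a further row to an operator on the whole space. -/
theorem inner_sigJ_of_rowOne_eq_zero {x : PhaseSpace H Hh} (hx : U.rowOne x = 0) :
    inner ℂ x (sigJ x) = Complex.I * inner ℂ (U.rowHat x) (U.rowHat x) := by
  have hmem : x ∈ LinearMap.range (sigJ ∘ₗ U.adj) := by rw [U.ker_rowOneL_eq]; exact hx
  obtain ⟨k, rfl⟩ := hmem
  simp only [LinearMap.comp_apply] at hx ⊢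
  rw [show sigJ (sigJ (U.adj k)) = -U.adj k from sigJ_sigJ _, inner_neg_right, inner_adj, hx,
    rowHat_sigJ_adj, inner_zero_left, add_zero,
    inner_smul_right, inner_smul_left, Complex.conj_I]
  linear_combination (Complex.I * inner ℂ k.1 k.1) * Complex.I_sq

end LeftOperator

end Left

/-! ### Dissipativity of the boundary parameter -/

section Parameter

variable {V : Type*} [NormedAddCommGroup V] [InnerProductSpace ℂ V]

theorem norm_add_smul_I_sq (x y : V) :
    ‖x + Complex.I • y‖ ^ 2 = ‖x‖ ^ 2 + ‖y‖ ^ 2 - 2 * (inner ℂ x y).im := by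
  have h := norm_add_sq (𝕜 := ℂ) x (Complex.I • y)
  rw [norm_smul, Complex.norm_I, one_mul, inner_smul_right] at h
  rw [h]; simp; ring

/-- Equal Cayley combinations mean `s = x + w` and `t = y + i w` for a single `w`. The claim is then
a linear combination of the hypotheses and `‖x + w - i y‖² ≥ 0`. -/
theorem im_inner_le_of_cayley {x y s t : V} {m : ℝ}
    (hst : s + Complex.I • t = x + Complex.I • y) (h1 : (inner ℂ x s + inner ℂ y t).re + m = 0)
    (h2 : 2 * (inner ℂ s t).im ≤ m) : 2 * (inner ℂ y x).im + m ≤ 0 := by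
  obtain ⟨w, rfl⟩ : ∃ w, s = x + w := ⟨s - x, by abel⟩
  have ht : t = y + Complex.I • w := by
    have e : Complex.I • t = Complex.I • y - w := by
      rw [← sub_eq_iff_eq_add.2 (hst.symm.trans (add_comm _ _))]; abel
    have e2 := congrArg (fun v => (-Complex.I) • v) e
    simp only [smul_smul, smul_sub] at e2
    simpa using e2
  subst ht
  have h3 : 0 ≤ ‖x + w + (-Complex.I) • y‖ ^ 2 := by positivity
  have h4 : ‖x + w + (-Complex.I) • y‖ ^ 2 =
      ‖x + w‖ ^ 2 + ‖y‖ ^ 2 + 2 * (inner ℂ (x + w) y).im := by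
    have := norm_add_smul_I_sq (x + w) (-y)
    rw [smul_neg, ← neg_smul, norm_neg, inner_neg_right, Complex.neg_im] at this
    rw [this]; ring
  have h5 := norm_add_sq (𝕜 := ℂ) x w
  have hyx : (inner ℂ y x).im = -(inner ℂ x y).im := inner_im_symm (𝕜 := ℂ) y x
  have hwy : (inner ℂ w y).im = -(inner ℂ y w).im := inner_im_symm (𝕜 := ℂ) w y
  have hx : (inner ℂ x x).re = ‖x‖ ^ 2 := by rw [inner_self_eq_norm_sq_to_K]; norm_cast
  have hy : (inner ℂ y y).re = ‖y‖ ^ 2 := by rw [inner_self_eq_norm_sq_to_K]; norm_cast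
  have hw : (inner ℂ w w).re = ‖w‖ ^ 2 := by rw [inner_self_eq_norm_sq_to_K]; norm_cast
  simp only [inner_add_left, inner_add_right, inner_smul_right, Complex.add_re, Complex.add_im,
    Complex.I_mul_re, Complex.I_mul_im, hx, hy, hw, hwy, RCLike.re_to_complex] at h1 h2 h4 h5
  rw [hyx]
  linarith

/-- The mirror argument, with `t = y - i w` and the square `‖x + w + i y‖²`. Here `h` and `k` may
differ, and `‖h + k‖² ≥ 0` makes up for it. -/
theorem im_inner_ge_of_cayley {x y s t : V} {W : Type*} [NormedAddCommGroup W]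
    [InnerProductSpace ℂ W] {h k : W}
    (hst : s - Complex.I • t = x - Complex.I • y)
    (h1 : (inner ℂ x s + inner ℂ y t + inner ℂ h k).re = 0)
    (h2 : ‖k‖ ^ 2 ≤ 2 * (inner ℂ s t).im) : 0 ≤ 2 * (inner ℂ y x).im + ‖h‖ ^ 2 := by
  obtain ⟨w, rfl⟩ : ∃ w, s = x + w := ⟨s - x, by abel⟩
  have ht : t = y - Complex.I • w := by
    have e : Complex.I • t = Complex.I • y + w := by
      have := sub_eq_sub_iff_add_eq_add.1 hst
      have e3 : x + (Complex.I • y + w) = x + Complex.I • t := by rw [← this]; abel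
      exact (add_left_cancel e3).symm
    have e2 := congrArg (fun v => (-Complex.I) • v) e
    simp only [smul_smul, smul_add] at e2
    simpa [sub_eq_add_neg] using e2
  subst ht
  have h3 : 0 ≤ ‖x + w + Complex.I • y‖ ^ 2 := by positivity
  have h4 := norm_add_smul_I_sq (x + w) y
  have h5 := norm_add_sq (𝕜 := ℂ) x w
  have h6 := norm_add_sq (𝕜 := ℂ) h k
  have h7 : 0 ≤ ‖h + k‖ ^ 2 := by positivity
  have hyx : (inner ℂ y x).im = -(inner ℂ x y).im := inner_im_symm (𝕜 := ℂ) y x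
  have hwy : (inner ℂ w y).im = -(inner ℂ y w).im := inner_im_symm (𝕜 := ℂ) w y
  have hx : (inner ℂ x x).re = ‖x‖ ^ 2 := by rw [inner_self_eq_norm_sq_to_K]; norm_cast
  have hy : (inner ℂ y y).re = ‖y‖ ^ 2 := by rw [inner_self_eq_norm_sq_to_K]; norm_cast
  have hw : (inner ℂ w w).re = ‖w‖ ^ 2 := by rw [inner_self_eq_norm_sq_to_K]; norm_cast
  simp only [inner_add_left, inner_add_right, inner_sub_right, inner_smul_right, Complex.add_re,
    Complex.add_im, Complex.sub_re, Complex.sub_im,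
    Complex.I_mul_re, Complex.I_mul_im, hx, hy, hw, hwy, RCLike.re_to_complex] at h1 h2 h4 h5 h6
  rw [hyx]
  linarith

open ContinuousLinearMap (adjoint)

namespace BoundaryParameter

variable {E : Type*} [NormedAddCommGroup E] [InnerProductSpace ℂ E] [FiniteDimensional ℂ E]
  {E₁ : Submodule ℂ E}

/-- This translates the operator inequalities in the definition of `τ` into inequalities for values
of the adjoint operators. -/
theorem re_inner_two_opIm_add {F : Type*} [NormedAddCommGroup F] [InnerProductSpace ℂ F]
    [FiniteDimensional ℂ F] {G G' : Type*} [NormedAddCommGroup G] [InnerProductSpace ℂ G]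
    [FiniteDimensional ℂ G] [NormedAddCommGroup G'] [InnerProductSpace ℂ G']
    [FiniteDimensional ℂ G'] (A B : G →L[ℂ] F) (C : G' →L[ℂ] F) (e : F) :
    (inner ℂ (((2 : ℂ) • opIm (A ∘L adjoint B) + C ∘L adjoint C) e) e).re =
      ‖adjoint C e‖ ^ 2 - 2 * (inner ℂ (adjoint B e) (adjoint A e)).im := by
  have h1 : (2 : ℂ) • opIm (A ∘L adjoint B) = (-Complex.I) • (A ∘L adjoint B - B ∘L adjoint A) := by
    rw [opIm, smul_smul, ContinuousLinearMap.adjoint_comp, ContinuousLinearMap.adjoint_adjoint]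
    congr 1
    rw [mul_inv, Complex.inv_I]; ring
  have hi : ∀ (A : G →L[ℂ] F) (u : G), inner ℂ (A u) e = inner ℂ u (adjoint A e) := fun A u =>
    (ContinuousLinearMap.adjoint_inner_right A u e).symm
  rw [h1]
  simp only [add_apply, sub_apply,
    smul_apply, ContinuousLinearMap.comp_apply, inner_add_left, inner_smul_left,
    inner_sub_left, map_neg, Complex.conj_I, neg_neg]
  have hc : inner ℂ (C (adjoint C e)) e = inner ℂ (adjoint C e) (adjoint C e) :=
    (ContinuousLinearMap.adjoint_inner_right C _ e).symm
  rw [hi A, hi B, hc]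
  have h2 : (inner ℂ (adjoint C e) (adjoint C e)).re = ‖adjoint C e‖ ^ 2 := by
    rw [inner_self_eq_norm_sq_to_K]; norm_cast
  have h3 : (inner ℂ (adjoint A e) (adjoint B e)).im =
      -(inner ℂ (adjoint B e) (adjoint A e)).im := inner_im_symm (𝕜 := ℂ) _ _
  rw [Complex.add_re, h2, Complex.I_mul_re, Complex.sub_im, h3]
  ring

theorem exists_adjoint_eq_of_isUnit {X : E →L[ℂ] E} (hX : IsUnit X) (r : E) :
    ∃ e, adjoint X e = r := by
  obtain ⟨Y, hY⟩ := hX.exists_left_inv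
  refine ⟨adjoint Y r, ?_⟩
  have h : adjoint X ∘L adjoint Y = 1 := by
    rw [← ContinuousLinearMap.adjoint_comp]
    change adjoint (Y * X) = 1
    rw [hY]
    exact ContinuousLinearMap.adjoint_id
  exact DFunLike.congr_fun h r

theorem inner_split (h k : E) : inner ℂ h k =
    inner ℂ (E₁.orthogonalProjectionOnto h) (E₁.orthogonalProjectionOnto k) +
      inner ℂ (E₁ᗮ.orthogonalProjectionOnto h) (E₁ᗮ.orthogonalProjectionOnto k) := by
  conv_lhs => rw [← E₁.starProjection_add_starProjection_orthogonal h]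
  rw [inner_add_left]
  simp only [Submodule.starProjection_apply,
    Submodule.inner_orthogonalProjectionOnto_eq_of_mem_left]

variable (τ : BoundaryParameter E₁)

theorem adjoint_comp_subtypeL {F : Type*} [NormedAddCommGroup F] [InnerProductSpace ℂ F]
    [FiniteDimensional ℂ F] (A : E →L[ℂ] F) (K : Submodule ℂ E) (e : F) :
    adjoint (A ∘L K.subtypeL) e = K.orthogonalProjectionOnto (adjoint A e) := by
  rw [ContinuousLinearMap.adjoint_comp, Submodule.adjoint_subtypeL]; rfl

/-- The defining inequality concerns the range of the adjoint pair, whereas `(h₀, h₁)` lies in the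
kernel of the pair. Invertibility of `C₀ - i C₁ P` supplies an `e` for which `(C₀* e, C₁* e)` has
the same Cayley combination as `(h₀, h₁)`, with equal components in `E₁ᗮ`; `im_inner_le_of_cayley`
transfers the sign. -/
theorem relPlus_dissipative {z : ℂ} (hz : 0 < z.im) {h₀ : E} {h₁ : E₁}
    (h : τ.C₀ z h₀ + τ.C₁ z h₁ = 0) :
    2 * (inner ℂ (h₁ : E) h₀).im + ‖E₁ᗮ.starProjection h₀‖ ^ 2 ≤ 0 := by
  set x := E₁.orthogonalProjectionOnto h₀
  set m := E₁ᗮ.orthogonalProjectionOnto h₀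
  obtain ⟨e, he⟩ := exists_adjoint_eq_of_isUnit (τ.isUnit_C z hz)
    ((x : E) + Complex.I • (h₁ : E) + (m : E))
  have he' : adjoint (τ.C₀ z) e + Complex.I • (adjoint (τ.C₁ z) e : E) =
      (x : E) + Complex.I • (h₁ : E) + (m : E) := by
    rw [← he, map_sub, LinearIsometryEquiv.map_smulₛₗ, ContinuousLinearMap.adjoint_comp,
      Submodule.adjoint_orthogonalProjectionOnto]
    simp
  have e1 := congrArg E₁.orthogonalProjectionOnto he'
  have e2 := congrArg E₁ᗮ.orthogonalProjectionOnto he'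
  have p1 : E₁.orthogonalProjectionOnto (m : E) = 0 :=
    E₁.orthogonalProjectionOnto_apply_of_mem_orthogonal m.2
  have p2 : ∀ v : E₁, E₁ᗮ.orthogonalProjectionOnto (v : E) = 0 := fun v =>
    E₁.orthogonalProjectionOnto_orthogonal_apply_eq_zero v.2
  simp only [map_add, map_smul, Submodule.orthogonalProjectionOnto_mem_subspace_eq_self, p1, p2,
    smul_zero, add_zero, zero_add] at e1 e2
  have hpos : 0 ≤ (inner ℂ (((2 : ℂ) • opIm (τ.C₁ z ∘L adjoint (τ.C₀ z ∘L E₁.subtypeL)) +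
      (τ.C₀ z ∘L E₁ᗮ.subtypeL) ∘L adjoint (τ.C₀ z ∘L E₁ᗮ.subtypeL)) e) e).re :=
    (τ.nonneg_C z hz).2 e
  rw [re_inner_two_opIm_add, adjoint_comp_subtypeL, adjoint_comp_subtypeL, e2] at hpos
  -- The kernel of the pair is orthogonal to the range of its adjoint.
  have h0 : inner ℂ h₀ (adjoint (τ.C₀ z) e) + inner ℂ h₁ (adjoint (τ.C₁ z) e) = 0 := by
    rw [ContinuousLinearMap.adjoint_inner_right, ContinuousLinearMap.adjoint_inner_right,
      ← inner_add_left, h, inner_zero_left]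
  rw [inner_split (E₁ := E₁), e2] at h0
  have h0' := congrArg Complex.re h0
  have hm : (inner ℂ m m).re = ‖m‖ ^ 2 := inner_self_eq_norm_sq (𝕜 := ℂ) m
  have e3 : (inner ℂ (h₁ : E) h₀) = inner ℂ h₁ x :=
    (Submodule.inner_orthogonalProjectionOnto_eq_of_mem_left h₁ h₀).symm
  rw [e3]
  refine im_inner_le_of_cayley e1 (m := ‖m‖ ^ 2) ?_ (by linarith)
  simp only [Complex.add_re, Complex.zero_re] at h0' ⊢
  linarith

/-- As in `ℂ₊`, except that `D₀₁ + i D₁` acts on `E₁` only. The component of `D₀* e` in `E₁ᗮ` is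
then unrelated to that of `h₀` and enters separately as `k`. -/
theorem relMinus_accumulative {z : ℂ} (hz : z.im < 0) {h₀ : E} {h₁ : E₁}
    (h : τ.D₀ z h₀ + τ.D₁ z h₁ = 0) :
    0 ≤ 2 * (inner ℂ (h₁ : E) h₀).im + ‖E₁ᗮ.starProjection h₀‖ ^ 2 := by
  set x := E₁.orthogonalProjectionOnto h₀
  set m := E₁ᗮ.orthogonalProjectionOnto h₀
  obtain ⟨e, he⟩ := exists_adjoint_eq_of_isUnit (τ.isUnit_D z hz) (x - Complex.I • h₁)
  have e1 : E₁.orthogonalProjectionOnto (adjoint (τ.D₀ z) e) - Complex.I • adjoint (τ.D₁ z) e =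
      x - Complex.I • h₁ := by
    rw [← he, map_add, LinearIsometryEquiv.map_smulₛₗ, add_apply, adjoint_comp_subtypeL]
    simp [sub_eq_add_neg]
  have hpos : 0 ≤ (inner ℂ ((-((2 : ℂ) • opIm (τ.D₁ z ∘L adjoint (τ.D₀ z ∘L E₁.subtypeL)) +
      (τ.D₀ z ∘L E₁ᗮ.subtypeL) ∘L adjoint (τ.D₀ z ∘L E₁ᗮ.subtypeL))) e) e).re :=
    (τ.nonpos_D z hz).2 e
  rw [neg_apply, inner_neg_left, Complex.neg_re, re_inner_two_opIm_add, adjoint_comp_subtypeL,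
    adjoint_comp_subtypeL] at hpos
  have h0 : inner ℂ h₀ (adjoint (τ.D₀ z) e) + inner ℂ h₁ (adjoint (τ.D₁ z) e) = 0 := by
    rw [ContinuousLinearMap.adjoint_inner_right, ContinuousLinearMap.adjoint_inner_right,
      ← inner_add_left, h, inner_zero_left]
  rw [inner_split (E₁ := E₁)] at h0
  have h0' := congrArg Complex.re h0
  have e3 : (inner ℂ (h₁ : E) h₀) = inner ℂ h₁ x :=
    (Submodule.inner_orthogonalProjectionOnto_eq_of_mem_left h₁ h₀).symm
  rw [e3]
  refine im_inner_ge_of_cayley e1 (h := m) (k := E₁ᗮ.orthogonalProjectionOnto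
    (adjoint (τ.D₀ z) e)) ?_ (by linarith)
  simp only [Complex.add_re, Complex.zero_re] at h0' ⊢
  linarith

/-- The elements orthogonal to `τ₊(λ̄)` in the indefinite metric belong to `τ₋(λ)`. -/
theorem relMinus_of_mem_adjoint {z : ℂ} (hz : z.im < 0) {h₀ : E} {h₁ : E₁}
    (h : (E₁.orthogonalProjectionOnto h₀, (h₁ : E) - Complex.I • E₁ᗮ.starProjection h₀) ∈
      (τ.relPlus (starRingEnd ℂ z)).adjoint) : τ.D₀ z h₀ + τ.D₁ z h₁ = 0 := by
  rw [Submodule.mem_adjoint_iff] at h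
  refine ext_inner_left ℂ fun e => ?_
  have hs := DFunLike.congr_fun (τ.symm_CD (starRingEnd ℂ z) (by simpa using hz)) e
  simp only [Complex.conj_conj, add_apply, sub_apply, smul_apply, ContinuousLinearMap.comp_apply,
    adjoint_comp_subtypeL, zero_apply, Submodule.subtypeL_apply] at hs
  set p := E₁.orthogonalProjectionOnto (adjoint (τ.D₀ z) e) with hp
  set q := E₁ᗮ.orthogonalProjectionOnto (adjoint (τ.D₀ z) e) with hq
  -- By `symm_CD` this pair belongs to `τ₊(λ̄)`. Testing the adjoint condition on it yields the
  -- product of `e` with the left side of the asserted equation.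
  have hmem : (-(adjoint (τ.D₁ z) e : E) + Complex.I • (q : E), p) ∈
      τ.relPlus (starRingEnd ℂ z) := by
    change τ.C₀ _ (-(adjoint (τ.D₁ z) e : E) + Complex.I • (q : E)) + τ.C₁ _ p = 0
    rw [← hs, map_add, map_neg, map_smul]
    abel
  have h' := h _ _ hmem
  have o1 : inner ℂ (q : E) (h₁ : E) = 0 := Submodule.inner_left_of_mem_orthogonal h₁.2 q.2
  have o2 : inner ℂ ((adjoint (τ.D₁ z) e : E₁) : E) (E₁ᗮ.starProjection h₀) = 0 :=
    Submodule.inner_right_of_mem_orthogonal (adjoint (τ.D₁ z) e).2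
      (E₁ᗮ.starProjection_apply_mem h₀)
  have o3 : inner ℂ (q : E) (E₁ᗮ.starProjection h₀) =
      inner ℂ q (E₁ᗮ.orthogonalProjectionOnto h₀) := rfl
  have o4 : inner ℂ ((adjoint (τ.D₁ z) e : E₁) : E) (h₁ : E) = inner ℂ (adjoint (τ.D₁ z) e) h₁ :=
    rfl
  rw [inner_add_left, inner_sub_right, inner_sub_right, inner_neg_left, inner_neg_left,
    inner_smul_left, inner_smul_left, inner_smul_right, inner_smul_right, o1, o2, o3, o4,
    Complex.conj_I] at h'
  rw [inner_zero_right, inner_add_right, ← ContinuousLinearMap.adjoint_inner_left,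
    ← ContinuousLinearMap.adjoint_inner_left, inner_split (E₁ := E₁), ← hp, ← hq]
  linear_combination h' + (inner ℂ q (E₁ᗮ.orthogonalProjectionOnto h₀)) * Complex.I_sq

/-- The row `(C₀, C₁)` is onto `E`, already on the vectors `(e, -i P e)`, because `C₀ - i C₁ P` is
invertible. -/
theorem finrank_relPlus {z : ℂ} (hz : 0 < z.im) :
    Module.finrank ℂ (τ.relPlus z) = Module.finrank ℂ E₁ := by
  have hs : Function.Surjective ((τ.C₀ z).toLinearMap.coprod (τ.C₁ z).toLinearMap) := by
    intro e
    obtain ⟨Y, hY⟩ := (τ.isUnit_C z hz).exists_right_inv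
    have h := DFunLike.congr_fun hY e
    refine ⟨(Y e, -(Complex.I • E₁.orthogonalProjectionOnto (Y e))), ?_⟩
    rw [LinearMap.coprod_apply]
    simpa [sub_eq_add_neg] using! h
  have h1 := LinearMap.finrank_range_add_finrank_ker
    ((τ.C₀ z).toLinearMap.coprod (τ.C₁ z).toLinearMap)
  rw [LinearMap.range_eq_top.2 hs, finrank_top, Module.finrank_prod] at h1
  exact Nat.add_left_cancel h1

theorem finrank_relPlus_adjoint {z : ℂ} (hz : 0 < z.im) :
    Module.finrank ℂ (τ.relPlus z).adjoint = Module.finrank ℂ E := by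
  have h1 := τ.finrank_relPlus hz
  rw [Submodule.adjoint, LinearEquiv.finrank_map_eq]
  have h2 := Submodule.finrank_add_finrank_orthogonal ((τ.relPlus z).map
    ((LinearEquiv.skewSwap ℂ E₁ E).symm.trans
      (WithLp.linearEquiv 2 ℂ (E₁ × E)).symm).toLinearMap)
  rw [LinearEquiv.finrank_map_eq, h1, (WithLp.linearEquiv 2 ℂ (E₁ × E)).finrank_eq,
    Module.finrank_prod] at h2
  exact Nat.add_left_cancel h2

end BoundaryParameter

end Parameter

end

/-! ### The energy identity, the dimension count, and solvability -/

section

/-! ### Boundary data of solutions -/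

namespace SymmetricSystem

section Data

variable {H Hh : Type*} [NormedAddCommGroup H] [InnerProductSpace ℂ H] [FiniteDimensional ℂ H]
  [NormedAddCommGroup Hh] [InnerProductSpace ℂ Hh] [FiniteDimensional ℂ Hh]
  {S : SymmetricSystem H Hh} {E : Type*} [NormedAddCommGroup E] [InnerProductSpace ℂ E]
  [FiniteDimensional ℂ E] {E₁ : Submodule ℂ E} {z : ℂ}

variable (S) in
/-- The evaluation `y ↦ y(a)` on `dom t_max`. -/
def evalA : S.domMax →ₗ[ℂ] PhaseSpace H Hh := LinearMap.proj S.a ∘ₗ S.domMax.subtype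

/-- The boundary data `{Γ_{1a} y, i (Γ̂_a - Γ̂_b) y}`. -/
def leftData (U : LeftOperator H Hh) (Γ : S.RightMap E₁) : S.domMax →ₗ[ℂ] H × Hh :=
  (U.rowOneL ∘ₗ S.evalA).prod (Complex.I • (U.rowHatL ∘ₗ S.evalA - Γ.Γh))

/-- The form at `b` is nondegenerate and `Γ_b` is onto, so each component of the boundary value of
`u` can itself be used as a test vector, first the one of `Γ₀ u` in `E₁`, then the others. -/
theorem RightMap.eq_zero_of_bracket_eq_zero (Γ : S.RightMap E₁) {u : S.domMax}
    (hu : ∀ v ∈ S.domMax, ∀ c, Tendsto (bracket (u : ℝ → PhaseSpace H Hh) v) S.leftNhdsB (𝓝 c) →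
      c = 0) : Γ.Γ₀ u = 0 ∧ Γ.Γh u = 0 ∧ Γ.Γ₁ u = 0 := by
  have h : ∀ v : S.domMax, inner ℂ (Γ.Γ₁ v : E) (Γ.Γ₀ u) - inner ℂ (Γ.Γ₀ v) (Γ.Γ₁ u : E) +
      Complex.I * inner ℂ (E₁ᗮ.starProjection (Γ.Γ₀ v)) (E₁ᗮ.starProjection (Γ.Γ₀ u)) +
      Complex.I * inner ℂ (Γ.Γh v) (Γ.Γh u) = 0 := fun v => hu v v.2 _ (Γ.form u v)
  have hv : ∀ p : E × Hh × E₁, ∃ v, Γ.Γ₀ v = p.1 ∧ Γ.Γh v = p.2.1 ∧ Γ.Γ₁ v = p.2.2 := fun p => by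
    obtain ⟨v, hv⟩ := Γ.surj p
    exact ⟨v, congrArg Prod.fst hv, congrArg (fun q => q.2.1) hv, congrArg (fun q => q.2.2) hv⟩
  refine ⟨?_, ?_, ?_⟩
  · have h1 : E₁.orthogonalProjectionOnto (Γ.Γ₀ u) = 0 := by
      obtain ⟨v, v0, vh, v1⟩ := hv (0, 0, E₁.orthogonalProjectionOnto (Γ.Γ₀ u))
      have := h v
      rw [v0, vh, v1, map_zero, inner_zero_left, inner_zero_left, inner_zero_left, mul_zero,
        add_zero, add_zero, sub_zero, ← Submodule.inner_orthogonalProjectionOnto_eq_of_mem_left]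
        at this
      exact inner_self_eq_zero.1 this
    have h2 : E₁ᗮ.starProjection (Γ.Γ₀ u) = 0 := by
      obtain ⟨v, v0, vh, v1⟩ := hv (E₁ᗮ.starProjection (Γ.Γ₀ u), 0, 0)
      have := h v
      rw [v0, vh, v1, Submodule.starProjection_eq_self_iff.2 (E₁ᗮ.starProjection_apply_mem _),
        Submodule.inner_left_of_mem_orthogonal (Γ.Γ₁ u).2 (E₁ᗮ.starProjection_apply_mem _)] at this
      simpa using! this
    rw [← E₁.starProjection_add_starProjection_orthogonal (Γ.Γ₀ u), h2,
      Submodule.starProjection_apply, h1]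
    simp
  · obtain ⟨v, v0, vh, v1⟩ := hv (0, Γ.Γh u, 0)
    have := h v
    rw [v0, vh, v1] at this
    simpa using this
  · obtain ⟨v, v0, vh, v1⟩ := hv ((Γ.Γ₁ u : E), 0, 0)
    have := h v
    have h0 : E₁ᗮ.starProjection (Γ.Γ₁ u : E) = 0 := by
      rw [Submodule.starProjection_apply,
        E₁.orthogonalProjectionOnto_orthogonal_apply_eq_zero (Γ.Γ₁ u).2]; rfl
    rw [v0, vh, v1, h0] at this
    simpa using this

theorem RightMap.eq_zero_of_eventually_eq_zero (Γ : S.RightMap E₁) {u : S.domMax}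
    (hu : ∀ᶠ t in S.leftNhdsB, (u : ℝ → PhaseSpace H Hh) t = 0) :
    Γ.Γ₀ u = 0 ∧ Γ.Γh u = 0 ∧ Γ.Γ₁ u = 0 := by
  refine Γ.eq_zero_of_bracket_eq_zero fun v _ c hc => tendsto_nhds_unique hc ?_
  refine tendsto_const_nhds.congr' ?_
  filter_upwards [hu] with t ht
  rw [bracket, ht, map_zero, inner_zero_right]

variable (S) in
theorem finiteDimensional_solSpace (z : ℂ) : FiniteDimensional ℂ (S.solSpace z) := by
  refine Module.Finite.of_injective (LinearMap.proj S.a ∘ₗ (S.solSpace z).subtype) ?_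
  rw [← LinearMap.ker_eq_bot, LinearMap.ker_eq_bot']
  intro y hy
  refine Subtype.ext (funext fun t => ?_)
  by_cases ht : t ∈ S.I
  · exact eq_zero_of_mem_tLoc (S.tMax_le_tLoc y.2) hy t ht
  · exact y.2.1.1 t ht

/-- The value at `a` and the boundary values at `b` can be prescribed independently. By
`exists_eq_add_add`, elements of `𝓝_λ` and `𝓝_λ̄` already produce all of them. -/
theorem finrank_le_deficiency_add (hS : S.IsDefinite) (Γ : S.RightMap E₁) (hz : z.im ≠ 0) :
    2 * (Module.finrank ℂ H + Module.finrank ℂ Hh) + Module.finrank ℂ E + Module.finrank ℂ E₁ ≤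
      S.deficiency z + S.deficiency (starRingEnd ℂ z) := by
  have := S.finiteDimensional_solSpace z
  have := S.finiteDimensional_solSpace (starRingEnd ℂ z)
  set bd : S.domMax →ₗ[ℂ] PhaseSpace H Hh × E × Hh × E₁ :=
    S.evalA.prod (Γ.Γ₀.prod (Γ.Γh.prod Γ.Γ₁)) with hbd
  set Φ : S.solSpace z × S.solSpace (starRingEnd ℂ z) →ₗ[ℂ] PhaseSpace H Hh × E × Hh × E₁ :=
    (bd ∘ₗ Submodule.inclusion (S.solSpace_le_domMax z)).coprod
      (bd ∘ₗ Submodule.inclusion (S.solSpace_le_domMax (starRingEnd ℂ z)))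
  have hΦ : Function.Surjective Φ := by
    rintro ⟨x, p⟩
    obtain ⟨y₁, hy₁⟩ := Γ.surj p
    -- `y₂` corrects the value at `a` and vanishes near `b`, so the boundary values of `y₁` at `b`
    -- are kept.
    obtain ⟨y₂, hy₂, ha, hb⟩ := exists_mem_domMax_apply_a hS
      (x - (y₁ : ℝ → PhaseSpace H Hh) S.a)
    obtain ⟨b0, bh, b1⟩ := Γ.eq_zero_of_eventually_eq_zero (u := ⟨y₂, hy₂⟩) hb
    have hy : bd (y₁ + ⟨y₂, hy₂⟩) = (x, p) := by
      have e1 : bd y₁ = ((y₁ : ℝ → PhaseSpace H Hh) S.a, p) := by rw [← hy₁]; rfl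
      have e2 : bd ⟨y₂, hy₂⟩ = (x - (y₁ : ℝ → PhaseSpace H Hh) S.a, 0) := by
        rw [← ha, ← Prod.mk_zero_zero, ← Prod.mk_zero_zero, ← b1]
        nth_rw 1 [← b0]
        rw [← bh, b1]
        exact Prod.ext rfl (Prod.ext rfl (Prod.ext rfl b1))
      rw [map_add, e1, e2]
      simp
    obtain ⟨w, hw, w', hw', u, hu, e, hua, hub⟩ :=
      exists_eq_add_add hS hz (y₁ + ⟨y₂, hy₂⟩ : S.domMax).2
    obtain ⟨u0, uh, u1⟩ := Γ.eq_zero_of_bracket_eq_zero (u := ⟨u, hu⟩) hub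
    have hbu : bd ⟨u, hu⟩ = 0 := Prod.ext hua (Prod.ext u0 (Prod.ext uh u1))
    refine ⟨(⟨w, hw⟩, ⟨w', hw'⟩), ?_⟩
    rw [← hy, show y₁ + ⟨y₂, hy₂⟩ = ⟨w, S.solSpace_le_domMax _ hw⟩ +
      ⟨w', S.solSpace_le_domMax _ hw'⟩ + (⟨u, hu⟩ : S.domMax) from Subtype.ext e,
      map_add, map_add, hbu, add_zero]
    rfl
  have h := LinearMap.finrank_le_finrank_of_surjective hΦ
  simp only [Module.finrank_prod] at h
  rw [finrank_phaseSpace] at h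
  unfold deficiency
  omega

/-- Green's formula for `y` with itself on `[a, β n]`, in the limit. The form at `a` is `i ‖Γ̂_a
y‖²` as `Γ_{1a} y = 0`, and it cancels the term `i ‖Γ̂_b y‖²` at `b`. -/
theorem two_im_mul_integral_quad (U : LeftOperator H Hh) (Γ : S.RightMap E₁) {y : S.domMax}
    (hy : (y : ℝ → PhaseSpace H Hh) ∈ S.solSpace z) (hl : leftData U Γ y = 0) :
    2 * z.im * ∫ t in S.I, S.quad y t =
      2 * (inner ℂ (Γ.Γ₁ y : E) (Γ.Γ₀ y)).im + ‖E₁ᗮ.starProjection (Γ.Γ₀ y)‖ ^ 2 := by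
  obtain ⟨β, hβ⟩ := S.exists_isExhaustion
  have ht : ((y : ℝ → PhaseSpace H Hh), z • (y : ℝ → PhaseSpace H Hh)) ∈ S.tLoc :=
    S.tMax_le_tLoc hy
  have hl1 : S.gammaOneA U y = 0 := congrArg Prod.fst hl
  have hl2 : Γ.Γh y = S.gammaHatA U y := by
    have h : Complex.I • (S.gammaHatA U y - Γ.Γh y) = 0 := congrArg Prod.snd hl
    exact (sub_eq_zero.1 ((smul_eq_zero_iff_right Complex.I_ne_zero).1 h)).symm
  have hzl : z • y.1 ∈ S.L2Loc := S.L2_le_L2Loc hy.2.1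
  have hy1 : y.1 ∈ S.L2 := hy.1
  have hgreen : ∀ n, bracket y.1 y.1 (β n) - bracket y.1 y.1 S.a =
      2 * z.im * Complex.I * S.energy S.a (β n) y := fun n => by
    rw [bracket_sub_bracket ht ht hzl hzl S.a_mem_I (hβ.mem n), S.ip_smul_right, S.ip_smul_left,
      S.ip_self S.a_mem_I (hβ.mem n), ← sub_mul, sub_conj_eq]
  have h1 : Tendsto (fun n => bracket y.1 y.1 (β n) - bracket y.1 y.1 S.a) atTop
      (𝓝 _) := ((Γ.form y y).comp hβ.tendsto).sub_const _
  have h2 : Tendsto (fun n => 2 * z.im * Complex.I * (S.energy S.a (β n) y : ℂ)) atTop (𝓝 _) :=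
    ((Complex.continuous_ofReal.tendsto _).comp (hβ.tendsto_energy hy1)).const_mul _
  rw [funext hgreen] at h1
  have h := tendsto_nhds_unique h2 h1
  have ha : bracket y.1 y.1 S.a =
      Complex.I * inner ℂ (S.gammaHatA U y) (S.gammaHatA U y) :=
    U.inner_sigJ_of_rowOne_eq_zero hl1
  rw [ha, hl2, add_sub_cancel_right, inner_self_eq_norm_sq_to_K] at h
  have h' := congrArg Complex.im h
  have hs : (inner ℂ (Γ.Γ₀ y) (Γ.Γ₁ y : E)).im = -(inner ℂ (Γ.Γ₁ y : E) (Γ.Γ₀ y)).im :=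
    inner_im_symm (𝕜 := ℂ) _ _
  have e1 : (2 * z.im * Complex.I * ((∫ t in S.I, S.quad y t : ℝ) : ℂ)).im =
      2 * z.im * ∫ t in S.I, S.quad y t := by
    simp
  have e2 : (Complex.I * ((‖E₁ᗮ.starProjection (Γ.Γ₀ y)‖ : ℝ) : ℂ) ^ 2).im =
      ‖E₁ᗮ.starProjection (Γ.Γ₀ y)‖ ^ 2 := by
    rw [← Complex.ofReal_pow, Complex.I_mul_im, Complex.ofReal_re]
  rw [e1, Complex.add_im, Complex.sub_im, hs] at h'
  rw [h']
  exact congrArg₂ (· + ·) (by ring) e2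

/-- The energy identity together with the opposite sign at `b` makes the energy zero; positivity of
`Δ` gives `Δ y = 0` a.e., and definiteness applies. -/
theorem eq_zero_of_leftData_eq_zero (hS : S.IsDefinite) (U : LeftOperator H Hh)
    (Γ : S.RightMap E₁) (hz : z.im ≠ 0) {y : S.domMax}
    (hy : (y : ℝ → PhaseSpace H Hh) ∈ S.solSpace z) (hl : leftData U Γ y = 0)
    (hr : z.im * (2 * (inner ℂ (Γ.Γ₁ y : E) (Γ.Γ₀ y)).im +
      ‖E₁ᗮ.starProjection (Γ.Γ₀ y)‖ ^ 2) ≤ 0) : y = 0 := by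
  have h := two_im_mul_integral_quad U Γ hy hl
  have hnn : 0 ≤ ∫ t in S.I, S.quad y t := integral_nonneg_of_ae (S.quad_nonneg y)
  have hz2 : 0 < z.im ^ 2 := by positivity
  have h0 : ∫ t in S.I, S.quad y t = 0 := by
    rw [← h] at hr
    refine le_antisymm (le_of_mul_le_mul_left (a := z.im ^ 2) ?_ hz2) hnn
    linarith
  rw [integral_eq_zero_iff_of_nonneg_ae (S.quad_nonneg y) hy.1.2.2] at h0
  have hΔ : ∀ᵐ t ∂volume.restrict S.I, S.Δ t ((y : ℝ → PhaseSpace H Hh) t) = 0 := by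
    filter_upwards [h0, S.nonneg_Δ] with t ht hp
    exact apply_eq_zero_of_isPositive hp ht
  refine Subtype.ext (funext fun t => ?_)
  by_cases ht : t ∈ S.I
  · exact hS z y hy.2.2.1 hy.2.2.2 hΔ t ht
  · exact hy.1.1 t ht

/-- A boundary mapping at `b` is regular at `λ` if a solution from `𝓛²_Δ` for which it vanishes
together with the data at `a` is trivial. -/
def IsRegularAt (U : LeftOperator H Hh) (Γ : S.RightMap E₁) (z : ℂ) {F : Type*} [AddCommGroup F]
    [Module ℂ F] (R : S.domMax →ₗ[ℂ] F) : Prop :=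
  ∀ y : S.domMax, (y : ℝ → PhaseSpace H Hh) ∈ S.solSpace z → leftData U Γ y = 0 → R y = 0 → y = 0

section Solver

variable {U : LeftOperator H Hh} {Γ : S.RightMap E₁} {F : Type*} [AddCommGroup F] [Module ℂ F]
  {R : S.domMax →ₗ[ℂ] F}

theorem IsRegularAt.eq_of_eq (hR : IsRegularAt U Γ z R) {y w : S.domMax}
    (hy : (y : ℝ → PhaseSpace H Hh) ∈ S.solSpace z)
    (hw : (w : ℝ → PhaseSpace H Hh) ∈ S.solSpace z) (hl : leftData U Γ y = leftData U Γ w)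
    (hr : R y = R w) : y = w :=
  sub_eq_zero.1 (hR (y - w) (sub_mem hy hw) (by rw [map_sub, hl, sub_self])
    (by rw [map_sub, hr, sub_self]))

variable [FiniteDimensional ℂ F]

theorem IsRegularAt.injective (hR : IsRegularAt U Γ z R) : Function.Injective
    ((leftData U Γ).prod R ∘ₗ Submodule.inclusion (S.solSpace_le_domMax z)) := by
  intro y w h
  have := hR.eq_of_eq (y := Submodule.inclusion (S.solSpace_le_domMax z) y)
    (w := Submodule.inclusion (S.solSpace_le_domMax z) w) y.2 w.2
    (congrArg Prod.fst h) (congrArg Prod.snd h)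
  exact Submodule.inclusion_injective _ this

theorem IsRegularAt.deficiency_le (hR : IsRegularAt U Γ z R) :
    S.deficiency z ≤ Module.finrank ℂ H + Module.finrank ℂ Hh + Module.finrank ℂ F := by
  have := S.finiteDimensional_solSpace z
  have h := LinearMap.finrank_le_finrank_of_injective hR.injective
  rwa [Module.finrank_prod, Module.finrank_prod] at h

/-- Between spaces of equal dimension the injective data map is bijective; the operator solution is
its inverse composed with the prescribed data. -/
theorem IsRegularAt.existsUnique (hR : IsRegularAt U Γ z R) (hdim : S.deficiency z =
      Module.finrank ℂ H + Module.finrank ℂ Hh + Module.finrank ℂ F)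
    {K : Type*} [NormedAddCommGroup K] [InnerProductSpace ℂ K] [FiniteDimensional ℂ K]
    (L : K →ₗ[ℂ] H × Hh) (L' : K →ₗ[ℂ] F) :
    ∃! v : S.OpSolution z K, ∀ h, leftData U Γ (v.lin h) = L h ∧ R (v.lin h) = L' h := by
  have := S.finiteDimensional_solSpace z
  have hd : Module.finrank ℂ (S.solSpace z) = Module.finrank ℂ ((H × Hh) × F) := by
    rw [Module.finrank_prod, Module.finrank_prod]; exact hdim
  set e := LinearMap.linearEquivOfInjective _ hR.injective hd with he
  set G : K →ₗ[ℂ] S.solSpace z := e.symm.toLinearMap ∘ₗ L.prod L'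
  refine ⟨⟨fun t => LinearMap.toContinuousLinearMap
    (LinearMap.proj t ∘ₗ (S.solSpace z).subtype ∘ₗ G), fun h => (G h).2⟩, fun h => ?_,
    fun w hw => ?_⟩
  · have h1 : e (G h) = (L h, L' h) := e.apply_symm_apply _
    exact ⟨congrArg Prod.fst h1, congrArg Prod.snd h1⟩
  · have key : ∀ h, w.lin h = Submodule.inclusion (S.solSpace_le_domMax z) (G h) := fun h => by
      have h1 : e (G h) = (L h, L' h) := e.apply_symm_apply _
      refine hR.eq_of_eq (w.mem h) (G h).2 ((hw h).1.trans (congrArg Prod.fst h1).symm)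
        ((hw h).2.trans (congrArg Prod.snd h1).symm)
    refine OpSolution.ext (funext fun t => ContinuousLinearMap.ext fun h => ?_)
    exact congrFun (congrArg Subtype.val (key h)) t

end Solver

end Data

end SymmetricSystem

end

/-! ### Inverting `τ + M`, and the Nevanlinna pair for `E₁ = ⊤` -/

section

/-! ### Inverses of linear relations -/

/-- On `R` the map `(x, y) ↦ y + M x` is injective, since `x = 0` forces `y = 0`, hence bijective by
dimension. `T` is the first component of its inverse. -/
theorem exists_relInv_relAddOp_eq_graph {X Y : Type*} [AddCommGroup X] [Module ℂ X]
    [FiniteDimensional ℂ X] [AddCommGroup Y] [Module ℂ Y] [FiniteDimensional ℂ Y]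
    (R : Submodule ℂ (X × Y)) (M : X →ₗ[ℂ] Y)
    (hinj : ∀ x y, (x, y) ∈ R → y + M x = 0 → x = 0)
    (hdim : Module.finrank ℂ R = Module.finrank ℂ Y) :
    ∃ T : Y →ₗ[ℂ] X, relInv (relAddOp R M) = T.graph ∧
      ∀ k, ∃ y, (T k, y) ∈ R ∧ y + M (T k) = k := by
  set A : R →ₗ[ℂ] Y := (LinearMap.snd ℂ X Y + M ∘ₗ LinearMap.fst ℂ X Y) ∘ₗ R.subtype
  have hA : Function.Injective A := by
    rw [← LinearMap.ker_eq_bot, LinearMap.ker_eq_bot']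
    rintro ⟨⟨x, y⟩, hxy⟩ h
    change y + M x = 0 at h
    have hx := hinj x y hxy h
    subst hx
    rw [map_zero, add_zero] at h
    subst h
    rfl
  set e := LinearMap.linearEquivOfInjective A hA hdim
  have he : ∀ k, (e.symm k).1.2 + M (e.symm k).1.1 = k := fun k => e.apply_symm_apply k
  refine ⟨LinearMap.fst ℂ X Y ∘ₗ R.subtype ∘ₗ e.symm.toLinearMap, ?_, fun k =>
    ⟨(e.symm k).1.2, (e.symm k).2, he k⟩⟩
  ext ⟨k, x⟩
  rw [LinearMap.mem_graph_iff]
  constructor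
  · rintro ⟨_, ⟨⟨x', y⟩, hp, rfl⟩, h⟩
    have h1 : y + M x' = k := congrArg Prod.fst h
    have h2 : x' = x := congrArg Prod.snd h
    subst h2
    have h3 : e.symm k = ⟨(x', y), hp⟩ := by
      rw [LinearEquiv.symm_apply_eq]; exact h1.symm
    change x' = (e.symm k).1.1
    rw [h3]
  · intro h
    change x = (e.symm k).1.1 at h
    subst h
    exact ⟨(_, k), ⟨(e.symm k).1, (e.symm k).2, Prod.ext rfl (he k)⟩, rfl⟩

/-! ### The case of equal deficiency indices -/

namespace BoundaryParameter

open ContinuousLinearMap (adjoint)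

variable {E : Type*} [NormedAddCommGroup E] [InnerProductSpace ℂ E] [FiniteDimensional ℂ E]
  {E₁ : Submodule ℂ E} (τ : BoundaryParameter E₁)

theorem pair₀_of_pos {z : ℂ} (hz : 0 < z.im) :
    τ.pair₀ z = E₁.orthogonalProjectionOnto ∘L τ.C₀ z ∘L E₁.subtypeL := if_pos hz

theorem pair₁_of_pos {z : ℂ} (hz : 0 < z.im) :
    τ.pair₁ z = E₁.orthogonalProjectionOnto ∘L τ.C₁ z := if_pos hz

theorem pair₀_of_neg {z : ℂ} (hz : z.im < 0) : τ.pair₀ z = τ.D₀ z ∘L E₁.subtypeL :=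
  if_neg hz.not_gt

theorem pair₁_of_neg {z : ℂ} (hz : z.im < 0) : τ.pair₁ z = τ.D₁ z := if_neg hz.not_gt

theorem coe_orthogonalProjectionOnto_of_eq_top (hE : E₁ = ⊤) (e : E) :
    (E₁.orthogonalProjectionOnto e : E) = e :=
  Submodule.starProjection_eq_self_iff.2 (hE ▸ Submodule.mem_top)

theorem comp_subtypeL_orthogonal_of_eq_top (hE : E₁ = ⊤) {F : Type*} [NormedAddCommGroup F]
    [InnerProductSpace ℂ F] (A : E →L[ℂ] F) : A ∘L E₁ᗮ.subtypeL = 0 := by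
  ext ⟨x, hx⟩
  rw [hE, Submodule.top_orthogonal_eq_bot, Submodule.mem_bot] at hx
  subst hx
  exact map_zero A

theorem differentiableOn_pair₀ : DifferentiableOn ℂ τ.pair₀ {z | z.im ≠ 0} := by
  intro z hz
  refine DifferentiableAt.differentiableWithinAt ?_
  rcases lt_or_gt_of_ne hz with hz | hz
  · have ho : {z : ℂ | z.im < 0} ∈ 𝓝 z :=
      (isOpen_lt Complex.continuous_im continuous_const).mem_nhds hz
    have h : DifferentiableAt ℂ (fun w => τ.D₀ w ∘L E₁.subtypeL) z :=
      (τ.holo_D₀.differentiableAt ho).clm_comp (differentiableAt_const _)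
    refine h.congr_of_eventuallyEq ?_
    filter_upwards [ho] with w hw using τ.pair₀_of_neg hw
  · have ho : {z : ℂ | 0 < z.im} ∈ 𝓝 z :=
      (isOpen_lt continuous_const Complex.continuous_im).mem_nhds hz
    have h : DifferentiableAt ℂ
        (fun w => E₁.orthogonalProjectionOnto ∘L τ.C₀ w ∘L E₁.subtypeL) z :=
      (differentiableAt_const _).clm_comp
        ((τ.holo_C₀.differentiableAt ho).clm_comp (differentiableAt_const _))
    refine h.congr_of_eventuallyEq ?_
    filter_upwards [ho] with w hw using τ.pair₀_of_pos hw

theorem differentiableOn_pair₁ : DifferentiableOn ℂ τ.pair₁ {z | z.im ≠ 0} := by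
  intro z hz
  refine DifferentiableAt.differentiableWithinAt ?_
  rcases lt_or_gt_of_ne hz with hz | hz
  · have ho : {z : ℂ | z.im < 0} ∈ 𝓝 z :=
      (isOpen_lt Complex.continuous_im continuous_const).mem_nhds hz
    refine (τ.holo_D₁.differentiableAt ho).congr_of_eventuallyEq ?_
    filter_upwards [ho] with w hw using τ.pair₁_of_neg hw
  · have ho : {z : ℂ | 0 < z.im} ∈ 𝓝 z :=
      (isOpen_lt continuous_const Complex.continuous_im).mem_nhds hz
    have h : DifferentiableAt ℂ (fun w => E₁.orthogonalProjectionOnto ∘L τ.C₁ w) z :=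
      (differentiableAt_const _).clm_comp (τ.holo_C₁.differentiableAt ho)
    refine h.congr_of_eventuallyEq ?_
    filter_upwards [ho] with w hw using τ.pair₁_of_pos hw

theorem pair_symm_of_pos (hE : E₁ = ⊤) {z : ℂ} (hz : 0 < z.im) :
    τ.pair₁ z ∘L adjoint (τ.pair₀ (starRingEnd ℂ z)) -
      τ.pair₀ z ∘L adjoint (τ.pair₁ (starRingEnd ℂ z)) = 0 := by
  have hz' : (starRingEnd ℂ z).im < 0 := by simpa using hz
  have h := τ.symm_CD z hz
  rw [comp_subtypeL_orthogonal_of_eq_top hE, ContinuousLinearMap.zero_comp, smul_zero,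
    add_zero] at h
  rw [τ.pair₀_of_pos hz, τ.pair₁_of_pos hz, τ.pair₀_of_neg hz', τ.pair₁_of_neg hz',
    ContinuousLinearMap.comp_assoc, ContinuousLinearMap.comp_assoc, ← ContinuousLinearMap.comp_sub,
    h, ContinuousLinearMap.comp_zero]

theorem pair_symm (hE : E₁ = ⊤) {z : ℂ} (hz : z.im ≠ 0) :
    τ.pair₁ z ∘L adjoint (τ.pair₀ (starRingEnd ℂ z)) -
      τ.pair₀ z ∘L adjoint (τ.pair₁ (starRingEnd ℂ z)) = 0 := by
  rcases lt_or_gt_of_ne hz with hz | hz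
  -- The identity is given in `ℂ₊` only; its adjoint at `λ̄` is the identity at `λ`, up to sign.
  · have h := congrArg adjoint (τ.pair_symm_of_pos hE (z := starRingEnd ℂ z) (by simpa using hz))
    rw [map_sub, ContinuousLinearMap.adjoint_comp, ContinuousLinearMap.adjoint_comp,
      ContinuousLinearMap.adjoint_adjoint, ContinuousLinearMap.adjoint_adjoint, map_zero,
      Complex.conj_conj] at h
    rw [← neg_sub, h, neg_zero]
  · exact τ.pair_symm_of_pos hE hz

open scoped ComplexOrder in
theorem pair_nonneg (hE : E₁ = ⊤) {z : ℂ} (hz : z.im ≠ 0) :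
    ((z.im : ℂ) • opIm (τ.pair₁ z ∘L adjoint (τ.pair₀ z))).IsPositive := by
  rcases lt_or_gt_of_ne hz with hz | hz
  · have h := τ.nonpos_D z hz
    rw [comp_subtypeL_orthogonal_of_eq_top hE, ContinuousLinearMap.zero_comp, add_zero] at h
    rw [τ.pair₀_of_neg hz, τ.pair₁_of_neg hz]
    -- The factor `1 / 2` removes the 2 in `2 Im (D₁ D₀₁*)`, and `-Im λ > 0` compensates the
    -- reversed sign in `ℂ₋`.
    have hc : (0 : ℂ) ≤ ((-z.im / 2 : ℝ) : ℂ) := by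
      rw [Complex.zero_le_real]; linarith
    convert h.smul_of_nonneg hc using 1
    rw [smul_neg, smul_smul, ← neg_smul]
    congr 1
    push_cast; ring
  · have h := τ.nonneg_C z hz
    rw [comp_subtypeL_orthogonal_of_eq_top hE, ContinuousLinearMap.zero_comp, add_zero] at h
    rw [τ.pair₀_of_pos hz, τ.pair₁_of_pos hz]
    have hc : (0 : ℂ) ≤ ((z.im / 2 : ℝ) : ℂ) := by
      rw [Complex.zero_le_real]; linarith
    -- The given operator acts on `E` and the wanted one on `E₁ = ⊤`; conjugation by the projection
    -- passes from one to the other.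
    convert (h.smul_of_nonneg hc).conj_adjoint E₁.orthogonalProjectionOnto using 1
    rw [smul_smul, opIm, opIm]
    simp only [ContinuousLinearMap.adjoint_comp, Submodule.adjoint_orthogonalProjectionOnto,
      Submodule.adjoint_subtypeL, ContinuousLinearMap.adjoint_adjoint]
    have e : ((z.im / 2 : ℝ) : ℂ) * 2 = z.im := by push_cast; ring
    rw [e]
    ext x
    simp [ContinuousLinearMap.comp_apply]

theorem isUnit_pair_of_pos {z : ℂ} (hE : E₁ = ⊤) (hz : 0 < z.im) :
    IsUnit (τ.pair₀ z - Complex.I • τ.pair₁ z) := by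
  obtain ⟨Y, h1, h2⟩ := isUnit_iff_exists.1 (τ.isUnit_C z hz)
  rw [τ.pair₀_of_pos hz, τ.pair₁_of_pos hz]
  have e : E₁.orthogonalProjectionOnto ∘L τ.C₀ z ∘L E₁.subtypeL -
      Complex.I • (E₁.orthogonalProjectionOnto ∘L τ.C₁ z) = E₁.orthogonalProjectionOnto ∘L
        (τ.C₀ z - Complex.I • (τ.C₁ z ∘L E₁.orthogonalProjectionOnto)) ∘L E₁.subtypeL := by
    ext x
    simp
  have hP := coe_orthogonalProjectionOnto_of_eq_top hE
  rw [e, isUnit_iff_exists]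
  refine ⟨E₁.orthogonalProjectionOnto ∘L Y ∘L E₁.subtypeL, ?_, ?_⟩
  · ext x
    have h : (τ.C₀ z - Complex.I • (τ.C₁ z ∘L E₁.orthogonalProjectionOnto)) (Y x) = x :=
      DFunLike.congr_fun h1 (x : E)
    change (E₁.orthogonalProjectionOnto ((τ.C₀ z - Complex.I • (τ.C₁ z ∘L
      E₁.orthogonalProjectionOnto)) (E₁.orthogonalProjectionOnto (Y x) : E)) : E) = x
    rw [hP, hP, h]
  · ext x
    have h : Y ((τ.C₀ z - Complex.I • (τ.C₁ z ∘L E₁.orthogonalProjectionOnto)) x) = x :=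
      DFunLike.congr_fun h2 (x : E)
    change (E₁.orthogonalProjectionOnto (Y (E₁.orthogonalProjectionOnto ((τ.C₀ z - Complex.I •
      (τ.C₁ z ∘L E₁.orthogonalProjectionOnto)) x) : E)) : E) = x
    rw [hP, hP, h]

theorem isNevanlinnaPair (hE : E₁ = ⊤) : IsNevanlinnaPair τ.pair₀ τ.pair₁ where
  holo₀ := τ.differentiableOn_pair₀
  holo₁ := τ.differentiableOn_pair₁
  nonneg _ hz := τ.pair_nonneg hE hz
  symm _ hz := τ.pair_symm hE hz
  isUnit_plus _ hz := τ.isUnit_pair_of_pos hE hz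
  isUnit_minus z hz := by
    rw [τ.pair₀_of_neg hz, τ.pair₁_of_neg hz]
    exact τ.isUnit_D z hz

end BoundaryParameter

end

/-! ### Regular conditions at `b`, the operator solutions, and the formulas for `v_τ` -/

section

/-! ### Regular boundary conditions -/

namespace SymmetricSystem

section Formulas

variable {H Hh : Type*} [NormedAddCommGroup H] [InnerProductSpace ℂ H] [FiniteDimensional ℂ H]
  [NormedAddCommGroup Hh] [InnerProductSpace ℂ Hh] [FiniteDimensional ℂ Hh]
  {S : SymmetricSystem H Hh} {E : Type*} [NormedAddCommGroup E] [InnerProductSpace ℂ E]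
  [FiniteDimensional ℂ E] {E₁ : Submodule ℂ E} {z : ℂ}

/-- The mapping `P_{E₁} Γ_{0b}`. -/
def RightMap.projΓ₀ (Γ : S.RightMap E₁) : S.domMax →ₗ[ℂ] E₁ :=
  E₁.orthogonalProjectionOnto.toLinearMap ∘ₗ Γ.Γ₀

/-- The mapping `C₀(λ) Γ_{0b} + C₁(λ) Γ_{1b}`. -/
def RightMap.plusCondition (Γ : S.RightMap E₁) (τ : BoundaryParameter E₁) (z : ℂ) :
    S.domMax →ₗ[ℂ] E :=
  (τ.C₀ z).toLinearMap ∘ₗ Γ.Γ₀ + (τ.C₁ z).toLinearMap ∘ₗ Γ.Γ₁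

/-- The mapping `D₀(λ) Γ_{0b} + D₁(λ) Γ_{1b}`. -/
def RightMap.minusCondition (Γ : S.RightMap E₁) (τ : BoundaryParameter E₁) (z : ℂ) :
    S.domMax →ₗ[ℂ] E₁ :=
  (τ.D₀ z).toLinearMap ∘ₗ Γ.Γ₀ + (τ.D₁ z).toLinearMap ∘ₗ Γ.Γ₁

variable (U : LeftOperator H Hh) (Γ : S.RightMap E₁)
  (τ : BoundaryParameter E₁)

theorem isRegularAt_Γ₀ (hS : S.IsDefinite) (hz : 0 < z.im) : IsRegularAt U Γ z Γ.Γ₀ :=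
  fun y hy hl hr =>
  eq_zero_of_leftData_eq_zero hS U Γ hz.ne' hy hl (by simp [hr])

theorem isRegularAt_projΓ₀ (hS : S.IsDefinite) (hz : z.im < 0) : IsRegularAt U Γ z Γ.projΓ₀ :=
  fun y hy hl hr => by
    refine eq_zero_of_leftData_eq_zero hS U Γ hz.ne hy hl ?_
    have hr' : E₁.orthogonalProjectionOnto (Γ.Γ₀ y) = 0 := hr
    rw [← Submodule.inner_orthogonalProjectionOnto_eq_of_mem_left, hr', inner_zero_right,
      Complex.zero_im, mul_zero, zero_add]
    exact mul_nonpos_of_nonpos_of_nonneg hz.le (sq_nonneg _)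

theorem isRegularAt_plusCondition (hS : S.IsDefinite) (hz : 0 < z.im) :
    IsRegularAt U Γ z (Γ.plusCondition τ z) := fun _ hy hl hr =>
  eq_zero_of_leftData_eq_zero hS U Γ hz.ne' hy hl
    (mul_nonpos_of_nonneg_of_nonpos hz.le (τ.relPlus_dissipative hz hr))

theorem isRegularAt_minusCondition (hS : S.IsDefinite) (hz : z.im < 0) :
    IsRegularAt U Γ z (Γ.minusCondition τ z) := fun _ hy hl hr =>
  eq_zero_of_leftData_eq_zero hS U Γ hz.ne hy hl
    (mul_nonpos_of_nonpos_of_nonneg hz.le (τ.relMinus_accumulative hz hr))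

/-- The upper bounds at `λ` and `λ̄` add up to the lower bound for the sum of the two dimensions, so
both are equalities. -/
theorem deficiency_of_pos (hS : S.IsDefinite) (U : LeftOperator H Hh) (Γ : S.RightMap E₁)
    (hz : 0 < z.im) : S.deficiency z =
      Module.finrank ℂ H + Module.finrank ℂ Hh + Module.finrank ℂ E := by
  have h1 := (isRegularAt_Γ₀ U Γ hS hz).deficiency_le
  have h2 := (isRegularAt_projΓ₀ U Γ hS (z := starRingEnd ℂ z) (by simpa using hz)).deficiency_le
  have h3 := finrank_le_deficiency_add hS Γ hz.ne'
  omega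

theorem deficiency_of_neg (hS : S.IsDefinite) (U : LeftOperator H Hh) (Γ : S.RightMap E₁)
    (hz : z.im < 0) : S.deficiency z =
      Module.finrank ℂ H + Module.finrank ℂ Hh + Module.finrank ℂ E₁ := by
  have h1 := (isRegularAt_projΓ₀ U Γ hS hz).deficiency_le
  have h2 := (isRegularAt_Γ₀ U Γ hS (z := starRingEnd ℂ z) (by simpa using hz)).deficiency_le
  have h3 := finrank_le_deficiency_add hS Γ hz.ne
  omega

/-! ### Existence and uniqueness of the operator solutions -/

/-- The operator `{h, ĥ} ↦ {-h, ĥ}` from `H₀` to `H ⊕ Ĥ`. -/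
def unitLeftData (H Hh : Type*) [NormedAddCommGroup H] [InnerProductSpace ℂ H]
    [NormedAddCommGroup Hh] [InnerProductSpace ℂ Hh] : HZero H Hh →ₗ[ℂ] H × Hh :=
  (-LinearMap.id).prodMap LinearMap.id ∘ₗ (WithLp.linearEquiv 2 ℂ (H × Hh)).toLinearMap

theorem hasUnitLeftData_iff {v : S.OpSolution z (HZero H Hh)} :
    HasUnitLeftData U Γ v ↔ ∀ h, leftData U Γ (v.lin h) = unitLeftData H Hh h :=
  forall_congr' fun h =>
    (Prod.ext_iff (x := leftData U Γ (v.lin h)) (y := unitLeftData H Hh h)).symm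

theorem hasZeroLeftData_iff {K : Type*} [NormedAddCommGroup K] [InnerProductSpace ℂ K]
    {v : S.OpSolution z K} :
    HasZeroLeftData U Γ v ↔ ∀ h, leftData U Γ (v.lin h) = (0 : K →ₗ[ℂ] H × Hh) h :=
  forall_congr' fun h => (Prod.ext_iff (x := leftData U Γ (v.lin h)) (y := 0)).symm

theorem existsUnique_isVTau (hS : S.IsDefinite) (hz : z.im ≠ 0) :
    ∃! v : S.OpSolution z (HZero H Hh), IsVTau U Γ τ v := by
  rcases lt_or_gt_of_ne hz with hz | hz
  · refine (existsUnique_congr fun v => ?_).1 ((isRegularAt_minusCondition U Γ τ hS hz).existsUnique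
      (deficiency_of_neg hS U Γ hz) (unitLeftData H Hh) 0)
    rw [forall_and, ← hasUnitLeftData_iff]
    exact and_congr_right fun _ => ⟨fun h => ⟨fun hz' => absurd hz' hz.not_gt, fun _ => h⟩,
      fun h => h.2 hz⟩
  · refine (existsUnique_congr fun v => ?_).1 ((isRegularAt_plusCondition U Γ τ hS hz).existsUnique
      (deficiency_of_pos hS U Γ hz) (unitLeftData H Hh) 0)
    rw [forall_and, ← hasUnitLeftData_iff]
    exact and_congr_right fun _ => ⟨fun h => ⟨fun _ => h, fun hz' => absurd hz' hz.not_gt⟩,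
      fun h => h.1 hz⟩

theorem existsUnique_isVZero (hS : S.IsDefinite) (hz : z.im ≠ 0) :
    ∃! v : S.OpSolution z (HZero H Hh), IsVZero U Γ v := by
  rcases lt_or_gt_of_ne hz with hz | hz
  · refine (existsUnique_congr fun v => ?_).1 ((isRegularAt_projΓ₀ U Γ hS hz).existsUnique
      (deficiency_of_neg hS U Γ hz) (unitLeftData H Hh) 0)
    rw [forall_and, ← hasUnitLeftData_iff]
    exact and_congr_right fun _ => ⟨fun h => ⟨fun hz' => absurd hz' hz.not_gt, fun _ => h⟩,
      fun h => h.2 hz⟩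
  · refine (existsUnique_congr fun v => ?_).1 ((isRegularAt_Γ₀ U Γ hS hz).existsUnique
      (deficiency_of_pos hS U Γ hz) (unitLeftData H Hh) 0)
    rw [forall_and, ← hasUnitLeftData_iff]
    exact and_congr_right fun _ => ⟨fun h => ⟨fun _ => h, fun hz' => absurd hz' hz.not_gt⟩,
      fun h => h.1 hz⟩

theorem existsUnique_isUPlus (hS : S.IsDefinite) (hz : 0 < z.im) :
    ∃! u : S.OpSolution z E, IsUPlus U Γ u := by
  refine (existsUnique_congr fun v => ?_).1 ((isRegularAt_Γ₀ U Γ hS hz).existsUnique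
    (deficiency_of_pos hS U Γ hz) 0 LinearMap.id)
  rw [forall_and, ← hasZeroLeftData_iff]
  rfl

theorem existsUnique_isUMinus (hS : S.IsDefinite) (hz : z.im < 0) :
    ∃! u : S.OpSolution z E₁, IsUMinus U Γ u := by
  refine (existsUnique_congr fun v => ?_).1 ((isRegularAt_projΓ₀ U Γ hS hz).existsUnique
    (deficiency_of_neg hS U Γ hz) 0 LinearMap.id)
  rw [forall_and, ← hasZeroLeftData_iff]
  rfl

/-! ### The formulas for `v_τ` -/

theorem OpSolution.lin_mem {K : Type*} [NormedAddCommGroup K] [InnerProductSpace ℂ K]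
    (Y : S.OpSolution z K) (h : K) : (Y.lin h : ℝ → PhaseSpace H Hh) ∈ S.solSpace z := Y.mem h

variable {U Γ τ}

/-- If `(x, y) ∈ τ₊` and `y + M₄₊ x = 0`, then `y = Γ_{1b} u x`, so `u x` satisfies the homogeneous
problem of `τ`; hence `u x = 0` and `x = Γ_{0b} u x = 0`. This is the injectivity required for
inverting `τ₊ + M₄₊`. -/
theorem exists_upper_formula (hS : S.IsDefinite) (hz : 0 < z.im)
    {v v₀ : S.OpSolution z (HZero H Hh)} {u : S.OpSolution z E} (hv : IsVTau U Γ τ v)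
    (hv₀ : IsVZero U Γ v₀) (hu : IsUPlus U Γ u) :
    ∃ T : E₁ →ₗ[ℂ] E, relInv (relAddOp (τ.relPlus z) (weylPlus Γ u)) = T.graph ∧
      ∀ (t : ℝ) (h : HZero H Hh), v.fn t h = v₀.fn t h - u.fn t (T (weylPlus Γ v₀ h)) := by
  have hreg := isRegularAt_plusCondition U Γ τ hS hz
  have hul := (hasZeroLeftData_iff U Γ).1 hu.1
  obtain ⟨T, hT, hk⟩ := exists_relInv_relAddOp_eq_graph (τ.relPlus z) (weylPlus Γ u)
    (fun x y hxy h => by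
      have h1 : Γ.Γ₁ (u.lin x) = y := by
        rw [← sub_eq_zero, ← neg_eq_zero, neg_sub, sub_eq_add_neg]; exact h
      have h0 := hreg (u.lin x) (u.lin_mem x) (hul x) (by
        change τ.C₀ z (Γ.Γ₀ (u.lin x)) + τ.C₁ z (Γ.Γ₁ (u.lin x)) = 0
        rw [hu.2 x, h1]; exact hxy)
      rw [← hu.2 x, h0, map_zero])
    (τ.finrank_relPlus hz)
  refine ⟨T, hT, fun t h => ?_⟩
  obtain ⟨y, hy, hyk⟩ := hk (weylPlus Γ v₀ h)
  set x := T (weylPlus Γ v₀ h)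
  -- The data at `a` agree, and the right side has boundary values `(-x, -y)` with `(x, y) ∈ τ₊`, so
  -- both sides solve the same uniquely solvable problem.
  have key : v.lin h = v₀.lin h - u.lin x := by
    refine hreg.eq_of_eq (v.lin_mem h) (sub_mem (v₀.lin_mem h) (u.lin_mem x)) ?_ ?_
    · rw [map_sub, (hasUnitLeftData_iff U Γ).1 hv.1 h, (hasUnitLeftData_iff U Γ).1 hv₀.1 h, hul x]
      simp
    · have h0 : Γ.Γ₀ (v₀.lin h - u.lin x) = -x := by rw [map_sub, hv₀.2.1 hz, hu.2, zero_sub]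
      have h1 : Γ.Γ₁ (v₀.lin h - u.lin x) = -y := by
        have e : y + -Γ.Γ₁ (u.lin x) = -Γ.Γ₁ (v₀.lin h) := hyk
        rw [map_sub, eq_sub_of_add_eq e]; abel
      have e1 : Γ.plusCondition τ z (v.lin h) = 0 := hv.2.1 hz h
      rw [e1]
      change 0 = τ.C₀ z (Γ.Γ₀ (v₀.lin h - u.lin x)) + τ.C₁ z (Γ.Γ₁ (v₀.lin h - u.lin x))
      have e2 : τ.C₀ z x + τ.C₁ z y = 0 := hy
      rw [h0, h1, map_neg, map_neg, ← neg_add, e2, neg_zero]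
  exact congrFun (congrArg Subtype.val key) t

theorem weylMinus_apply {K : Type*} [NormedAddCommGroup K] [InnerProductSpace ℂ K]
    (Y : S.OpSolution z K) (k : K) : weylMinus Γ Y k = -(Γ.Γ₁ (Y.lin k) : E) +
      Complex.I • E₁ᗮ.starProjection (Γ.Γ₀ (Y.lin k)) := rfl

/-- The argument of `ℂ₊`, with the boundary value recorded as `(P Γ_{0b}, Γ_{1b} - i P^⊥ Γ_{0b})`.
In these coordinates membership in `τ₊*(λ̄)` implies the condition of `τ` by
`relMinus_of_mem_adjoint`, which accounts for the extra term in `M₃₋` and `M₄₋`. -/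
theorem exists_lower_formula (hS : S.IsDefinite) (hz : z.im < 0)
    {v v₀ : S.OpSolution z (HZero H Hh)} {u : S.OpSolution z E₁} (hv : IsVTau U Γ τ v)
    (hv₀ : IsVZero U Γ v₀) (hu : IsUMinus U Γ u) :
    ∃ T : E →ₗ[ℂ] E₁,
      relInv (relAddOp (τ.relPlus (starRingEnd ℂ z)).adjoint (weylMinus Γ u)) = T.graph ∧
      ∀ (t : ℝ) (h : HZero H Hh), v.fn t h = v₀.fn t h - u.fn t (T (weylMinus Γ v₀ h)) := by
  have hreg := isRegularAt_minusCondition U Γ τ hS hz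
  have hul := (hasZeroLeftData_iff U Γ).1 hu.1
  obtain ⟨T, hT, hk⟩ := exists_relInv_relAddOp_eq_graph (τ.relPlus (starRingEnd ℂ z)).adjoint
    (weylMinus Γ u)
    (fun x y hxy h => by
      have h1 : (Γ.Γ₁ (u.lin x) : E) - Complex.I • E₁ᗮ.starProjection (Γ.Γ₀ (u.lin x)) = y := by
        rw [weylMinus_apply] at h
        rw [eq_neg_of_add_eq_zero_left h]; abel
      have h0 := hreg (u.lin x) (u.lin_mem x) (hul x)
        (τ.relMinus_of_mem_adjoint hz (by rw [hu.2 x, h1]; exact hxy))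
      rw [← hu.2 x, h0, map_zero, map_zero])
    (τ.finrank_relPlus_adjoint (by simpa using hz))
  refine ⟨T, hT, fun t h => ?_⟩
  obtain ⟨y, hy, hyk⟩ := hk (weylMinus Γ v₀ h)
  set x := T (weylMinus Γ v₀ h)
  have key : v.lin h = v₀.lin h - u.lin x := by
    refine hreg.eq_of_eq (v.lin_mem h) (sub_mem (v₀.lin_mem h) (u.lin_mem x)) ?_ ?_
    · rw [map_sub, (hasUnitLeftData_iff U Γ).1 hv.1 h, (hasUnitLeftData_iff U Γ).1 hv₀.1 h, hul x]
      simp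
    · have h0 : E₁.orthogonalProjectionOnto (Γ.Γ₀ (v₀.lin h - u.lin x)) = -x := by
        rw [map_sub, map_sub, hv₀.2.2 hz, hu.2, zero_sub]
      have h1 : (Γ.Γ₁ (v₀.lin h - u.lin x) : E) -
          Complex.I • E₁ᗮ.starProjection (Γ.Γ₀ (v₀.lin h - u.lin x)) = -y := by
        rw [eq_sub_of_add_eq hyk, weylMinus_apply, weylMinus_apply]
        simp only [map_sub, Submodule.coe_sub, smul_sub]
        abel
      have e1 : Γ.minusCondition τ z (v.lin h) = 0 := hv.2.2 hz h
      rw [e1]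
      refine (τ.relMinus_of_mem_adjoint hz ?_).symm
      rw [h0, h1]
      exact neg_mem hy
  exact congrFun (congrArg Subtype.val key) t

/-! ### Equal deficiency indices -/

/-- The dimension formulas give `n₊ - n₋ = dim E - dim E₁`. -/
theorem eq_top_of_deficiency_eq (hS : S.IsDefinite) (U : LeftOperator H Hh) (Γ : S.RightMap E₁)
    {zp zm : ℂ} (hp : 0 < zp.im) (hm : zm.im < 0) (h : S.deficiency zp = S.deficiency zm) :
    E₁ = ⊤ := by
  rw [deficiency_of_pos hS U Γ hp, deficiency_of_neg hS U Γ hm] at h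
  exact Submodule.eq_top_of_finrank_eq (Nat.add_left_cancel h).symm

theorem satisfiesRight_iff_pair (hE : E₁ = ⊤) (hz : z.im ≠ 0) {K : Type*} [NormedAddCommGroup K]
    [InnerProductSpace ℂ K] (v : S.OpSolution z K) :
    SatisfiesRight τ Γ v ↔ ∀ h : K,
      τ.pair₀ z (E₁.orthogonalProjectionOnto (Γ.Γ₀ (v.lin h))) + τ.pair₁ z (Γ.Γ₁ (v.lin h)) = 0 := by
  have hP := BoundaryParameter.coe_orthogonalProjectionOnto_of_eq_top hE
  rcases lt_or_gt_of_ne hz with hz | hz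
  · rw [τ.pair₀_of_neg hz, τ.pair₁_of_neg hz]
    simp only [ContinuousLinearMap.comp_apply, Submodule.subtypeL_apply, hP]
    exact ⟨fun h => h.2 hz, fun h => ⟨fun hz' => absurd hz' hz.not_gt, fun _ => h⟩⟩
  · rw [τ.pair₀_of_pos hz, τ.pair₁_of_pos hz]
    simp only [ContinuousLinearMap.comp_apply, Submodule.subtypeL_apply, hP, ← map_add]
    have hinj : ∀ e : E, E₁.orthogonalProjectionOnto e = 0 ↔ e = 0 := fun e => by
      rw [← Submodule.coe_eq_zero, hP]
    simp only [hinj]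
    exact ⟨fun h => h.1 hz, fun h => ⟨fun _ => h, fun hz' => absurd hz' hz.not_gt⟩⟩

end Formulas

end SymmetricSystem

end

end

theorem theorem4p2
    {H Hh E : Type*}
    [NormedAddCommGroup H] [InnerProductSpace ℂ H] [FiniteDimensional ℂ H]
    [NormedAddCommGroup Hh] [InnerProductSpace ℂ Hh] [FiniteDimensional ℂ Hh]
    [NormedAddCommGroup E] [InnerProductSpace ℂ E] [FiniteDimensional ℂ E]
    (S : SymmetricSystem H Hh) (hS : S.IsDefinite)
    (U : LeftOperator H Hh)
    (E₁ : Submodule ℂ E) (Γ : S.RightMap E₁) (τ : BoundaryParameter E₁) :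
    -- existence and uniqueness of `v_τ`
    (∀ z : ℂ, z.im ≠ 0 →
      ∃! v : S.OpSolution z (HZero H Hh), SymmetricSystem.IsVTau U Γ τ v) ∧
    -- the formula in the upper half-plane
    (∀ z : ℂ, 0 < z.im →
      (∃! v₀ : S.OpSolution z (HZero H Hh), SymmetricSystem.IsVZero U Γ v₀) ∧
      (∃! u : S.OpSolution z E, SymmetricSystem.IsUPlus U Γ u) ∧
      ∀ (v v₀ : S.OpSolution z (HZero H Hh)) (u : S.OpSolution z E),
        SymmetricSystem.IsVTau U Γ τ v → SymmetricSystem.IsVZero U Γ v₀ →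
        SymmetricSystem.IsUPlus U Γ u →
        ∃ T : E₁ →ₗ[ℂ] E,
          relInv (relAddOp (τ.relPlus z) (SymmetricSystem.weylPlus Γ u)) = T.graph ∧
          ∀ (t : ℝ) (h : HZero H Hh),
            v.fn t h = v₀.fn t h - u.fn t (T (SymmetricSystem.weylPlus Γ v₀ h))) ∧
    -- the formula in the lower half-plane
    (∀ z : ℂ, z.im < 0 →
      (∃! v₀ : S.OpSolution z (HZero H Hh), SymmetricSystem.IsVZero U Γ v₀) ∧
      (∃! u : S.OpSolution z E₁, SymmetricSystem.IsUMinus U Γ u) ∧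
      ∀ (v v₀ : S.OpSolution z (HZero H Hh)) (u : S.OpSolution z E₁),
        SymmetricSystem.IsVTau U Γ τ v → SymmetricSystem.IsVZero U Γ v₀ →
        SymmetricSystem.IsUMinus U Γ u →
        ∃ T : E →ₗ[ℂ] E₁,
          relInv (relAddOp (τ.relPlus (starRingEnd ℂ z)).adjoint
            (SymmetricSystem.weylMinus Γ u)) = T.graph ∧
          ∀ (t : ℝ) (h : HZero H Hh),
            v.fn t h = v₀.fn t h - u.fn t (T (SymmetricSystem.weylMinus Γ v₀ h))) ∧
    -- the case of equal deficiency indices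
    (∀ zp zm : ℂ, 0 < zp.im → zm.im < 0 → S.deficiency zp = S.deficiency zm →
      E₁ = ⊤ ∧ IsNevanlinnaPair τ.pair₀ τ.pair₁ ∧
      ∀ z : ℂ, z.im ≠ 0 → ∀ v : S.OpSolution z (HZero H Hh),
        (SymmetricSystem.SatisfiesRight τ Γ v ↔
          ∀ h : HZero H Hh,
            τ.pair₀ z (E₁.orthogonalProjectionOnto (Γ.Γ₀ (v.lin h))) +
              τ.pair₁ z (Γ.Γ₁ (v.lin h)) = 0)) := by
  refine ⟨fun z hz => SymmetricSystem.existsUnique_isVTau U Γ τ hS hz, fun z hz =>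
    ⟨SymmetricSystem.existsUnique_isVZero U Γ hS hz.ne',
      SymmetricSystem.existsUnique_isUPlus U Γ hS hz,
      fun _ _ _ hv hv₀ hu => SymmetricSystem.exists_upper_formula hS hz hv hv₀ hu⟩, fun z hz =>
    ⟨SymmetricSystem.existsUnique_isVZero U Γ hS hz.ne,
      SymmetricSystem.existsUnique_isUMinus U Γ hS hz,
      fun _ _ _ hv hv₀ hu => SymmetricSystem.exists_lower_formula hS hz hv hv₀ hu⟩,
    fun zp zm hp hm h => ?_⟩
  have hE := SymmetricSystem.eq_top_of_deficiency_eq hS U Γ hp hm h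
  exact ⟨hE, τ.isNevanlinnaPair hE,
    fun z hz v => SymmetricSystem.satisfiesRight_iff_pair hE hz v⟩
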